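/- Let $n\ge 1$, $0<\alpha<1$, $\beta=1-2\alpha$, $\varepsilon>0$, $\omega>0$. Write points of $\mathbb R^{n+1}$ as $(x,y)\in\mathbb R^n\times\mathbb R$, let $B_1$ be the open unit ball of $\mathbb R^{n+1}$, $B_1^+=B_1\cap\{y>0\}$, and let $$f_\varepsilon(s)=\tfrac1\varepsilon(s-\omega)\ \text{ for } s\ge\omega,\qquad f_\varepsilon(s)=\varepsilon(s-\omega)\ \text{ for } s\le\omega .$$ Let $H^1(\beta,B_1)$ be the space of functions $v\in L^2(B_1^+)\cap L^1_{\rm loc}(B_1)$ that have a weak gradient in $B_1$ with $|y|^{\beta/2}\nabla v\in L^2(B_1)$. For $v\in H^1(\beta,B_1)$ put $$I_\varepsilon(v)=\int_{B_1}|y|^\beta|\nabla v|^2\,dx\,dy+f_\varepsilon\Big(\mathcal L^n\big(\{x\in\mathbb R^n:\ |x|<1,\ v(x,0)>0\}\big)\Big),$$ where $v(\cdot,0)$ is the trace of $v$ on $B_1\cap\{y=0\}$. Let $\varphi$ be a smooth function on the closed half-sphere $\partial B_1\cap\{y\ge 0\}$ (the restriction of a $C^\infty$ function on $\mathbb R^{n+1}$),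 and let $\mathcal K_\varphi$ be the set of all $v\in H^1(\beta,B_1)$ with $v(x,y)=\varphi(x,|y|)$ on $\partial B_1$ in the sense of traces. Then $I_\varepsilon$ has an absolute minimizer in $\mathcal K_\varphi$: there is $u\in\mathcal K_\varphi$ with $$I_\varepsilon(u)\le I_\varepsilon(v)\qquad\text{for all } v\in\mathcal K_\varphi .$$ Moreover, $u$ can be chosen even in $y$. -/

import Mathlib

open MeasureTheory Set
open scoped ContDiff

noncomputable section

namespace FractionalDesign

/-- The Euclidean space `ℝⁿ⁺¹ = ℝⁿ × ℝ`, with points `z = (x, y)`, `x = z.fst`, `y = z.snd`,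
the Euclidean norm and Lebesgue measure. -/
abbrev Ext (n : ℕ) : Type := WithLp 2 (EuclideanSpace ℝ (Fin n) × ℝ)

/-- The point `(x, y)` of `ℝⁿ⁺¹`. -/
def pt {n : ℕ} (x : EuclideanSpace ℝ (Fin n)) (y : ℝ) : Ext n := WithLp.toLp 2 (x, y)

/-- The open upper half-space `{(x, y) : y > 0}`. -/
def upperHalf (n : ℕ) : Set (Ext n) := {z | 0 < z.snd}

/-- The trace `Ω ∩ ℝⁿ` of a set on the hyperplane `{y = 0}`, as a subset of `ℝⁿ`. -/
def slice {n : ℕ} (Ω : Set (Ext n)) : Set (EuclideanSpace ℝ (Fin n)) := {x | pt x 0 ∈ Ω}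

/-- The open unit ball `B₁` of `ℝⁿ⁺¹`. -/
def unitBall (n : ℕ) : Set (Ext n) := Metric.ball 0 1

/-- `ψ ∈ C_c^∞(Ω)`. -/
structure IsTestOn {n : ℕ} (Ω : Set (Ext n)) (ψ : Ext n → ℝ) : Prop where
  smooth : ContDiff ℝ ∞ ψ
  compact : HasCompactSupport ψ
  support : tsupport ψ ⊆ Ω

/-- `G` is the weak (distributional) gradient of `u` in the open set `Ω`. -/
structure IsWeakGradOn {n : ℕ} (Ω : Set (Ext n)) (u : Ext n → ℝ) (G : Ext n → Ext n) : Prop where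
  locInt : LocallyIntegrableOn u Ω
  grad_locInt : LocallyIntegrableOn G Ω
  by_parts : ∀ ψ : Ext n → ℝ, IsTestOn Ω ψ → ∀ e : Ext n,
    ∫ z in Ω, u z * fderiv ℝ ψ z e = -∫ z in Ω, inner ℝ (G z) e * ψ z

open Classical in
/-- The weak gradient of `u` in `Ω` (unique up to null sets of `Ω`; zero if there is none). -/
def weakGrad {n : ℕ} (Ω : Set (Ext n)) (u : Ext n → ℝ) : Ext n → Ext n :=
  if h : ∃ G, IsWeakGradOn Ω u G then h.choose else 0

/-- The weighted space `H¹(β, Ω)`: `u ∈ L²(Ω₊)` and `|y|^{β/2} ∇u ∈ L²(Ω)`. -/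
structure MemH1 {n : ℕ} (β : ℝ) (Ω : Set (Ext n)) (u : Ext n → ℝ) : Prop where
  memLp : MemLp u 2 (volume.restrict (Ω ∩ upperHalf n))
  exists_grad : ∃ G, IsWeakGradOn Ω u G
  grad_memLp : MemLp (fun z => (|z.snd| ^ (β / 2)) • weakGrad Ω u z) 2 (volume.restrict Ω)

/-- `g` is the trace of `u` on `Ω ∩ ℝⁿ`, that is, on the flat boundary of
`Ω₊ = Ω ∩ {y > 0}`, whose outer normal there is `-e_y`: for all `ψ ∈ C_c^∞(Ω)`,
`∫_{Ω₊} (u ∂_y ψ + ψ ∂_y u) = - ∫_{Ω ∩ ℝⁿ} g(x) ψ(x, 0) dx`. -/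
structure IsFlatTrace {n : ℕ} (Ω : Set (Ext n)) (u : Ext n → ℝ)
    (g : EuclideanSpace ℝ (Fin n) → ℝ) : Prop where
  locInt : LocallyIntegrableOn g (slice Ω)
  green : ∀ ψ : Ext n → ℝ, IsTestOn Ω ψ →
    ∫ z in Ω ∩ upperHalf n,
        (u z * fderiv ℝ ψ z (pt 0 1) + inner ℝ (weakGrad Ω u z) (pt 0 1) * ψ z) =
      -∫ x in slice Ω, g x * ψ (pt x 0)

open Classical in
/-- The trace `u(·, 0)` of `u` on `Ω ∩ ℝⁿ` (unique up to null sets; zero if there is none). -/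
def flatTrace {n : ℕ} (Ω : Set (Ext n)) (u : Ext n → ℝ) : EuclideanSpace ℝ (Fin n) → ℝ :=
  if h : ∃ g, IsFlatTrace Ω u g then h.choose else 0

/-- The penalization `f_ε`, with volume budget `w`. -/
def penal (ε w s : ℝ) : ℝ := if w ≤ s then (1 / ε) * (s - w) else ε * (s - w)

/-- The weighted Dirichlet energy `∫_Ω |y|^β |∇u|²`. -/
def energy {n : ℕ} (β : ℝ) (Ω : Set (Ext n)) (u : Ext n → ℝ) : ℝ :=
  ∫ z in Ω, |z.snd| ^ β * ‖weakGrad Ω u z‖ ^ 2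

/-- The volume `ℒⁿ({u > 0} ∩ ℝⁿ ∩ Ω)`, for bounded `Ω`. -/
def posVolume {n : ℕ} (Ω : Set (Ext n)) (u : Ext n → ℝ) : ℝ :=
  (volume (slice Ω ∩ {x | 0 < flatTrace Ω u x})).toReal

/-- The functional `I_ε(u, Ω)`, for bounded `Ω`. -/
def functional {n : ℕ} (β ε w : ℝ) (Ω : Set (Ext n)) (u : Ext n → ℝ) : ℝ :=
  energy β Ω u + penal ε w (posVolume Ω u)

/-- `u = φ` on `∂B₁` in the sense of traces: Green's formula
`∫_{B₁} (u ∂_e ψ + ψ ∂_e u) = ∫_{∂B₁} φ ψ (ζ · e) dσ(ζ)`, with surface measure `σ`, holds for all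
`ψ ∈ C_c^∞(ℝⁿ⁺¹)` and all directions `e`. -/
def HasSphereTrace {n : ℕ} (u φ : Ext n → ℝ) : Prop :=
  ∀ ψ : Ext n → ℝ, IsTestOn univ ψ → ∀ e : Ext n,
    ∫ z in unitBall n,
        (u z * fderiv ℝ ψ z e + inner ℝ (weakGrad (unitBall n) u z) e * ψ z) =
      ∫ ζ : Metric.sphere (0 : Ext n) 1,
        φ ζ * ψ ζ * inner ℝ (ζ : Ext n) e ∂(volume : Measure (Ext n)).toSphere

/-- The even extension `(x, y) ↦ φ(x, |y|)` across `{y = 0}`; it uses `φ` only on `{y ≥ 0}`. -/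
def evenExt {n : ℕ} (φ : Ext n → ℝ) : Ext n → ℝ := fun z => φ (pt z.fst |z.snd|)

/-- The competitors in `B₁`: functions `v ∈ H¹(β, B₁)` which on `∂B₁` equal the datum `φ`, given on
the upper half-sphere and reflected evenly. -/
def Admissible {n : ℕ} (β : ℝ) (φ v : Ext n → ℝ) : Prop :=
  MemH1 β (unitBall n) v ∧ HasSphereTrace v (evenExt φ)

end FractionalDesign

end

/-! The proof is the direct method. Put `β = 1 - 2α`, so that `-1 < β < 1` and both `|y|^β` and
`|y|^{-β}` are integrable on the ball. The penalization is bounded below by `-εω`, hence along a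
minimizing sequence the weighted gradients `|y|^{β/2} ∇v_k` are bounded in `L²(B₁)` and have a
weakly convergent subsequence. The weak limit must be shown to be the weighted gradient of a
competitor, and the positive volume of its trace must not exceed the limit of the positive volumes.
Lower semicontinuity of the norm, together with monotonicity and continuity of `f_ε`, then gives a
minimizer.

Competitors. Fix a compactly supported Lipschitz function `f`, even in `y`, that agrees with the
datum on the sphere. It satisfies Green's formula by the divergence theorem for Lipschitz functions
(`integral_unitBall_lineDeriv`). Subtracting the two Green formulas shows that the boundary
condition on `v` makes `v - f`, extended by zero, weakly differentiable on all of `ℝⁿ⁺¹`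
(`IsDatum.isWeakGradOn_gradDiff`); `IsDatum.admissible` goes back. A function vanishing outside the
ball is minus the upward integral of its vertical derivative (`IsWeakGradOn.ae_eq_vertInt`). The
weak gradient relation thereby becomes a linear identity in the gradient alone, tested against
bounded fields, and so it survives weak limits (`isWeakGradOn_of_tendsto`).

Traces. The value at `(x, 0)` is minus the integral of the gradient along any ray rising from that
point. Averaging over the directions `(ξ, 1)`, `|ξ| < 1`, replaces the ray by a cone and gives a
kernel of size `y^{-n}` (`coneKernel`). The resulting operator is bounded from `L¹` to `L¹`, and its
kernel is bounded for `y > δ`. Weak convergence therefore gives pointwise convergence of the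
contribution of `y > δ`, while that of `0 < y ≤ δ` is uniformly small by Cauchy-Schwarz, because
`|y|^{-β/2}` lies in `L²(B₁)`. So the traces converge in `L¹` (`tendsto_lintegral_coneTrace`),
almost everywhere along a further subsequence, and Fatou's lemma handles the sets where they are
positive.

Evenness. Averaging a competitor with its reflection keeps the trace (`IsFlatTrace.even_part`) and,
by convexity, does not raise the energy (`energy_even_part_le`). -/

namespace FractionalDesign
open Filter Topology
open scoped NNReal

/-! ### Coordinates on `ℝⁿ × ℝ` and the reflection in `{y = 0}` -/

section Coordinates
variable {n : ℕ}

@[simp] lemma pt_fst (x : EuclideanSpace ℝ (Fin n)) (y : ℝ) : (pt x y).fst = x := rfl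

@[simp] lemma pt_snd (x : EuclideanSpace ℝ (Fin n)) (y : ℝ) : (pt x y).snd = y := rfl

@[simp] lemma pt_eta (z : Ext n) : pt z.fst z.snd = z := rfl

lemma norm_pt_sq (x : EuclideanSpace ℝ (Fin n)) (y : ℝ) : ‖pt x y‖ ^ 2 = ‖x‖ ^ 2 + y ^ 2 := by
  rw [WithLp.prod_norm_sq_eq_of_L2]; simp [pt]

lemma norm_sq_eq (z : Ext n) : ‖z‖ ^ 2 = ‖z.fst‖ ^ 2 + z.snd ^ 2 := norm_pt_sq z.fst z.snd

lemma inner_pt (a b : Ext n) : inner ℝ a b = inner ℝ a.fst b.fst + a.snd * b.snd := by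
  rw [WithLp.prod_inner_apply]
  simp [mul_comm]

@[simp] lemma inner_vertical (a : Ext n) : inner ℝ a (pt 0 1) = a.snd := by
  rw [inner_pt]; simp

lemma pt_add (x x' : EuclideanSpace ℝ (Fin n)) (y y' : ℝ) :
    pt x y + pt x' y' = pt (x + x') (y + y') := rfl

lemma pt_smul (c : ℝ) (x : EuclideanSpace ℝ (Fin n)) (y : ℝ) :
    c • pt x y = pt (c • x) (c * y) := rfl

lemma abs_snd_le_norm (z : Ext n) : |z.snd| ≤ ‖z‖ := by
  refine abs_le_of_sq_le_sq ?_ (norm_nonneg _)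
  rw [norm_sq_eq]; nlinarith [sq_nonneg ‖z.fst‖]

lemma norm_fst_le_norm (z : Ext n) : ‖z.fst‖ ≤ ‖z‖ := by
  apply le_of_sq_le_sq _ (norm_nonneg _)
  rw [norm_sq_eq]; nlinarith [sq_nonneg z.snd]

lemma contDiff_pt : ContDiff ℝ ∞ fun p : EuclideanSpace ℝ (Fin n) × ℝ => pt p.1 p.2 :=
  (WithLp.prodContinuousLinearEquiv 2 ℝ (EuclideanSpace ℝ (Fin n)) ℝ).symm.contDiff

@[fun_prop] lemma continuous_pt : Continuous fun p : EuclideanSpace ℝ (Fin n) × ℝ => pt p.1 p.2 :=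
  contDiff_pt.continuous

lemma contDiff_fst' : ContDiff ℝ ∞ fun z : Ext n => z.fst :=
  (WithLp.fstL 2 ℝ (EuclideanSpace ℝ (Fin n)) ℝ).contDiff

lemma contDiff_snd' : ContDiff ℝ ∞ fun z : Ext n => z.snd :=
  (WithLp.sndL 2 ℝ (EuclideanSpace ℝ (Fin n)) ℝ).contDiff

@[fun_prop] lemma continuous_fst' : Continuous fun z : Ext n => z.fst := contDiff_fst'.continuous

@[fun_prop] lemma continuous_snd' : Continuous fun z : Ext n => z.snd := contDiff_snd'.continuous

@[fun_prop] lemma measurable_fst' : Measurable fun z : Ext n => z.fst := continuous_fst'.measurable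

@[fun_prop] lemma measurable_snd' : Measurable fun z : Ext n => z.snd := continuous_snd'.measurable

@[fun_prop] lemma measurable_pt :
    Measurable fun p : EuclideanSpace ℝ (Fin n) × ℝ => pt p.1 p.2 := continuous_pt.measurable

lemma measurePreserving_pt : MeasurePreserving
    (fun p : EuclideanSpace ℝ (Fin n) × ℝ => pt p.1 p.2) :=
  WithLp.volume_preserving_toLp (EuclideanSpace ℝ (Fin n)) ℝ

lemma measurableEmbedding_pt : MeasurableEmbedding
    (fun p : EuclideanSpace ℝ (Fin n) × ℝ => pt p.1 p.2) :=
  (MeasurableEquiv.toLp 2 (EuclideanSpace ℝ (Fin n) × ℝ)).measurableEmbedding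

lemma integral_ext {F : Type*} [NormedAddCommGroup F] [NormedSpace ℝ F] (f : Ext n → F) :
    ∫ z, f z = ∫ p : EuclideanSpace ℝ (Fin n) × ℝ, f (pt p.1 p.2) :=
  (measurePreserving_pt.integral_comp measurableEmbedding_pt f).symm

lemma lintegral_ext (f : Ext n → ENNReal) :
    ∫⁻ z, f z = ∫⁻ p : EuclideanSpace ℝ (Fin n) × ℝ, f (pt p.1 p.2) :=
  (measurePreserving_pt.lintegral_comp_emb measurableEmbedding_pt f).symm

lemma integrable_ext {F : Type*} [NormedAddCommGroup F] (f : Ext n → F) :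
    Integrable f ↔ Integrable fun p : EuclideanSpace ℝ (Fin n) × ℝ => f (pt p.1 p.2) :=
  (measurePreserving_pt.integrable_comp_emb measurableEmbedding_pt).symm

lemma measurableSet_upperHalf : MeasurableSet (upperHalf n) :=
  measurableSet_lt measurable_const measurable_snd'

lemma isOpen_unitBall : IsOpen (unitBall n) := Metric.isOpen_ball

lemma measurableSet_unitBall : MeasurableSet (unitBall n) := isOpen_unitBall.measurableSet

lemma mem_unitBall {z : Ext n} : z ∈ unitBall n ↔ ‖z‖ < 1 := by simp [unitBall]

lemma slice_unitBall : slice (unitBall n) = Metric.ball 0 1 := by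
  ext x
  simp only [slice, mem_ofPred_eq, mem_unitBall, Metric.mem_ball, dist_zero_right]
  have := norm_pt_sq x 0
  simp only [ne_eq, OfNat.ofNat_ne_zero, not_false_eq_true, zero_pow, add_zero] at this
  rw [(sq_eq_sq₀ (norm_nonneg _) (norm_nonneg _)).1 this]

/-- The reflection `(x, y) ↦ (x, -y)`. -/
noncomputable def reflect (n : ℕ) : Ext n ≃ₗᵢ[ℝ] Ext n where
  toFun z := pt z.fst (-z.snd)
  invFun z := pt z.fst (-z.snd)
  map_add' a b := by
    change pt (a.fst + b.fst) (-(a.snd + b.snd)) = _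
    rw [pt_add, neg_add]
  map_smul' c a := by
    change pt (c • a.fst) (-(c * a.snd)) = c • _
    rw [pt_smul, mul_neg]
  left_inv z := by simp
  right_inv z := by simp
  norm_map' z := by
    have := norm_pt_sq z.fst (-z.snd)
    rw [neg_sq, ← norm_sq_eq] at this
    exact (sq_eq_sq₀ (norm_nonneg _) (norm_nonneg _)).1 this

lemma reflect_apply (z : Ext n) : reflect n z = pt z.fst (-z.snd) := rfl

@[simp] lemma reflect_fst (z : Ext n) : (reflect n z).fst = z.fst := rfl

@[simp] lemma reflect_pt (x : EuclideanSpace ℝ (Fin n)) (y : ℝ) :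
    reflect n (pt x y) = pt x (-y) := rfl

@[simp] lemma reflect_snd (z : Ext n) : (reflect n z).snd = -z.snd := rfl

@[simp] lemma reflect_reflect (z : Ext n) : reflect n (reflect n z) = z := by
  simp [reflect_apply]

lemma measurePreserving_reflect : MeasurePreserving (reflect n) :=
  (reflect n).measurePreserving

lemma measurableEmbedding_reflect : MeasurableEmbedding (reflect n) :=
  (reflect n).toHomeomorph.measurableEmbedding

lemma inner_reflect (a b : Ext n) : inner ℝ (reflect n a) b = inner ℝ a (reflect n b) := by
  rw [inner_pt, inner_pt]; simp

lemma reflect_mem_unitBall {z : Ext n} : reflect n z ∈ unitBall n ↔ z ∈ unitBall n := by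
  simp [mem_unitBall]

lemma preimage_reflect_unitBall : reflect n ⁻¹' unitBall n = unitBall n := by
  ext z; exact reflect_mem_unitBall

end Coordinates

/-! ### Weak gradients: uniqueness and elementary operations -/

section WeakGradient
variable {n : ℕ} {Ω : Set (Ext n)}

lemma IsTestOn.mono {Ω' : Set (Ext n)} {ψ : Ext n → ℝ} (h : IsTestOn Ω ψ) (hs : Ω ⊆ Ω') :
    IsTestOn Ω' ψ := ⟨h.smooth, h.compact, h.support.trans hs⟩

lemma IsTestOn.eq_zero {ψ : Ext n → ℝ} (h : IsTestOn Ω ψ) {z : Ext n} (hz : z ∉ Ω) : ψ z = 0 :=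
  image_eq_zero_of_notMem_tsupport fun h' => hz (h.support h')

lemma IsTestOn.fderiv_eq_zero {ψ : Ext n → ℝ} (h : IsTestOn Ω ψ) {z : Ext n} (hz : z ∉ Ω) :
    fderiv ℝ ψ z = 0 := by
  by_contra hne
  exact hz (h.support (support_fderiv_subset ℝ hne))

lemma IsTestOn.continuous_fderiv {ψ : Ext n → ℝ} (h : IsTestOn Ω ψ) (e : Ext n) :
    Continuous fun z => fderiv ℝ ψ z e :=
  (h.smooth.continuous_fderiv (by simp)).clm_apply continuous_const

lemma IsTestOn.tsupport_fderiv {ψ : Ext n → ℝ} (h : IsTestOn Ω ψ) (e : Ext n) :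
    tsupport (fun z => fderiv ℝ ψ z e) ⊆ Ω :=
  (closure_minimal (fun z (hz : fderiv ℝ ψ z e ≠ 0) => support_fderiv_subset ℝ
      (show fderiv ℝ ψ z ≠ 0 from fun h0 => hz (by simp [h0])))
    (isClosed_tsupport ψ)).trans h.support

lemma IsTestOn.hasCompactSupport_fderiv {ψ : Ext n → ℝ} (h : IsTestOn Ω ψ) (e : Ext n) :
    HasCompactSupport fun z => fderiv ℝ ψ z e := h.compact.fderiv_apply ℝ e

lemma IsTestOn.comp_reflect {ψ : Ext n → ℝ} (h : IsTestOn Ω ψ) (hΩ : reflect n ⁻¹' Ω = Ω) :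
    IsTestOn Ω (ψ ∘ reflect n) where
  smooth := h.smooth.comp (reflect n).contDiff
  compact := h.compact.comp_homeomorph (reflect n).toHomeomorph
  support := by
    have := tsupport_comp_subset_preimage ψ (reflect n).continuous
    exact this.trans ((preimage_mono h.support).trans hΩ.le)

lemma fderiv_comp_reflect (ψ : Ext n → ℝ) (z e : Ext n) :
    fderiv ℝ (ψ ∘ reflect n) z e = fderiv ℝ ψ (reflect n z) (reflect n e) := by
  have := (reflect n).toContinuousLinearEquiv.comp_right_fderiv (f := ψ) (x := z)
  have h2 := congrArg (fun L => L e) this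
  simpa using h2

lemma integrable_mul_of_hasCompactSupport {u h : Ext n → ℝ} (hu : LocallyIntegrableOn u Ω)
    (hh : Continuous h) (hc : HasCompactSupport h) (hs : tsupport h ⊆ Ω) :
    Integrable fun z => u z * h z := by
  have h1 : IntegrableOn u (tsupport h) := hu.integrableOn_compact_subset hs hc
  have h2 := h1.mul_continuousOn hh.continuousOn hc
  refine (integrableOn_iff_integrable_of_support_subset ?_).1 h2
  exact (Function.support_mul_subset_right _ _).trans (subset_tsupport h)

lemma LocallyIntegrableOn.inner_const' {G : Ext n → Ext n} (hG : LocallyIntegrableOn G Ω)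
    (e : Ext n) : LocallyIntegrableOn (fun z => inner ℝ (G z) e) Ω := by
  intro x hx
  obtain ⟨t, ht, hi⟩ := hG x hx
  exact ⟨t, ht, hi.inner_const e⟩

lemma IsWeakGradOn.integrable_left {u : Ext n → ℝ} {G : Ext n → Ext n} (h : IsWeakGradOn Ω u G)
    {ψ : Ext n → ℝ} (hψ : IsTestOn Ω ψ) (e : Ext n) :
    Integrable fun z => u z * fderiv ℝ ψ z e :=
  integrable_mul_of_hasCompactSupport h.locInt (hψ.continuous_fderiv e)
    (hψ.hasCompactSupport_fderiv e) (hψ.tsupport_fderiv e)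

lemma IsWeakGradOn.integrable_right {u : Ext n → ℝ} {G : Ext n → Ext n} (h : IsWeakGradOn Ω u G)
    {ψ : Ext n → ℝ} (hψ : IsTestOn Ω ψ) (e : Ext n) :
    Integrable fun z => inner ℝ (G z) e * ψ z :=
  integrable_mul_of_hasCompactSupport (LocallyIntegrableOn.inner_const' h.grad_locInt e)
    hψ.smooth.continuous hψ.compact hψ.support

lemma IsWeakGradOn.ae_eq {u : Ext n → ℝ} {G G' : Ext n → Ext n} (hΩ : IsOpen Ω)
    (h : IsWeakGradOn Ω u G) (h' : IsWeakGradOn Ω u G') : G =ᵐ[volume.restrict Ω] G' := by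
  have key : ∀ᵐ z ∂(volume : Measure (Ext n)), z ∈ Ω → (G - G') z = 0 := by
    refine hΩ.ae_eq_zero_of_integral_contDiff_smul_eq_zero
      (h.grad_locInt.sub h'.grad_locInt) fun g hg hgc hgs => ?_
    have ht : IsTestOn Ω g := ⟨hg, hgc, hgs⟩
    have hi : ∀ {H : Ext n → Ext n}, LocallyIntegrableOn H Ω → Integrable fun z => g z • H z := by
      intro H hH
      have h1 : IntegrableOn H (tsupport g) := hH.integrableOn_compact_subset hgs hgc
      have h2 := h1.continuousOn_smul hg.continuous.continuousOn hgc
      refine (integrableOn_iff_integrable_of_support_subset ?_).1 h2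
      exact (Function.support_smul_subset_left _ _).trans (subset_tsupport g)
    refine ext_inner_right ℝ fun e => ?_
    have hsub : ∀ z, g z • (G - G') z = g z • G z - g z • G' z := fun z => smul_sub _ _ _
    simp_rw [hsub]
    rw [integral_sub (hi h.grad_locInt) (hi h'.grad_locInt), inner_sub_left, inner_zero_left,
      real_inner_comm, real_inner_comm e, ← integral_inner (hi h.grad_locInt),
      ← integral_inner (hi h'.grad_locInt)]
    have e1 := h.by_parts g ht e
    have e2 := h'.by_parts g ht e
    rw [e1] at e2
    have hz : ∀ (H : Ext n → Ext n), ∫ z in Ω, inner ℝ (H z) e * g z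
        = ∫ z, inner ℝ e (g z • H z) := by
      intro H
      rw [setIntegral_eq_integral_of_forall_compl_eq_zero fun z hz => by simp [ht.eq_zero hz]]
      congr 1; ext z; rw [inner_smul_right, real_inner_comm, mul_comm]
    rw [← hz, ← hz]; linarith
  rw [EventuallyEq, ae_restrict_iff' hΩ.measurableSet]
  filter_upwards [key] with z hz hzΩ
  exact sub_eq_zero.1 (hz hzΩ)

lemma isWeakGradOn_weakGrad {u : Ext n → ℝ} (h : ∃ G, IsWeakGradOn Ω u G) :
    IsWeakGradOn Ω u (weakGrad Ω u) := by
  rw [weakGrad, dif_pos h]; exact h.choose_spec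

/-- Since `weakGrad` is an arbitrary choice, this is what allows energies and Green formulas to be
computed with any explicit weak gradient. -/
lemma IsWeakGradOn.weakGrad_ae_eq {u : Ext n → ℝ} {G : Ext n → Ext n} (hΩ : IsOpen Ω)
    (h : IsWeakGradOn Ω u G) : weakGrad Ω u =ᵐ[volume.restrict Ω] G :=
  (isWeakGradOn_weakGrad ⟨G, h⟩).ae_eq hΩ h

lemma IsWeakGradOn.congr {u u' : Ext n → ℝ} {G G' : Ext n → Ext n} (h : IsWeakGradOn Ω u G)
    (hΩ : MeasurableSet Ω) (hu : ∀ z ∈ Ω, u z = u' z) (hG : ∀ z ∈ Ω, G z = G' z) :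
    IsWeakGradOn Ω u' G' where
  locInt := by
    intro x hx
    obtain ⟨t, ht, hi⟩ := h.locInt x hx
    refine ⟨t ∩ Ω, inter_mem ht self_mem_nhdsWithin, ?_⟩
    have := hi.mono_set (inter_subset_left (t := Ω))
    refine this.congr ?_
    have : ∀ᵐ z ∂(volume.restrict Ω), z ∈ Ω := ae_restrict_mem hΩ
    have := ae_mono (Measure.restrict_mono_set volume (inter_subset_right (s := t))) this
    filter_upwards [this] with z hz using hu z hz
  grad_locInt := by
    intro x hx
    obtain ⟨t, ht, hi⟩ := h.grad_locInt x hx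
    refine ⟨t ∩ Ω, inter_mem ht self_mem_nhdsWithin, ?_⟩
    have := hi.mono_set (inter_subset_left (t := Ω))
    refine this.congr ?_
    have : ∀ᵐ z ∂(volume.restrict Ω), z ∈ Ω := ae_restrict_mem hΩ
    have := ae_mono (Measure.restrict_mono_set volume (inter_subset_right (s := t))) this
    filter_upwards [this] with z hz using hG z hz
  by_parts ψ hψ e := by
    have e1 := h.by_parts ψ hψ e
    have e2 : ∫ z in Ω, u' z * fderiv ℝ ψ z e = ∫ z in Ω, u z * fderiv ℝ ψ z e :=
      setIntegral_congr_fun hΩ fun z hz => by simp only [hu z hz]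
    have e3 : ∫ z in Ω, inner ℝ (G' z) e * ψ z = ∫ z in Ω, inner ℝ (G z) e * ψ z :=
      setIntegral_congr_fun hΩ fun z hz => by simp only [hG z hz]
    rw [e2, e3, e1]

lemma IsWeakGradOn.mono {Ω' : Set (Ext n)} {u : Ext n → ℝ} {G : Ext n → Ext n}
    (h : IsWeakGradOn Ω u G) (hs : Ω' ⊆ Ω) : IsWeakGradOn Ω' u G where
  locInt := h.locInt.mono_set hs
  grad_locInt := h.grad_locInt.mono_set hs
  by_parts ψ hψ e := by
    have e1 := h.by_parts ψ (hψ.mono hs) e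
    rw [setIntegral_eq_integral_of_forall_compl_eq_zero
        fun z hz => by simp [(hψ.mono hs).fderiv_eq_zero hz],
      setIntegral_eq_integral_of_forall_compl_eq_zero
        fun z hz => by simp [(hψ.mono hs).eq_zero hz]] at e1
    rw [setIntegral_eq_integral_of_forall_compl_eq_zero
        fun z hz => by simp [hψ.fderiv_eq_zero hz],
      setIntegral_eq_integral_of_forall_compl_eq_zero fun z hz => by simp [hψ.eq_zero hz]]
    exact e1

lemma IsWeakGradOn.add {u v : Ext n → ℝ} {G H : Ext n → Ext n} (hu : IsWeakGradOn Ω u G)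
    (hv : IsWeakGradOn Ω v H) : IsWeakGradOn Ω (fun z => u z + v z) (fun z => G z + H z) where
  locInt := hu.locInt.add hv.locInt
  grad_locInt := hu.grad_locInt.add hv.grad_locInt
  by_parts ψ hψ e := by
    simp only [add_mul, inner_add_left]
    rw [integral_add (hu.integrable_left hψ e).integrableOn (hv.integrable_left hψ e).integrableOn,
      integral_add (hu.integrable_right hψ e).integrableOn
        (hv.integrable_right hψ e).integrableOn, hu.by_parts ψ hψ e, hv.by_parts ψ hψ e]
    ring

lemma LocallyIntegrableOn.const_smul' {F : Type*} [NormedAddCommGroup F] [NormedSpace ℝ F]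
    {f : Ext n → F} (hf : LocallyIntegrableOn f Ω) (c : ℝ) :
    LocallyIntegrableOn (fun z => c • f z) Ω := by
  intro x hx
  obtain ⟨t, ht, hi⟩ := hf x hx
  exact ⟨t, ht, hi.smul c⟩

lemma IsWeakGradOn.const_smul {u : Ext n → ℝ} {G : Ext n → Ext n} (hu : IsWeakGradOn Ω u G)
    (c : ℝ) : IsWeakGradOn Ω (fun z => c * u z) (fun z => c • G z) where
  locInt := LocallyIntegrableOn.const_smul' hu.locInt c
  grad_locInt := LocallyIntegrableOn.const_smul' hu.grad_locInt c
  by_parts ψ hψ e := by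
    simp only [mul_assoc, real_inner_smul_left]
    rw [integral_const_mul, integral_const_mul, hu.by_parts ψ hψ e]
    ring

lemma LocallyIntegrableOn.comp_reflect {F : Type*} [NormedAddCommGroup F]
    {f : Ext n → F} (hf : LocallyIntegrableOn f Ω) (hΩ : reflect n ⁻¹' Ω = Ω) :
    LocallyIntegrableOn (fun z => f (reflect n z)) Ω := by
  intro x hx
  have hx' : reflect n x ∈ Ω := by rw [← hΩ] at hx; exact hx
  obtain ⟨t, ht, hi⟩ := hf _ hx'
  refine ⟨reflect n ⁻¹' t, ?_, ?_⟩
  · rw [← hΩ]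
    exact ((reflect n).continuous.continuousWithinAt.tendsto_nhdsWithin
      (fun z hz => hz)) ht
  · exact (measurePreserving_reflect.integrableOn_comp_preimage measurableEmbedding_reflect).2 hi

lemma setIntegral_comp_reflect {F : Type*} [NormedAddCommGroup F] [NormedSpace ℝ F]
    (s : Set (Ext n)) (f : Ext n → F) :
    ∫ z in reflect n ⁻¹' s, f (reflect n z) = ∫ z in s, f z :=
  measurePreserving_reflect.setIntegral_preimage_emb measurableEmbedding_reflect f s

lemma IsWeakGradOn.comp_reflect {u : Ext n → ℝ} {G : Ext n → Ext n} (hu : IsWeakGradOn Ω u G)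
    (hΩ : reflect n ⁻¹' Ω = Ω) :
    IsWeakGradOn Ω (fun z => u (reflect n z)) (fun z => reflect n (G (reflect n z))) where
  locInt := LocallyIntegrableOn.comp_reflect hu.locInt hΩ
  grad_locInt := by
    intro x hx
    obtain ⟨t, ht, hi⟩ := LocallyIntegrableOn.comp_reflect hu.grad_locInt hΩ x hx
    exact ⟨t, ht, (reflect n).toContinuousLinearEquiv.toContinuousLinearMap.integrable_comp hi⟩
  by_parts ψ hψ e := by
    have e1 := hu.by_parts _ (hψ.comp_reflect hΩ) (reflect n e)
    rw [← setIntegral_comp_reflect Ω, ← setIntegral_comp_reflect Ω, hΩ] at e1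
    simpa only [fderiv_comp_reflect, inner_reflect, reflect_reflect, Function.comp_apply]
      using e1

end WeakGradient

/-! ### Vertical primitives of test functions -/

section VerticalPrimitive
variable {n : ℕ}

/-- The primitive of `o` in the vertical direction. -/
noncomputable def vertPrimitive (o : Ext n → ℝ) (z : Ext n) : ℝ :=
  ∫ t in Iic z.snd, o (pt z.fst t)

lemma integrable_vertical {o : Ext n → ℝ} {r : ℝ} (ho : Continuous o)
    (hs : ∀ z, r < ‖z‖ → o z = 0) (x : EuclideanSpace ℝ (Fin n)) :
    Integrable fun t => o (pt x t) := by
  have hc : Continuous fun t => o (pt x t) := by fun_prop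
  refine hc.integrable_of_hasCompactSupport ?_
  refine HasCompactSupport.intro (isCompact_Icc (a := -r) (b := r)) fun t ht => hs _ ?_
  refine lt_of_lt_of_le ?_ (abs_snd_le_norm _)
  by_contra h
  exact ht (abs_le.1 (not_lt.1 h))

/-- The primitive is the convolution in `y` with the Heaviside function, with `x` as a parameter;
smoothness in both variables follows from differentiating under a convolution with compact support.
-/
lemma contDiff_vertPrimitive {o : Ext n → ℝ} {r : ℝ} (ho : ContDiff ℝ ∞ o)
    (hs : ∀ z, r < ‖z‖ → o z = 0) : ContDiff ℝ ∞ (vertPrimitive o) := by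
  have h1 : ContDiff ℝ ∞ fun q : EuclideanSpace ℝ (Fin n) × ℝ =>
      (convolution ((Ici (0 : ℝ)).indicator fun _ => (1 : ℝ)) (fun s => o (pt q.1 s))
        (ContinuousLinearMap.mul ℝ ℝ) volume) q.2 := by
    rw [← contDiffOn_univ, ← univ_prod_univ]
    refine contDiffOn_convolution_right_with_param (n := ⊤) (ContinuousLinearMap.mul ℝ ℝ)
      (g := fun x s => o (pt x s)) (k := Icc (-r) r) isOpen_univ isCompact_Icc ?_ ?_ ?_
    · intro x s _ hx
      refine hs _ (lt_of_lt_of_le ?_ (abs_snd_le_norm _))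
      by_contra h
      exact hx (abs_le.1 (not_lt.1 h))
    · exact (locallyIntegrable_const (1 : ℝ)).indicator measurableSet_Ici
    · exact (ho.comp contDiff_pt).contDiffOn
  have h2 : vertPrimitive o = fun z : Ext n =>
      (convolution ((Ici (0 : ℝ)).indicator fun _ => (1 : ℝ)) (fun s => o (pt z.fst s))
        (ContinuousLinearMap.mul ℝ ℝ) volume) z.snd := by
    ext z
    rw [convolution_def, vertPrimitive, ← integral_indicator measurableSet_Iic,
      ← integral_sub_left_eq_self _ volume z.snd]
    congr 1; ext t
    by_cases ht : 0 ≤ t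
    · rw [indicator_of_mem (by simpa using ht), indicator_of_mem (by simpa using ht)]; simp
    · rw [indicator_of_notMem (by simpa using ht), indicator_of_notMem (by simpa using ht)]; simp
  rw [h2]
  exact h1.comp (contDiff_fst'.prodMk contDiff_snd')

/-- For `y ≤ 0` the norm grows on going down the line, so the integrand vanishes on the whole
half-line below. For `y > 0` the mean-zero condition turns the integral into minus the one over the
half-line above, where the same argument applies. -/
lemma vertPrimitive_eq_zero {o : Ext n → ℝ} {r : ℝ} (ho : Continuous o)
    (hs : ∀ z, r < ‖z‖ → o z = 0) (h0 : ∀ x, ∫ t, o (pt x t) = 0) {z : Ext n} (hz : r < ‖z‖) :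
    vertPrimitive o z = 0 := by
  have mono : ∀ t, |z.snd| ≤ |t| → o (pt z.fst t) = 0 := by
    intro t ht
    refine hs _ (hz.trans_le (le_of_sq_le_sq ?_ (norm_nonneg _)))
    rw [norm_pt_sq, norm_sq_eq]
    have := sq_le_sq.2 ht
    linarith
  rcases le_or_gt z.snd 0 with hy | hy
  · rw [vertPrimitive]
    refine setIntegral_eq_zero_of_forall_eq_zero fun t ht => mono t ?_
    have ht' : t ≤ z.snd := ht
    rw [abs_of_nonpos hy, abs_of_nonpos (ht'.trans hy)]; linarith
  · have h1 := integral_add_compl (measurableSet_Iic (a := z.snd)) (integrable_vertical ho hs z.fst)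
    rw [h0, compl_Iic] at h1
    rw [vertPrimitive]
    have h2 : ∫ t in Ioi z.snd, o (pt z.fst t) = 0 := by
      refine setIntegral_eq_zero_of_forall_eq_zero fun t ht => mono t ?_
      have ht' : z.snd < t := ht
      rw [abs_of_pos hy, abs_of_pos (hy.trans ht')]; linarith
    linarith

lemma fderiv_vertPrimitive {o : Ext n → ℝ} {r : ℝ} (ho : ContDiff ℝ ∞ o)
    (hs : ∀ z, r < ‖z‖ → o z = 0) (z : Ext n) :
    fderiv ℝ (vertPrimitive o) z (pt 0 1) = o z := by
  have hd : DifferentiableAt ℝ (vertPrimitive o) z :=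
    (contDiff_vertPrimitive ho hs).differentiable (by simp) z
  rw [← hd.lineDeriv_eq_fderiv]
  refine HasLineDerivAt.lineDeriv ?_
  have hint := integrable_vertical ho.continuous hs z.fst
  have h1 : HasDerivAt (fun y => ∫ t in Iic y, o (pt z.fst t)) (o (pt z.fst z.snd)) z.snd := by
    have h2 : (fun y => ∫ t in Iic y, o (pt z.fst t)) = fun y =>
        (∫ t in Iic z.snd, o (pt z.fst t)) + ∫ t in z.snd..y, o (pt z.fst t) := by
      ext y
      rw [← intervalIntegral.integral_Iic_sub_Iic hint.integrableOn hint.integrableOn]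
      ring
    rw [h2]
    refine HasDerivAt.const_add _ ?_
    have hc : Continuous fun t => o (pt z.fst t) := by have := ho.continuous; fun_prop
    exact intervalIntegral.integral_hasDerivAt_right hc.continuousOn.intervalIntegrable
      (hc.stronglyMeasurableAtFilter _ _) hc.continuousAt
  have h3 : HasDerivAt (fun t : ℝ => z.snd + t) 1 0 := by
    simpa using (hasDerivAt_id (0 : ℝ)).const_add z.snd
  have h4 : HasDerivAt (fun y => ∫ t in Iic y, o (pt z.fst t)) (o (pt z.fst z.snd)) (z.snd + 0) := by
    simpa using h1
  have h5 := h4.comp (0 : ℝ) h3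
  rw [mul_one] at h5
  refine h5.congr_of_eventuallyEq (Eventually.of_forall fun t => ?_)
  change vertPrimitive o (z + t • pt 0 1) = _
  have : z + t • pt 0 1 = pt z.fst (z.snd + t) := by
    rw [pt_smul, ← pt_eta z, pt_add]; simp
  rw [this]; rfl

lemma isTestOn_of_norm {Ω : Set (Ext n)} {ψ : Ext n → ℝ} {r : ℝ} (h : ContDiff ℝ ∞ ψ)
    (hs : ∀ z, r < ‖z‖ → ψ z = 0) (hΩ : Metric.closedBall 0 r ⊆ Ω) : IsTestOn Ω ψ where
  smooth := h
  compact := HasCompactSupport.intro (isCompact_closedBall (0 : Ext n) r) fun z hz => hs z (by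
    simpa using hz)
  support := by
    refine (closure_minimal (fun z hz => ?_) Metric.isClosed_closedBall).trans hΩ
    by_contra h'
    exact hz (hs z (by simpa using h'))

/-- A test function of mean zero on every vertical line is a vertical derivative. -/
lemma IsWeakGradOn.integral_mul_of_vertical_mean_zero {Ω : Set (Ext n)} {u : Ext n → ℝ}
    {G : Ext n → Ext n} (h : IsWeakGradOn Ω u G) {o : Ext n → ℝ} {r : ℝ} (ho : ContDiff ℝ ∞ o)
    (hs : ∀ z, r < ‖z‖ → o z = 0) (hΩ : Metric.closedBall 0 r ⊆ Ω)
    (h0 : ∀ x, ∫ t, o (pt x t) = 0) :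
    ∫ z in Ω, u z * o z = -∫ z in Ω, (G z).snd * vertPrimitive o z := by
  have := h.by_parts _ (isTestOn_of_norm (contDiff_vertPrimitive ho hs)
    (fun z hz => vertPrimitive_eq_zero ho.continuous hs h0 hz) hΩ) (pt 0 1)
  simpa only [fderiv_vertPrimitive ho hs, inner_vertical] using this

end VerticalPrimitive

/-! ### Integral operators in the vertical variable -/

section VerticalIntegral
variable {n : ℕ}

/-- The integral operator with kernel `k` acting in the vertical variable. -/
noncomputable def vertInt (k : ℝ → ℝ → ℝ) (g : Ext n → ℝ) (z : Ext n) : ℝ :=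
  ∫ s, k s z.snd * g (pt z.fst s)

lemma measurePreserving_swap_right {α : Type*} [MeasureSpace α] [SFinite (volume : Measure α)] :
    MeasurePreserving (fun q : (α × ℝ) × ℝ => ((q.1.1, q.2), q.1.2)) := by
  have h1 : MeasurePreserving (MeasurableEquiv.prodAssoc : (α × ℝ) × ℝ ≃ᵐ α × ℝ × ℝ) :=
    volume_preserving_prodAssoc
  have h2 : MeasurePreserving (Prod.map id Prod.swap : α × ℝ × ℝ → α × ℝ × ℝ) :=
    (MeasurePreserving.id _).prod Measure.measurePreserving_swap
  exact (h1.symm _).comp (h2.comp h1)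

lemma measurableEmbedding_swap_right {α : Type*} [MeasurableSpace α] :
    MeasurableEmbedding (fun q : (α × ℝ) × ℝ => ((q.1.1, q.2), q.1.2)) :=
  (MeasurableEquiv.mk (Equiv.mk (fun q : (α × ℝ) × ℝ => ((q.1.1, q.2), q.1.2))
    (fun q => ((q.1.1, q.2), q.1.2)) (fun _ => rfl) (fun _ => rfl))
    (by dsimp; fun_prop) (by dsimp; fun_prop)).measurableEmbedding

/-- The input to Fubini in the variables `(x, s, t)`: the product is dominated by `|g(x, s)|` times
a constant on the bounded interval of `t` where `ψ` can be nonzero. -/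
lemma integrable_vertical_triple {k : ℝ → ℝ → ℝ} (hk : Measurable (Function.uncurry k))
    (hk1 : ∀ s t, |k s t| ≤ 1) {g : Ext n → ℝ} (hg : Integrable g) {ψ : Ext n → ℝ}
    (hψ : Measurable ψ) {C r : ℝ} (hC : ∀ z, |ψ z| ≤ C) (hr : ∀ z, r < |z.snd| → ψ z = 0) :
    Integrable fun q : (EuclideanSpace ℝ (Fin n) × ℝ) × ℝ =>
      g (pt q.1.1 q.1.2) * (k q.1.2 q.2 * ψ (pt q.1.1 q.2)) := by
  have h1 : Integrable ((Icc (-r) r).indicator fun _ => C) := by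
    rw [integrable_indicator_iff measurableSet_Icc]
    exact integrableOn_const (by simp)
  have h2 := ((integrable_ext g).1 hg).mul_prod h1
  refine Integrable.mono h2 ?_ (Eventually.of_forall fun q => ?_)
  · refine AEStronglyMeasurable.mul ?_ (Measurable.aestronglyMeasurable ?_)
    · exact ((integrable_ext g).1 hg).aestronglyMeasurable.comp_fst
    · have a1 : Measurable fun q : (EuclideanSpace ℝ (Fin n) × ℝ) × ℝ => k q.1.2 q.2 :=
        hk.comp (f := fun q : (EuclideanSpace ℝ (Fin n) × ℝ) × ℝ => (q.1.2, q.2)) (by fun_prop)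
      have a2 : Measurable fun q : (EuclideanSpace ℝ (Fin n) × ℝ) × ℝ => ψ (pt q.1.1 q.2) :=
        hψ.comp (measurable_pt.comp
          (f := fun q : (EuclideanSpace ℝ (Fin n) × ℝ) × ℝ => (q.1.1, q.2)) (by fun_prop))
      exact a1.mul a2
  · rw [norm_mul, norm_mul (g _)]
    refine mul_le_mul_of_nonneg_left ?_ (norm_nonneg (g (pt q.1.1 q.1.2)))
    by_cases hq : q.2 ∈ Icc (-r) r
    · rw [indicator_of_mem hq, norm_mul]
      calc _ ≤ 1 * C := mul_le_mul (hk1 _ _) (hC _) (abs_nonneg _) zero_le_one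
        _ ≤ |C| := by rw [one_mul]; exact le_abs_self C
    · have : ψ (pt q.1.1 q.2) = 0 := by
        refine hr _ ?_
        by_contra h
        exact hq (abs_le.1 (not_lt.1 h))
      simp [this]

/-- Fubini: exchanging `s` and `t` moves the operator from `ψ` to `g` and transposes its kernel. It
converts primitives of test functions into representation formulas. -/
lemma integral_mul_vertInt {k : ℝ → ℝ → ℝ} (hk : Measurable (Function.uncurry k))
    (hk1 : ∀ s t, |k s t| ≤ 1) {g : Ext n → ℝ} (hg : Integrable g) {ψ : Ext n → ℝ}
    (hψ : Measurable ψ) {C r : ℝ} (hC : ∀ z, |ψ z| ≤ C) (hr : ∀ z, r < |z.snd| → ψ z = 0) :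
    ∫ z, g z * vertInt (fun t y => k y t) ψ z = ∫ z, ψ z * vertInt k g z := by
  have hi := integrable_vertical_triple hk hk1 hg hψ hC hr
  have h1 := integral_prod _ hi
  have hi' := (measurePreserving_swap_right.integrable_comp_emb measurableEmbedding_swap_right).2 hi
  have h2 := integral_prod _ hi'
  have h3 := measurePreserving_swap_right.integral_comp measurableEmbedding_swap_right
    (fun q : (EuclideanSpace ℝ (Fin n) × ℝ) × ℝ =>
      g (pt q.1.1 q.1.2) * (k q.1.2 q.2 * ψ (pt q.1.1 q.2)))
  rw [integral_ext, integral_ext]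
  calc _ = _ := ?_
    _ = _ := h1.symm
    _ = _ := h3.symm
    _ = _ := h2
    _ = _ := ?_
  · congr 1; ext p
    exact (integral_const_mul _ _).symm
  · congr 1; ext p
    simp only [Function.comp_apply, vertInt, pt_fst, pt_snd]
    rw [← integral_const_mul]
    congr 1; ext s; ring

lemma integrable_mul_vertInt {k : ℝ → ℝ → ℝ} (hk : Measurable (Function.uncurry k))
    (hk1 : ∀ s t, |k s t| ≤ 1) {g : Ext n → ℝ} (hg : Integrable g) {ψ : Ext n → ℝ}
    (hψ : Measurable ψ) {C r : ℝ} (hC : ∀ z, |ψ z| ≤ C) (hr : ∀ z, r < |z.snd| → ψ z = 0) :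
    Integrable fun z => ψ z * vertInt k g z := by
  have hi := integrable_vertical_triple hk hk1 hg hψ hC hr
  have hi' := (measurePreserving_swap_right.integrable_comp_emb measurableEmbedding_swap_right).2 hi
  rw [integrable_ext]
  refine hi'.integral_prod_left.congr (Eventually.of_forall fun p => ?_)
  simp only [Function.comp_apply, vertInt, pt_fst, pt_snd]
  rw [← integral_const_mul]
  congr 1; ext s; ring

lemma integrableOn_vertInt {k : ℝ → ℝ → ℝ} (hk : Measurable (Function.uncurry k))
    (hk1 : ∀ s t, |k s t| ≤ 1) {g : Ext n → ℝ} (hg : Integrable g) (r : ℝ) :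
    IntegrableOn (vertInt k g) {z | |z.snd| ≤ r} := by
  have hm : MeasurableSet {z : Ext n | |z.snd| ≤ r} :=
    measurableSet_le (by fun_prop) measurable_const
  rw [← integrable_indicator_iff hm]
  have := integrable_mul_vertInt hk hk1 hg (ψ := {z : Ext n | |z.snd| ≤ r}.indicator fun _ => 1)
    (measurable_const.indicator hm) (C := 1) (r := r) (fun z => ?_) (fun z hz => ?_)
  · refine this.congr (Eventually.of_forall fun z => ?_)
    by_cases hz : z ∈ {z : Ext n | |z.snd| ≤ r} <;> simp [hz]
  · by_cases hz : z ∈ {z : Ext n | |z.snd| ≤ r} <;> simp [hz]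
  · rw [indicator_of_notMem]; exact not_le.2 hz

lemma integrableOn_unitBall_vertInt {k : ℝ → ℝ → ℝ} (hk : Measurable (Function.uncurry k))
    (hk1 : ∀ s t, |k s t| ≤ 1) {g : Ext n → ℝ} (hg : Integrable g) :
    IntegrableOn (vertInt k g) (unitBall n) :=
  (integrableOn_vertInt hk hk1 hg 1).mono_set fun z hz =>
    (abs_snd_le_norm z).trans (mem_unitBall.1 hz).le

end VerticalIntegral

/-! ### The weight `|y|^b` and Cauchy-Schwarz -/

section Weight
variable {n : ℕ}

lemma integrableOn_abs_rpow {c : ℝ} (hc : -1 < c) :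
    IntegrableOn (fun t : ℝ => |t| ^ c) (Icc (-1) 1) := by
  have h1 : IntegrableOn (fun t : ℝ => |t| ^ c) (Icc 0 1) := by
    have := (intervalIntegrable_iff_integrableOn_Icc_of_le (zero_le_one' ℝ)).1
      (intervalIntegral.intervalIntegrable_rpow' (a := 0) (b := 1) hc)
    exact this.congr_fun (fun t ht => by simp only [abs_of_nonneg ht.1]) measurableSet_Icc
  have h2 : IntegrableOn (fun t : ℝ => |t| ^ c) (Icc (-1) 0) := by
    have := (Measure.measurePreserving_neg (volume : Measure ℝ)).integrableOn_comp_preimage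
      (MeasurableEquiv.neg ℝ).measurableEmbedding (f := fun t : ℝ => |t| ^ c) (s := Icc 0 1)
    have h3 := this.2 h1
    have e : (Neg.neg ⁻¹' Icc (0 : ℝ) 1) = Icc (-1) 0 := by
      ext t; simp only [mem_preimage, mem_Icc]; constructor <;> rintro ⟨a, b⟩ <;> constructor <;> linarith
    rw [e] at h3
    exact h3.congr_fun (fun t _ => by simp) measurableSet_Icc
  exact (h2.union h1).mono_set fun t ht => by
    rcases le_total t 0 with h | h
    · exact Or.inl ⟨ht.1, h⟩
    · exact Or.inr ⟨h, ht.2⟩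

/-- Off `{y = 0}` the weights `|y|^{-b/2}` and `|y|^{b/2}` are inverse to each other; on it the
convention for powers of `0` breaks this. -/
lemma ae_snd_ne_zero : ∀ᵐ z : Ext n, z.snd ≠ 0 := by
  have h : ∀ᵐ p : EuclideanSpace ℝ (Fin n) × ℝ, p.2 ≠ 0 :=
    Measure.quasiMeasurePreserving_snd.ae (Measure.ae_ne volume 0)
  have := measurableEmbedding_pt.ae_map_iff (p := fun z : Ext n => z.snd ≠ 0)
    (μ := (volume : Measure (EuclideanSpace ℝ (Fin n) × ℝ)))
  rw [measurePreserving_pt.map_eq] at this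
  exact this.2 h

lemma abs_rpow_half_sq (c t : ℝ) : (|t| ^ (c / 2)) ^ 2 = |t| ^ c := by
  rw [← Real.rpow_natCast, ← Real.rpow_mul (abs_nonneg _)]; norm_num

lemma integrableOn_weight {c : ℝ} (hc : -1 < c) :
    IntegrableOn (fun z : Ext n => |z.snd| ^ c) (unitBall n) := by
  have h1 : Integrable fun p : EuclideanSpace ℝ (Fin n) × ℝ =>
      (Metric.ball 0 1).indicator (fun _ => (1 : ℝ)) p.1 *
        (Icc (-1) 1).indicator (fun t : ℝ => |t| ^ c) p.2 := by
    refine Integrable.mul_prod ?_ ?_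
    · rw [integrable_indicator_iff measurableSet_ball]
      exact integrableOn_const measure_ball_lt_top.ne
    · rw [integrable_indicator_iff measurableSet_Icc]
      exact integrableOn_abs_rpow hc
  have h2 := (integrable_ext (fun z : Ext n =>
      (Metric.ball 0 1).indicator (fun _ => (1 : ℝ)) z.fst *
        (Icc (-1) 1).indicator (fun t : ℝ => |t| ^ c) z.snd)).2 h1
  refine h2.integrableOn.congr_fun (s := unitBall n) (fun z hz => ?_) measurableSet_unitBall
  have hz' := mem_unitBall.1 hz
  have a1 : z.fst ∈ Metric.ball (0 : EuclideanSpace ℝ (Fin n)) 1 := by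
    simpa using (norm_fst_le_norm z).trans_lt hz'
  have a2 : z.snd ∈ Icc (-1 : ℝ) 1 := abs_le.1 ((abs_snd_le_norm z).trans hz'.le)
  simp only [indicator_of_mem a1, indicator_of_mem a2, one_mul]

lemma measurable_abs_snd_rpow (c : ℝ) : Measurable fun z : Ext n => |z.snd| ^ c :=
  (measurable_snd'.abs).pow_const c

lemma memLp_weight {c : ℝ} (hc : -1 < c) :
    MemLp (fun z : Ext n => |z.snd| ^ (c / 2)) 2 (volume.restrict (unitBall n)) := by
  rw [memLp_two_iff_integrable_sq (measurable_abs_snd_rpow _).aestronglyMeasurable]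
  simp only [abs_rpow_half_sq]
  exact integrableOn_weight hc

lemma weight_cancel {b t : ℝ} (ht : t ≠ 0) : |t| ^ (-b / 2) * |t| ^ (b / 2) = 1 := by
  rw [← Real.rpow_add (abs_pos.2 ht)]; ring_nf; simp

lemma eLpNorm_one_le_of_weighted {F : Type*} [NormedAddCommGroup F] [NormedSpace ℝ F] {b : ℝ}
    {G : Ext n → F} {s : Set (Ext n)}
    (hG : AEStronglyMeasurable (fun z => (|z.snd| ^ (b / 2)) • G z) (volume.restrict s)) :
    eLpNorm G 1 (volume.restrict s) ≤
      eLpNorm (fun z : Ext n => |z.snd| ^ (-b / 2)) 2 (volume.restrict s) *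
      eLpNorm (fun z => (|z.snd| ^ (b / 2)) • G z) 2 (volume.restrict s) := by
  have h := eLpNorm_smul_le_mul_eLpNorm (p := 2) (q := 2) (r := 1) hG
    (φ := fun z : Ext n => |z.snd| ^ (-b / 2)) (measurable_abs_snd_rpow _).aestronglyMeasurable
  refine le_trans (le_of_eq (eLpNorm_congr_ae ?_)) h
  filter_upwards [ae_restrict_of_ae ae_snd_ne_zero] with z hz
  simp [smul_smul, weight_cancel hz]

/-- Cauchy-Schwarz against `|y|^{-b/2}`, which is square integrable on the ball exactly because `b <
1`. -/
lemma integrableOn_of_weighted {F : Type*} [NormedAddCommGroup F] [NormedSpace ℝ F] {b : ℝ}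
    (hb : b < 1) {G : Ext n → F}
    (hG : MemLp (fun z => (|z.snd| ^ (b / 2)) • G z) 2 (volume.restrict (unitBall n))) :
    IntegrableOn G (unitBall n) := by
  have h := hG.smul (r := 1) (memLp_weight (n := n) (c := -b) (by linarith))
  rw [memLp_one_iff_integrable] at h
  refine h.congr ?_
  filter_upwards [ae_restrict_of_ae ae_snd_ne_zero] with z hz
  simp [smul_smul, weight_cancel hz]

lemma sq_lintegral_le_weighted {b : ℝ} {g : ℝ → ℝ} (hg : AEStronglyMeasurable g)
    (h0 : ∀ s, s ∉ Icc (-1 : ℝ) 1 → g s = 0) :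
    (∫⁻ s, ‖g s‖ₑ) ^ 2 ≤ (∫⁻ s in Icc (-1 : ℝ) 1, ‖|s| ^ (-b / 2)‖ₑ ^ 2) *
      ∫⁻ s, ‖|s| ^ (b / 2) * g s‖ₑ ^ 2 := by
  have h1 := ENNReal.lintegral_mul_le_Lp_mul_Lq (volume.restrict (Icc (-1 : ℝ) 1))
    Real.HolderConjugate.two_two
    (f := fun s => ‖|s| ^ (-b / 2)‖ₑ) (g := fun s => ‖|s| ^ (b / 2) * g s‖ₑ)
    (by fun_prop)
    (AEStronglyMeasurable.enorm (by
      exact (Measurable.aestronglyMeasurable (by fun_prop)).mul hg.restrict))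
  have h2 : ∫⁻ s, ‖g s‖ₑ = ∫⁻ s in Icc (-1 : ℝ) 1,
      ((fun s : ℝ => ‖|s| ^ (-b / 2)‖ₑ) * (fun s : ℝ => ‖|s| ^ (b / 2) * g s‖ₑ)) s := by
    rw [← setLIntegral_eq_of_support_subset (s := Icc (-1 : ℝ) 1)]
    · refine lintegral_congr_ae ?_
      filter_upwards [ae_restrict_of_ae (Measure.ae_ne volume (0 : ℝ))] with s hs
      rw [Pi.mul_apply, ← enorm_mul, ← mul_assoc, weight_cancel hs, one_mul]
    · intro s hs
      by_contra h
      exact hs (by simp [h0 s h])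
  rw [h2]
  calc _ ≤ _ := pow_le_pow_left' h1 2
    _ = (∫⁻ s in Icc (-1 : ℝ) 1, ‖|s| ^ (-b / 2)‖ₑ ^ (2 : ℝ)) *
      ∫⁻ s in Icc (-1 : ℝ) 1, ‖|s| ^ (b / 2) * g s‖ₑ ^ (2 : ℝ) := by
        rw [mul_pow, ← ENNReal.rpow_natCast, ← ENNReal.rpow_natCast, ← ENNReal.rpow_mul,
          ← ENNReal.rpow_mul]
        norm_num
    _ ≤ _ := by
        simp only [ENNReal.rpow_ofNat]
        exact mul_le_mul_right (lintegral_mono' Measure.restrict_le_self le_rfl) _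

/-- On the vertical line over `x`, Cauchy-Schwarz bounds the square of the operator, uniformly in
height, by `∫_{-1}^{1} |s|^{-b} ds` times `∫ |s|^b g(x, s)² ds`. Integrating over `x` and over
heights in `[-1, 1]` gives the claim. It supplies the `L²` membership of the limit function. -/
lemma memLp_vertInt {b : ℝ} (hb : b < 1) {k : ℝ → ℝ → ℝ} (hk : Measurable (Function.uncurry k))
    (hk1 : ∀ s t, |k s t| ≤ 1) {g : Ext n → ℝ} (hg : Integrable g)
    (h0 : ∀ z, z ∉ unitBall n → g z = 0)
    (hw : MemLp (fun z => |z.snd| ^ (b / 2) * g z) 2) :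
    MemLp (vertInt k g) 2 (volume.restrict (unitBall n)) := by
  have hmeas := (integrableOn_unitBall_vertInt hk hk1 hg).aestronglyMeasurable
  refine ⟨hmeas, ?_⟩
  rw [eLpNorm_lt_top_iff_lintegral_rpow_enorm_lt_top (by simp) (by simp)]
  simp only [ENNReal.toReal_ofNat, ENNReal.rpow_ofNat]
  set A := ∫⁻ s in Icc (-1 : ℝ) 1, ‖|s| ^ (-b / 2)‖ₑ ^ 2 with hA
  have hAfin : A < ⊤ := by
    have := (integrableOn_abs_rpow (c := -b) (by linarith)).hasFiniteIntegral
    refine lt_of_le_of_lt (lintegral_mono fun s => ?_) this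
    rw [← enorm_pow, abs_rpow_half_sq]
  have hsl : ∀ᵐ x : EuclideanSpace ℝ (Fin n), AEStronglyMeasurable fun s => g (pt x s) :=
    ((integrable_ext g).1 hg).aestronglyMeasurable.prodMk_left
  have hbound : ∀ᵐ x : EuclideanSpace ℝ (Fin n), ∀ t, ‖vertInt k g (pt x t)‖ₑ ^ 2 ≤
      A * ∫⁻ s, ‖|s| ^ (b / 2) * g (pt x s)‖ₑ ^ 2 := by
    filter_upwards [hsl] with x hx t
    refine le_trans (pow_le_pow_left' ?_ 2) (sq_lintegral_le_weighted hx fun s hs => h0 _ ?_)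
    · refine (enorm_integral_le_lintegral_enorm _).trans (lintegral_mono fun s => ?_)
      rw [enorm_mul]
      refine mul_le_of_le_one_left (zero_le) ?_
      rw [← ofReal_norm, Real.norm_eq_abs]
      exact ENNReal.ofReal_le_one.2 (hk1 _ _)
    · intro hz
      exact hs (abs_le.1 ((abs_snd_le_norm (pt x s)).trans (mem_unitBall.1 hz).le))
  calc ∫⁻ z in unitBall n, ‖vertInt k g z‖ₑ ^ 2
      ≤ ∫⁻ z : Ext n, (Icc (-1 : ℝ) 1).indicator 1 z.snd * ‖vertInt k g z‖ₑ ^ 2 := by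
        rw [← lintegral_indicator measurableSet_unitBall]
        refine lintegral_mono fun z => ?_
        by_cases hz : z ∈ unitBall n
        · have a2 : z.snd ∈ Icc (-1 : ℝ) 1 :=
            abs_le.1 ((abs_snd_le_norm z).trans (mem_unitBall.1 hz).le)
          simp [hz, a2]
        · simp [hz]
    _ = ∫⁻ p : EuclideanSpace ℝ (Fin n) × ℝ,
        (Icc (-1 : ℝ) 1).indicator 1 p.2 * ‖vertInt k g (pt p.1 p.2)‖ₑ ^ 2 := lintegral_ext _
    _ ≤ ∫⁻ p : EuclideanSpace ℝ (Fin n) × ℝ, (A * ∫⁻ s, ‖|s| ^ (b / 2) * g (pt p.1 s)‖ₑ ^ 2) *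
        (Icc (-1 : ℝ) 1).indicator 1 p.2 := by
        have : ∀ᵐ p : EuclideanSpace ℝ (Fin n) × ℝ, ∀ t, ‖vertInt k g (pt p.1 t)‖ₑ ^ 2 ≤
          A * ∫⁻ s, ‖|s| ^ (b / 2) * g (pt p.1 s)‖ₑ ^ 2 :=
          Measure.quasiMeasurePreserving_fst.ae hbound
        refine lintegral_mono_ae ?_
        filter_upwards [this] with p hp
        rw [mul_comm]
        gcongr
        exact hp _
    _ < ⊤ := by
        have hm : AEMeasurable fun p : EuclideanSpace ℝ (Fin n) × ℝ =>
            ‖|p.2| ^ (b / 2) * g (pt p.1 p.2)‖ₑ ^ 2 := by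
          have := ((measurePreserving_pt.integrable_comp_emb measurableEmbedding_pt).2
            hg).aestronglyMeasurable
          refine AEMeasurable.pow_const (AEStronglyMeasurable.enorm ?_) 2
          exact (Measurable.aestronglyMeasurable (by fun_prop)).mul this
        rw [show (volume : Measure (EuclideanSpace ℝ (Fin n) × ℝ)) = volume.prod volume from rfl,
          lintegral_prod_mul (f := fun x => A * ∫⁻ s, ‖|s| ^ (b / 2) * g (pt x s)‖ₑ ^ 2)
            (hm.lintegral_prod_right'.const_mul A)
            ((measurable_one.indicator measurableSet_Icc).aemeasurable),
          lintegral_const_mul'' _ hm.lintegral_prod_right',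
          lintegral_indicator_one measurableSet_Icc, Real.volume_Icc]
        refine ENNReal.mul_lt_top (ENNReal.mul_lt_top hAfin ?_) ENNReal.ofReal_lt_top
        have h4 := lintegral_prod _ hm
        rw [← h4, ← Measure.volume_eq_prod]
        refine (lintegral_ext fun z : Ext n => ‖|z.snd| ^ (b / 2) * g z‖ₑ ^ 2).symm.trans_lt ?_
        have := hw.2
        rw [eLpNorm_lt_top_iff_lintegral_rpow_enorm_lt_top (by simp) (by simp)] at this
        simpa using this

end Weight

/-! ### Recovering functions from their vertical derivative -/

section Representation
variable {n : ℕ}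

lemma isTestOn_unitBall_radius {ψ : Ext n → ℝ} (hψ : IsTestOn (unitBall n) ψ) :
    ∃ r < 1, ∀ z, r < ‖z‖ → ψ z = 0 := by
  obtain ⟨r, hr1, hr⟩ := exists_lt_subset_ball (isClosed_tsupport ψ) hψ.support
  refine ⟨r, hr1, fun z hz => image_eq_zero_of_notMem_tsupport fun h => ?_⟩
  have := hr h
  rw [Metric.mem_ball, dist_zero_right] at this
  linarith

lemma IsTestOn.exists_bound {Ω : Set (Ext n)} {ψ : Ext n → ℝ} (hψ : IsTestOn Ω ψ) :
    ∃ C, ∀ z, |ψ z| ≤ C :=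
  hψ.smooth.continuous.bounded_above_of_compact_support hψ.compact

/-- The kernel turning a test function `ψ` into the vertical primitive of `ψ - ψ ∘ reflect`. -/
noncomputable def reflectKernel (y t : ℝ) : ℝ := (if t ≤ y then 1 else 0) - if -t ≤ y then 1 else 0

/-- The kernel turning a test function `ψ` into the vertical primitive of the difference of `ψ`
and its translate by `3` units upwards. -/
noncomputable def shiftKernel (y t : ℝ) : ℝ := if t ≤ y ∧ y < t + 3 then 1 else 0

lemma measurable_reflectKernel : Measurable (Function.uncurry reflectKernel) := by
  refine Measurable.sub ?_ ?_
  · exact Measurable.ite (measurableSet_le (by fun_prop) (by fun_prop)) measurable_const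
      measurable_const
  · exact Measurable.ite (measurableSet_le (by fun_prop) (by fun_prop)) measurable_const
      measurable_const

lemma abs_reflectKernel_le (y t : ℝ) : |reflectKernel y t| ≤ 1 := by
  unfold reflectKernel
  split_ifs <;> simp

lemma measurable_shiftKernel : Measurable (Function.uncurry shiftKernel) := by
  have h1 : MeasurableSet {a : ℝ × ℝ | a.2 ≤ a.1} := measurableSet_le (by fun_prop) (by fun_prop)
  have h2 : MeasurableSet {a : ℝ × ℝ | a.1 < a.2 + 3} :=
    measurableSet_lt (by fun_prop) (by fun_prop)
  exact Measurable.ite (h1.inter h2) measurable_const measurable_const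

lemma abs_shiftKernel_le (y t : ℝ) : |shiftKernel y t| ≤ 1 := by
  unfold shiftKernel
  split_ifs <;> simp

lemma vertPrimitive_sub_reflect {ψ : Ext n → ℝ} {r : ℝ} (hψ : Continuous ψ)
    (hs : ∀ z, r < ‖z‖ → ψ z = 0) (z : Ext n) :
    vertPrimitive (fun z => ψ z - ψ (reflect n z)) z =
      vertInt (fun t y => reflectKernel y t) ψ z := by
  have hint := integrable_vertical hψ hs z.fst
  have h1 : Integrable fun t => (Iic z.snd).indicator (fun t => ψ (pt z.fst t)) t :=
    hint.indicator measurableSet_Iic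
  have h2 : Integrable fun t => (Iic z.snd).indicator (fun t => ψ (pt z.fst (-t))) t :=
    hint.comp_neg.indicator measurableSet_Iic
  rw [vertPrimitive, ← integral_indicator measurableSet_Iic]
  have e1 : (Iic z.snd).indicator (fun t => ψ (pt z.fst t) - ψ (reflect n (pt z.fst t))) =
      fun t => (Iic z.snd).indicator (fun t => ψ (pt z.fst t)) t -
        (Iic z.snd).indicator (fun t => ψ (pt z.fst (-t))) t := by
    ext t; by_cases ht : t ∈ Iic z.snd <;> simp [ht]
  have h3 := h2.comp_neg
  rw [e1, integral_sub h1 h2, vertInt, ← integral_neg_eq_self (fun t =>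
    (Iic z.snd).indicator (fun t => ψ (pt z.fst (-t))) t), ← integral_sub h1 h3]
  congr 1; ext t
  simp only [reflectKernel, indicator_apply, mem_Iic, neg_neg]
  split_ifs <;> simp

lemma vertPrimitive_sub_shift {ψ : Ext n → ℝ} {r : ℝ} (hψ : Continuous ψ)
    (hs : ∀ z, r < ‖z‖ → ψ z = 0) (z : Ext n) :
    vertPrimitive (fun z => ψ z - ψ (z - pt 0 3)) z =
      vertInt (fun t y => shiftKernel y t) ψ z := by
  have hint := integrable_vertical hψ hs z.fst
  have h1 : Integrable fun t => (Iic z.snd).indicator (fun t => ψ (pt z.fst t)) t :=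
    hint.indicator measurableSet_Iic
  have h2 : Integrable fun t => (Iic z.snd).indicator (fun t => ψ (pt z.fst (t - 3))) t :=
    (hint.comp_sub_right 3).indicator measurableSet_Iic
  rw [vertPrimitive, ← integral_indicator measurableSet_Iic]
  have e0 : ∀ t, pt z.fst t - pt 0 3 = pt z.fst (t - 3) := fun t => by
    rw [sub_eq_iff_eq_add, pt_add]; simp
  have e1 : (Iic z.snd).indicator (fun t => ψ (pt z.fst t) - ψ (pt z.fst t - pt 0 3)) =
      fun t => (Iic z.snd).indicator (fun t => ψ (pt z.fst t)) t -
        (Iic z.snd).indicator (fun t => ψ (pt z.fst (t - 3))) t := by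
    ext t; by_cases ht : t ∈ Iic z.snd <;> simp [ht, e0]
  have h3 := h2.comp_add_right 3
  rw [e1, integral_sub h1 h2, vertInt, ← integral_add_right_eq_self (fun t =>
    (Iic z.snd).indicator (fun t => ψ (pt z.fst (t - 3))) t) 3, ← integral_sub h1 h3]
  congr 1; ext t
  simp only [shiftKernel, indicator_apply, mem_Iic, add_sub_cancel_right]
  by_cases h1 : t + 3 ≤ z.snd
  · have h2 : t ≤ z.snd := by linarith
    simp [h1, h2, not_lt.2 h1]
  · by_cases h2 : t ≤ z.snd <;> simp [h1, h2, not_le.1 h1]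

lemma integral_vertical_sub_reflect {ψ : Ext n → ℝ} {r : ℝ} (hψ : Continuous ψ)
    (hs : ∀ z, r < ‖z‖ → ψ z = 0) (x : EuclideanSpace ℝ (Fin n)) :
    ∫ t, (ψ (pt x t) - ψ (reflect n (pt x t))) = 0 := by
  have hint := integrable_vertical hψ hs x
  simp only [reflect_pt]
  rw [integral_sub hint hint.comp_neg, integral_neg_eq_self fun t => ψ (pt x t), sub_self]

lemma integral_vertical_sub_shift {ψ : Ext n → ℝ} {r : ℝ} (hψ : Continuous ψ)
    (hs : ∀ z, r < ‖z‖ → ψ z = 0) (x : EuclideanSpace ℝ (Fin n)) :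
    ∫ t, (ψ (pt x t) - ψ (pt x t - pt 0 3)) = 0 := by
  have hint := integrable_vertical hψ hs x
  have e0 : ∀ t, pt x t - pt 0 3 = pt x (t - 3) := fun t => by
    rw [sub_eq_iff_eq_add, pt_add]; simp
  simp only [e0]
  rw [integral_sub hint (hint.comp_sub_right 3),
    integral_sub_right_eq_self (fun t => ψ (pt x t)), sub_self]

/-- `v(x, y) - v(x, -y)` is an integral of `∂_y v` along the vertical segment. -/
lemma IsWeakGradOn.sub_reflect_ae_eq {v : Ext n → ℝ} {G : Ext n → Ext n}
    (h : IsWeakGradOn (unitBall n) v G) (hG : IntegrableOn G (unitBall n)) :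
    ∀ᵐ z : Ext n, z ∈ unitBall n → v z - v (reflect n z) =
      -vertInt reflectKernel ((unitBall n).indicator fun z => (G z).snd) z := by
  set g : Ext n → ℝ := (unitBall n).indicator fun z => (G z).snd with hg
  have hgi : Integrable g := by
    rw [hg, integrable_indicator_iff measurableSet_unitBall]
    exact (WithLp.sndL 2 ℝ (EuclideanSpace ℝ (Fin n)) ℝ).integrable_comp hG
  have hVi := integrableOn_unitBall_vertInt measurable_reflectKernel abs_reflectKernel_le hgi
  have hvR := LocallyIntegrableOn.comp_reflect h.locInt preimage_reflect_unitBall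
  have key := isOpen_unitBall.ae_eq_zero_of_integral_contDiff_smul_eq_zero (μ := volume)
    (f := fun z => v z - v (reflect n z) + vertInt reflectKernel g z)
    ((h.locInt.sub hvR).add hVi.locallyIntegrableOn) ?_
  · filter_upwards [key] with z hz hzB
    have := hz hzB
    linarith
  intro ψ hψ hψc hψs
  have ht : IsTestOn (unitBall n) ψ := ⟨hψ, hψc, hψs⟩
  have htR := ht.comp_reflect preimage_reflect_unitBall
  obtain ⟨r, hr1, hr⟩ := isTestOn_unitBall_radius ht
  obtain ⟨C, hC⟩ := ht.exists_bound
  have hr2 : ∀ z : Ext n, r < |z.snd| → ψ z = 0 := fun z hz =>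
    hr z (hz.trans_le (abs_snd_le_norm z))
  -- The part of `ψ` that is odd in `y` has mean zero on every vertical line, so it is the vertical
  -- derivative of a test function in the ball.
  have e1 := h.integral_mul_of_vertical_mean_zero (o := fun z => ψ z - ψ (reflect n z)) (r := r)
    (hψ.sub htR.smooth) (fun z hz => by rw [hr z hz, hr _ (by simpa using hz), sub_self])
    (fun z hz => mem_unitBall.2 (by
      rw [Metric.mem_closedBall, dist_zero_right] at hz; linarith))
    (integral_vertical_sub_reflect hψ.continuous hr)
  simp only [vertPrimitive_sub_reflect hψ.continuous hr] at e1
  have e2 : ∫ z in unitBall n, (G z).snd * vertInt (fun t y => reflectKernel y t) ψ z =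
      ∫ z, g z * vertInt (fun t y => reflectKernel y t) ψ z := by
    rw [← integral_indicator measurableSet_unitBall]
    congr 1; ext z
    by_cases hz : z ∈ unitBall n <;> simp [hg, hz]
  rw [e2, integral_mul_vertInt measurable_reflectKernel abs_reflectKernel_le hgi
    hψ.continuous.measurable hC hr2] at e1
  have hi1 : Integrable fun z => v z * ψ z :=
    integrable_mul_of_hasCompactSupport h.locInt hψ.continuous hψc hψs
  have hi2 : Integrable fun z => v (reflect n z) * ψ z :=
    integrable_mul_of_hasCompactSupport hvR hψ.continuous hψc hψs
  have hi2' : Integrable fun z => v z * ψ (reflect n z) :=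
    integrable_mul_of_hasCompactSupport h.locInt htR.smooth.continuous htR.compact htR.support
  have hi3 := integrable_mul_vertInt measurable_reflectKernel abs_reflectKernel_le hgi
    hψ.continuous.measurable hC hr2
  have e3 : ∫ z in unitBall n, v z * (ψ z - ψ (reflect n z)) =
      ∫ z, v z * (ψ z - ψ (reflect n z)) :=
    setIntegral_eq_integral_of_forall_compl_eq_zero fun z hz => by
      have h1 := htR.eq_zero hz
      simp only [Function.comp_apply] at h1
      rw [ht.eq_zero hz, h1]; simp
  have e4 : ∫ z, v z * ψ (reflect n z) = ∫ z, v (reflect n z) * ψ z := by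
    rw [← measurePreserving_reflect.integral_comp measurableEmbedding_reflect]
    simp
  simp only [mul_sub] at e3
  have e5 : ∀ z, ψ z • (v z - v (reflect n z) + vertInt reflectKernel g z) =
      v z * ψ z - v (reflect n z) * ψ z + ψ z * vertInt reflectKernel g z := fun z => by
    rw [smul_eq_mul]; ring
  simp only [mul_sub] at e1
  simp_rw [e5]
  have hi12 : Integrable fun z => v z * ψ z - v (reflect n z) * ψ z := hi1.sub hi2
  rw [integral_add hi12 hi3, integral_sub hi1 hi2, ← e4, ← integral_sub hi1 hi2', ← e3, e1]
  ring

lemma MemH1.isWeakGradOn {Ω : Set (Ext n)} {b : ℝ} {v : Ext n → ℝ} (h : MemH1 b Ω v) :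
    IsWeakGradOn Ω v (weakGrad Ω v) := isWeakGradOn_weakGrad h.exists_grad

lemma MemH1.integrableOn_grad {b : ℝ} (hb : b < 1) {v : Ext n → ℝ} (h : MemH1 b (unitBall n) v) :
    IntegrableOn (weakGrad (unitBall n) v) (unitBall n) := integrableOn_of_weighted hb h.grad_memLp

/-- The definition gives square integrability only on the upper half-ball, and merely local
integrability below. Reflection transfers integrability downwards, since `v(x, y) - v(x, -y)` is
controlled by the integrable vertical derivative. -/
lemma MemH1.integrableOn {b : ℝ} (hb : b < 1) {v : Ext n → ℝ} (h : MemH1 b (unitBall n) v) :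
    IntegrableOn v (unitBall n) := by
  have hG := h.integrableOn_grad hb
  have hae := h.isWeakGradOn.sub_reflect_ae_eq hG
  set g : Ext n → ℝ := (unitBall n).indicator fun z => (weakGrad (unitBall n) v z).snd with hg
  have hgi : Integrable g := by
    rw [hg, integrable_indicator_iff measurableSet_unitBall]
    exact (WithLp.sndL 2 ℝ (EuclideanSpace ℝ (Fin n)) ℝ).integrable_comp hG
  have hVi := integrableOn_unitBall_vertInt measurable_reflectKernel abs_reflectKernel_le hgi
  have hfin : IsFiniteMeasure (volume.restrict (unitBall n ∩ upperHalf n)) :=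
    ⟨by rw [Measure.restrict_apply_univ]
        exact (measure_mono inter_subset_left).trans_lt Metric.isBounded_ball.measure_lt_top⟩
  have hup : IntegrableOn v (unitBall n ∩ upperHalf n) := h.memLp.integrable (by norm_num)
  have hlow : IntegrableOn (fun z => v (reflect n z)) (reflect n ⁻¹' (unitBall n ∩ upperHalf n)) :=
    (measurePreserving_reflect.integrableOn_comp_preimage measurableEmbedding_reflect).2 hup
  have hsub : reflect n ⁻¹' (unitBall n ∩ upperHalf n) ⊆ unitBall n := fun z hz =>
    reflect_mem_unitBall.1 hz.1
  have hlow2 : IntegrableOn v (reflect n ⁻¹' (unitBall n ∩ upperHalf n)) := by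
    refine (hlow.sub (hVi.mono_set hsub)).congr ?_
    have hm : MeasurableSet (reflect n ⁻¹' (unitBall n ∩ upperHalf n)) :=
      (reflect n).continuous.measurable (measurableSet_unitBall.inter measurableSet_upperHalf)
    filter_upwards [ae_restrict_of_ae hae, ae_restrict_mem hm] with z h1 h2
    have := h1 (hsub h2)
    simp only [Pi.sub_apply]
    linarith
  refine (hup.union hlow2).mono_set_ae ?_
  filter_upwards [ae_snd_ne_zero] with z hz hzB
  rcases lt_or_gt_of_ne hz with h1 | h1
  · refine Or.inr ⟨reflect_mem_unitBall.2 hzB, ?_⟩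
    simp only [upperHalf, mem_ofPred_eq, reflect_snd]; linarith
  · exact Or.inl ⟨hzB, h1⟩

/-- A function on `ℝⁿ⁺¹` supported in the unit ball is recovered from its vertical derivative. -/
lemma IsWeakGradOn.ae_eq_vertInt {w : Ext n → ℝ} {G : Ext n → Ext n}
    (h : IsWeakGradOn univ w G) (hG : Integrable G) (hw : ∀ z, z ∉ unitBall n → w z = 0) :
    ∀ᵐ z : Ext n, z ∈ unitBall n → w z = -vertInt shiftKernel (fun z => (G z).snd) z := by
  set g : Ext n → ℝ := fun z => (G z).snd with hg
  have hgi : Integrable g := (WithLp.sndL 2 ℝ (EuclideanSpace ℝ (Fin n)) ℝ).integrable_comp hG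
  have hVi := integrableOn_unitBall_vertInt measurable_shiftKernel abs_shiftKernel_le hgi
  have hwl := h.locInt.mono_set (subset_univ (unitBall n))
  have key := isOpen_unitBall.ae_eq_zero_of_integral_contDiff_smul_eq_zero (μ := volume)
    (f := fun z => w z + vertInt shiftKernel g z)
    (hwl.add hVi.locallyIntegrableOn) ?_
  · filter_upwards [key] with z hz hzB
    have := hz hzB
    linarith
  intro ψ hψ hψc hψs
  have ht : IsTestOn (unitBall n) ψ := ⟨hψ, hψc, hψs⟩
  obtain ⟨r, hr1, hr⟩ := isTestOn_unitBall_radius ht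
  obtain ⟨C, hC⟩ := ht.exists_bound
  have hr2 : ∀ z : Ext n, r < |z.snd| → ψ z = 0 := fun z hz =>
    hr z (hz.trans_le (abs_snd_le_norm z))
  have h3 : ‖(pt 0 3 : Ext n)‖ = 3 := by
    have := norm_pt_sq (0 : EuclideanSpace ℝ (Fin n)) 3
    rw [norm_zero] at this
    nlinarith [norm_nonneg (pt (0 : EuclideanSpace ℝ (Fin n)) 3)]
  -- Subtracting a vertical translate gives mean zero on vertical lines. The radius `4 = 1 + 3`
  -- leaves both `ψ` and its translate equal to zero outside.
  have e1 := h.integral_mul_of_vertical_mean_zero (o := fun z => ψ z - ψ (z - pt 0 3)) (r := 4)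
    (hψ.sub (hψ.comp (contDiff_id.sub contDiff_const))) (fun z hz => by
      rw [hr z (by linarith), hr (z - pt 0 3), sub_self]
      have := norm_sub_norm_le z (pt 0 3)
      linarith) (subset_univ _)
    (integral_vertical_sub_shift hψ.continuous hr)
  simp only [vertPrimitive_sub_shift hψ.continuous hr, setIntegral_univ] at e1
  rw [integral_mul_vertInt measurable_shiftKernel abs_shiftKernel_le hgi
    hψ.continuous.measurable hC hr2] at e1
  have hi1 : Integrable fun z => w z * ψ z :=
    integrable_mul_of_hasCompactSupport hwl hψ.continuous hψc hψs
  have hi3 := integrable_mul_vertInt measurable_shiftKernel abs_shiftKernel_le hgi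
    hψ.continuous.measurable hC hr2
  -- The shift `3` exceeds the diameter of the ball, so the translate of `ψ` does not meet the set
  -- where `w` can be nonzero.
  have e2 : ∀ z, w z * (ψ z - ψ (z - pt 0 3)) = w z * ψ z := fun z => by
    by_cases hz : z ∈ unitBall n
    · rw [hr (z - pt 0 3), sub_zero]
      have := norm_sub_norm_le (pt 0 3) z
      rw [norm_sub_rev] at this
      have := mem_unitBall.1 hz
      linarith
    · rw [hw z hz, zero_mul, zero_mul]
  simp only [e2] at e1
  have e5 : ∀ z, ψ z • (w z + vertInt shiftKernel g z) =
      w z * ψ z + ψ z * vertInt shiftKernel g z := fun z => by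
    rw [smul_eq_mul]; ring
  simp_rw [e5]
  rw [integral_add hi1 hi3, e1]
  ring

end Representation

/-! ### Green's formula in the upper half-space -/

section HalfSpace
variable {n : ℕ}

lemma deriv_smoothTransition_of_nonpos {s : ℝ} (hs : s ≤ 0) : deriv Real.smoothTransition s = 0 := by
  refine IsLocalMin.deriv_eq_zero (Eventually.of_forall fun t => ?_)
  rw [Real.smoothTransition.zero_of_nonpos hs]
  exact Real.smoothTransition.nonneg t

lemma deriv_smoothTransition_of_one_le {s : ℝ} (hs : 1 ≤ s) : deriv Real.smoothTransition s = 0 := by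
  refine IsLocalMax.deriv_eq_zero (Eventually.of_forall fun t => ?_)
  rw [Real.smoothTransition.one_of_one_le hs]
  exact Real.smoothTransition.le_one t

/-- With `s = k y` this bounds `k y η'(k y)` uniformly in `k`: the derivative of the cutoff `η(k y)`
is of size `k`, but only where `y` is at most `1/k`. -/
lemma exists_bound_mul_deriv_smoothTransition :
    ∃ M, ∀ s : ℝ, |s * deriv Real.smoothTransition s| ≤ M := by
  have hc : Continuous fun s : ℝ => s * deriv Real.smoothTransition s :=
    continuous_id.mul ((Real.smoothTransition.contDiff (n := 1)).continuous_deriv le_rfl)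
  obtain ⟨M, hM⟩ := (isCompact_Icc (a := (0 : ℝ)) (b := 1)).exists_bound_of_continuousOn
    hc.continuousOn
  refine ⟨max M 0, fun s => ?_⟩
  by_cases hs : s ∈ Icc (0 : ℝ) 1
  · exact (hM s hs).trans (le_max_left _ _)
  · have : deriv Real.smoothTransition s = 0 := by
      rcases le_or_gt s 0 with h | h
      · exact deriv_smoothTransition_of_nonpos h
      · exact deriv_smoothTransition_of_one_le (le_of_lt (by
          by_contra h'; exact hs ⟨h.le, not_lt.1 h'⟩))
    simp [this]

lemma IsTestOn.exists_abs_le_mul_snd {θ : Ext n → ℝ} (hθ : IsTestOn univ θ)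
    (h0 : ∀ x, θ (pt x 0) = 0) : ∃ C : ℝ, 0 ≤ C ∧ ∀ z, |θ z| ≤ C * |z.snd| := by
  obtain ⟨C, hC⟩ := (hθ.smooth.of_le (by simp : (1 : WithTop ℕ∞) ≤ ∞)).lipschitzWith_of_hasCompactSupport
    hθ.compact one_ne_zero
  refine ⟨C, C.2, fun z => ?_⟩
  have h := hC.dist_le_mul z (pt z.fst 0)
  rw [h0, Real.dist_eq, sub_zero, dist_eq_norm] at h
  have e : z - pt z.fst 0 = pt 0 z.snd := by
    rw [sub_eq_iff_eq_add, pt_add]; simp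
  have e2 : ‖(pt 0 z.snd : Ext n)‖ = |z.snd| := by
    have := norm_pt_sq (0 : EuclideanSpace ℝ (Fin n)) z.snd
    rw [norm_zero, ← sq_abs z.snd, zero_pow two_ne_zero, zero_add] at this
    exact (sq_eq_sq₀ (norm_nonneg _) (abs_nonneg _)).1 this
  rwa [e, e2] at h

lemma fderiv_smoothTransition_snd_mul (k : ℝ) {θ : Ext n → ℝ} (hθ : ContDiff ℝ ∞ θ) (z e : Ext n) :
    fderiv ℝ (fun z => Real.smoothTransition (k * z.snd) * θ z) z e =
      Real.smoothTransition (k * z.snd) * fderiv ℝ θ z e +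
        θ z * (k * deriv Real.smoothTransition (k * z.snd) * e.snd) := by
  have hsm : ContDiff ℝ ∞ fun z : Ext n => Real.smoothTransition (k * z.snd) :=
    Real.smoothTransition.contDiff.comp (contDiff_const.mul contDiff_snd')
  rw [← ((hsm.mul hθ).differentiable (by simp) z).lineDeriv_eq_fderiv]
  refine HasLineDerivAt.lineDeriv ?_
  have h1 : HasDerivAt (fun t : ℝ => k * (z.snd + t * e.snd)) (k * e.snd) 0 := by
    simpa using (((hasDerivAt_id (0 : ℝ)).mul_const e.snd).const_add z.snd).const_mul k
  have h2 : HasDerivAt Real.smoothTransition (deriv Real.smoothTransition (k * z.snd))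
      (k * (z.snd + 0 * e.snd)) := by
    rw [zero_mul, add_zero]
    exact ((Real.smoothTransition.contDiff (n := 1)).differentiable one_ne_zero _).hasDerivAt
  have h3 := h2.comp (0 : ℝ) h1
  have h4 : HasLineDerivAt ℝ θ (fderiv ℝ θ z e) z e :=
    ((hθ.differentiable (by simp)) z).hasFDerivAt.hasLineDerivAt e
  have h5 := h3.mul h4
  simp only [Function.comp_apply, zero_mul, add_zero, zero_smul] at h5
  unfold HasLineDerivAt
  convert! h5 using 1
  ring

/-- Green's formula in the upper half-space without boundary term: either the direction is
horizontal, or the test function vanishes on the boundary. -/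
lemma IsWeakGradOn.integral_upperHalf_eq_zero {w : Ext n → ℝ} {G : Ext n → Ext n}
    (h : IsWeakGradOn univ w G) (hw : Integrable w) {θ : Ext n → ℝ} (hθ : IsTestOn univ θ)
    (e : Ext n) (he : e.snd = 0 ∨ ∀ x, θ (pt x 0) = 0) :
    ∫ z in upperHalf n, (w z * fderiv ℝ θ z e + inner ℝ (G z) e * θ z) = 0 := by
  set η := Real.smoothTransition with hη
  have hηd : ∀ s, DifferentiableAt ℝ η s := fun s =>
    (Real.smoothTransition.contDiff (n := 1)).differentiable one_ne_zero s
  set F : Ext n → ℝ := fun z => w z * fderiv ℝ θ z e + inner ℝ (G z) e * θ z with hF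
  have hFi : Integrable F := (h.integrable_left hθ e).add (h.integrable_right hθ e)
  -- The Green integrand for the test function `η(k y) θ`, where the cutoffs `η(k y)` increase to
  -- the indicator of the half-space. The second summand comes from differentiating the cutoff.
  set Fk : ℕ → Ext n → ℝ := fun k z => η (k * z.snd) * F z +
    w z * (θ z * (k * deriv η (k * z.snd) * e.snd)) with hFk
  have hzero : ∀ k : ℕ, ∫ z, Fk k z = 0 := by
    intro k
    have hsm : ContDiff ℝ ∞ fun z : Ext n => η (k * z.snd) :=
      Real.smoothTransition.contDiff.comp (contDiff_const.mul contDiff_snd')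
    have ht : IsTestOn univ fun z => η (k * z.snd) * θ z :=
      ⟨hsm.mul hθ.smooth, hθ.compact.mul_left, subset_univ _⟩
    have e1 := h.by_parts _ ht e
    rw [setIntegral_univ, setIntegral_univ] at e1
    have e2 : ∀ z, fderiv ℝ (fun z => η (k * z.snd) * θ z) z e =
        η (k * z.snd) * fderiv ℝ θ z e + θ z * (k * deriv η (k * z.snd) * e.snd) := by
      intro z
      exact fderiv_smoothTransition_snd_mul k hθ.smooth z e
    have hi1 := h.integrable_left ht e
    have hi2 := h.integrable_right ht e
    have e3 : Fk k = fun z => w z * fderiv ℝ (fun z => η (k * z.snd) * θ z) z e +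
        inner ℝ (G z) e * (η (k * z.snd) * θ z) := by
      ext z; simp only [hFk, hF, e2]; ring
    rw [e3, integral_add hi1 hi2, e1]; ring
  obtain ⟨M, hM⟩ := exists_bound_mul_deriv_smoothTransition
  -- The cutoff's derivative is harmless in both cases: a horizontal direction does not see it, and
  -- a `θ` vanishing on `{y = 0}` satisfies `|θ| ≤ L |y|`, which absorbs the factor `k`.
  obtain ⟨C, hC⟩ : ∃ C : ℝ, ∀ (k : ℕ) z, |θ z * (k * deriv η (k * z.snd) * e.snd)| ≤ C := by
    rcases he with he | he
    · exact ⟨0, fun k z => by simp [he]⟩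
    · obtain ⟨L, hL0, hL⟩ := hθ.exists_abs_le_mul_snd he
      refine ⟨L * M * |e.snd|, fun k z => ?_⟩
      rw [abs_mul, abs_mul, abs_mul]
      have h1 := hM (k * z.snd)
      rw [abs_mul, abs_mul] at h1
      calc |θ z| * (|(k : ℝ)| * |deriv η (k * z.snd)| * |e.snd|)
          ≤ (L * |z.snd|) * (|(k : ℝ)| * |deriv η (k * z.snd)| * |e.snd|) := by
            gcongr; exact hL z
        _ = L * (|(k : ℝ)| * |z.snd| * |deriv η (k * z.snd)|) * |e.snd| := by ring
        _ ≤ L * M * |e.snd| := by gcongr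
  have hlim : Tendsto (fun k => ∫ z, Fk k z) atTop (𝓝 (∫ z, (upperHalf n).indicator F z)) := by
    refine tendsto_integral_of_dominated_convergence (fun z => |F z| + |w z| * C) ?_ ?_ ?_ ?_
    · intro k
      refine AEStronglyMeasurable.add ?_ ?_
      · refine AEStronglyMeasurable.mul (Continuous.aestronglyMeasurable ?_)
          hFi.aestronglyMeasurable
        exact Real.smoothTransition.continuous.comp (by fun_prop)
      · refine hw.aestronglyMeasurable.mul (Continuous.aestronglyMeasurable ?_)
        refine hθ.smooth.continuous.mul ((continuous_const.mul ?_).mul continuous_const)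
        exact ((Real.smoothTransition.contDiff (n := 1)).continuous_deriv le_rfl).comp
          (by fun_prop)
    · exact hFi.abs.add (hw.abs.mul_const C)
    · intro k
      refine Eventually.of_forall fun z => ?_
      refine (norm_add_le _ _).trans (add_le_add ?_ ?_)
      · rw [norm_mul, Real.norm_eq_abs, Real.norm_eq_abs,
          abs_of_nonneg (Real.smoothTransition.nonneg _)]
        exact mul_le_of_le_one_left (abs_nonneg _) (Real.smoothTransition.le_one _)
      · rw [norm_mul, Real.norm_eq_abs, Real.norm_eq_abs]
        exact mul_le_mul_of_nonneg_left (hC k z) (abs_nonneg _)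
    · refine Eventually.of_forall fun z => ?_
      refine tendsto_const_nhds.congr' ?_
      by_cases hz : 0 < z.snd
      · obtain ⟨N, hN⟩ := exists_nat_gt (1 / z.snd)
        filter_upwards [eventually_ge_atTop N] with k hk
        have hk1 : 1 ≤ k * z.snd := by
          have : (N : ℝ) ≤ k := by exact_mod_cast hk
          have := (div_lt_iff₀ hz).1 (hN.trans_le this)
          exact this.le
        rw [indicator_of_mem (show z ∈ upperHalf n from hz)]
        simp only [hFk, hη, Real.smoothTransition.one_of_one_le hk1,
          deriv_smoothTransition_of_one_le hk1]
        ring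
      · refine Eventually.of_forall fun k => ?_
        have hk0 : (k : ℝ) * z.snd ≤ 0 :=
          mul_nonpos_of_nonneg_of_nonpos (Nat.cast_nonneg k) (not_lt.1 hz)
        rw [indicator_of_notMem (show z ∉ upperHalf n from hz)]
        simp only [hFk, hη, Real.smoothTransition.zero_of_nonpos hk0,
          deriv_smoothTransition_of_nonpos hk0]
        ring
  simp only [hzero] at hlim
  rw [← integral_indicator measurableSet_upperHalf]
  exact (tendsto_nhds_unique tendsto_const_nhds hlim).symm

/-- The projection of `ℝⁿ⁺¹` onto `{y = 0}` along `(ξ, 1)`. -/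
noncomputable def obliqueProj (ξ : EuclideanSpace ℝ (Fin n)) (z : Ext n) : Ext n :=
  pt (z.fst - z.snd • ξ) 0

lemma contDiff_obliqueProj (ξ : EuclideanSpace ℝ (Fin n)) : ContDiff ℝ ∞ (obliqueProj ξ) :=
  contDiff_pt.comp ((contDiff_fst'.sub (contDiff_snd'.smul contDiff_const)).prodMk contDiff_const)

lemma obliqueProj_add_smul (ξ : EuclideanSpace ℝ (Fin n)) (z : Ext n) (t : ℝ) :
    obliqueProj ξ (z + t • pt ξ 1) = obliqueProj ξ z := by
  change pt (z.fst + t • ξ - (z.snd + t * 1) • ξ) 0 = pt (z.fst - z.snd • ξ) 0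
  congr 1
  module

/-- Let `θ` carry the boundary values of `ψ` along the lines of direction `(ξ, 1)`. Then `ψ - θ`
vanishes on `{y = 0}` and drops out of Green's formula. For `θ` write `(0, 1) = (ξ, 1) - (ξ, 0)`:
the derivative along `(ξ, 1)` is zero and the horizontal direction has no boundary term. Only the
gradient of `w` remains. -/
lemma IsWeakGradOn.integral_upperHalf_eq_oblique {w : Ext n → ℝ} {G : Ext n → Ext n}
    (h : IsWeakGradOn univ w G) (hw : Integrable w) {R : ℝ} (hwR : ∀ z, R < ‖z‖ → w z = 0)
    (hGR : ∀ z, R < ‖z‖ → G z = 0) {ψ : Ext n → ℝ} (hψ : IsTestOn univ ψ)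
    (ξ : EuclideanSpace ℝ (Fin n)) :
    ∫ z in upperHalf n, (w z * fderiv ℝ ψ z (pt 0 1) + inner ℝ (G z) (pt 0 1) * ψ z) =
      ∫ z in upperHalf n, inner ℝ (G z) (pt ξ 1) * ψ (obliqueProj ξ z) := by
  -- `θ` has no compact support until it is cut off. The radius `R2` is chosen so that the cutoff is
  -- `1` wherever `w`, `G` or `ψ` can be nonzero, hence changes none of the integrals.
  obtain ⟨R1, hR1⟩ := hψ.compact.isBounded.subset_closedBall (0 : Ext n)
  set R2 := max (max R R1) 0 + 1 with hR2
  have hRR : R < R2 := by have := le_max_left (max R R1) 0; have := le_max_left R R1; linarith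
  have hR1R : R1 < R2 := by have := le_max_left (max R R1) 0; have := le_max_right R R1; linarith
  have hR0 : 0 < R2 := by have := le_max_right (max R R1) 0; linarith
  let χ : ContDiffBump (0 : Ext n) := ⟨R2, R2 + 1, hR0, by linarith⟩
  have hχ1 : ∀ z : Ext n, ‖z‖ ≤ R2 → χ z = 1 := fun z hz =>
    χ.one_of_mem_closedBall (by simpa [χ] using hz)
  set θ : Ext n → ℝ := fun z => ψ (obliqueProj ξ z) * χ z with hθd
  have hθ : IsTestOn univ θ :=
    ⟨(hψ.smooth.comp (contDiff_obliqueProj ξ)).mul χ.contDiff, χ.hasCompactSupport.mul_left,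
      subset_univ _⟩
  have hD : IsTestOn univ fun z => ψ z - θ z :=
    ⟨hψ.smooth.sub hθ.smooth, hψ.compact.sub hθ.compact, subset_univ _⟩
  have e1 := h.integral_upperHalf_eq_zero hw hD (pt 0 1) (Or.inr fun x => by
    by_cases hx : ‖(pt x 0 : Ext n)‖ ≤ R2
    · simp [hθd, obliqueProj, hχ1 _ hx]
    · have : ψ (pt x 0) = 0 := image_eq_zero_of_notMem_tsupport fun h' => by
        have := hR1 h'
        rw [Metric.mem_closedBall, dist_zero_right] at this
        linarith
      simp [hθd, obliqueProj, this])
  have e2 := h.integral_upperHalf_eq_zero hw hθ (pt ξ 0) (Or.inl rfl)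
  have hdθ : ∀ z, w z * fderiv ℝ θ z (pt ξ 1) = 0 := by
    intro z
    by_cases hz : R < ‖z‖
    · rw [hwR z hz, zero_mul]
    · have hev : ∀ᶠ z' in 𝓝 z, χ z' = 1 := by
        have : Metric.ball (0 : Ext n) R2 ∈ 𝓝 z := Metric.isOpen_ball.mem_nhds (by
          rw [Metric.mem_ball, dist_zero_right]; linarith)
        filter_upwards [this] with z' hz'
        rw [Metric.mem_ball, dist_zero_right] at hz'
        exact hχ1 z' hz'.le
      have hline : Tendsto (fun t : ℝ => z + t • (pt ξ 1 : Ext n)) (𝓝 0) (𝓝 z) := by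
        have : Continuous fun t : ℝ => z + t • (pt ξ 1 : Ext n) := by fun_prop
        simpa using this.tendsto 0
      have hl : HasLineDerivAt ℝ θ 0 z (pt ξ 1) := by
        refine (hasDerivAt_const (0 : ℝ) (ψ (obliqueProj ξ z))).congr_of_eventuallyEq ?_
        filter_upwards [hline.eventually hev] with t ht
        simp only [hθd, ht, obliqueProj_add_smul, mul_one]
      rw [← (hθ.smooth.differentiable (by simp) z).lineDeriv_eq_fderiv, hl.lineDeriv, mul_zero]
  have hGθ : ∀ z, inner ℝ (G z) (pt ξ 1) * θ z =
      inner ℝ (G z) (pt ξ 1) * ψ (obliqueProj ξ z) := by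
    intro z
    by_cases hz : R < ‖z‖
    · simp [hGR z hz]
    · simp [hθd, hχ1 z (by linarith)]
  have e3 : ∀ z, fderiv ℝ (fun z => ψ z - θ z) z (pt 0 1) =
      fderiv ℝ ψ z (pt 0 1) - fderiv ℝ θ z (pt 0 1) := fun z => by
    rw [fderiv_fun_sub (hψ.smooth.differentiable (by simp) _)
      (hθ.smooth.differentiable (by simp) _)]; rfl
  have e4 : (pt ξ 1 : Ext n) = pt 0 1 + pt ξ 0 := by rw [pt_add]; simp
  have i1 : Integrable fun z => w z * fderiv ℝ (fun z => ψ z - θ z) z (pt 0 1) +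
      inner ℝ (G z) (pt 0 1) * (ψ z - θ z) := (h.integrable_left hD _).add (h.integrable_right hD _)
  have i2 : Integrable fun z => w z * fderiv ℝ θ z (pt ξ 0) + inner ℝ (G z) (pt ξ 0) * θ z :=
    (h.integrable_left hθ _).add (h.integrable_right hθ _)
  have i3 : Integrable fun z => w z * fderiv ℝ ψ z (pt 0 1) + inner ℝ (G z) (pt 0 1) * ψ z :=
    (h.integrable_left hψ _).add (h.integrable_right hψ _)
  have e5 : ∀ z, inner ℝ (G z) (pt ξ 1) * ψ (obliqueProj ξ z) =
      (w z * fderiv ℝ ψ z (pt 0 1) + inner ℝ (G z) (pt 0 1) * ψ z) -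
      (w z * fderiv ℝ (fun z => ψ z - θ z) z (pt 0 1) +
        inner ℝ (G z) (pt 0 1) * (ψ z - θ z)) +
      (w z * fderiv ℝ θ z (pt ξ 0) + inner ℝ (G z) (pt ξ 0) * θ z) := by
    intro z
    have h0 := hdθ z
    rw [e4, map_add] at h0
    rw [← hGθ, e3, e4, inner_add_right]
    linear_combination -h0
  simp_rw [e5]
  have i4 : Integrable fun z => (w z * fderiv ℝ ψ z (pt 0 1) + inner ℝ (G z) (pt 0 1) * ψ z) -
      (w z * fderiv ℝ (fun z => ψ z - θ z) z (pt 0 1) +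
        inner ℝ (G z) (pt 0 1) * (ψ z - θ z)) := i3.sub i1
  rw [integral_add i4.integrableOn i2.integrableOn, integral_sub i3.integrableOn i1.integrableOn,
    e1, e2]
  ring

end HalfSpace

/-! ### The trace as an integral of the gradient over a cone -/

section ConeTrace
variable {n : ℕ}

/-- The volume of the unit ball of `ℝⁿ`. -/
noncomputable def ballVolume (n : ℕ) : ℝ := volume.real (Metric.ball (0 : EuclideanSpace ℝ (Fin n)) 1)

lemma ballVolume_pos : 0 < ballVolume n :=
  ENNReal.toReal_pos (Metric.measure_ball_pos volume _ one_pos).ne' measure_ball_lt_top.ne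

/-- The kernel expressing the trace of a function at `(x, 0)` through its gradient in the cone
`{|x' - x| < y}`. -/
noncomputable def coneKernel (x : EuclideanSpace ℝ (Fin n)) (z : Ext n) : Ext n :=
  if 0 < z.snd ∧ ‖z.fst - x‖ < z.snd then
    ((ballVolume n)⁻¹ * (z.snd ^ n)⁻¹) • pt (z.snd⁻¹ • (z.fst - x)) 1 else 0

/-- The trace on `{y = 0}` of a compactly supported function with gradient `G`. -/
noncomputable def coneTrace (G : Ext n → Ext n) (x : EuclideanSpace ℝ (Fin n)) : ℝ :=
  -∫ z, inner ℝ (coneKernel x z) (G z)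

lemma measurable_coneKernel :
    Measurable fun p : EuclideanSpace ℝ (Fin n) × Ext n => coneKernel p.1 p.2 := by
  have h1 : MeasurableSet {p : EuclideanSpace ℝ (Fin n) × Ext n | 0 < p.2.snd} :=
    measurableSet_lt measurable_const (by fun_prop)
  have h2 : MeasurableSet {p : EuclideanSpace ℝ (Fin n) × Ext n | ‖p.2.fst - p.1‖ < p.2.snd} :=
    measurableSet_lt (by fun_prop) (by fun_prop)
  refine Measurable.ite (h1.inter h2) ?_ measurable_const
  have h3 : Measurable fun p : EuclideanSpace ℝ (Fin n) × Ext n =>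
      (pt (p.2.snd⁻¹ • (p.2.fst - p.1)) 1 : Ext n) :=
    measurable_pt.comp (f := fun p : EuclideanSpace ℝ (Fin n) × Ext n =>
      (p.2.snd⁻¹ • (p.2.fst - p.1), (1 : ℝ))) (by fun_prop)
  have h4 : Measurable fun p : EuclideanSpace ℝ (Fin n) × Ext n =>
      (ballVolume n)⁻¹ * (p.2.snd ^ n)⁻¹ := by fun_prop
  exact h4.smul h3

lemma norm_pt_one_le {ξ : EuclideanSpace ℝ (Fin n)} (hξ : ‖ξ‖ ≤ 1) : ‖(pt ξ 1 : Ext n)‖ ≤ 2 := by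
  refine le_of_sq_le_sq ?_ zero_le_two
  rw [norm_pt_sq]
  nlinarith [norm_nonneg ξ]

lemma norm_coneKernel_le (x : EuclideanSpace ℝ (Fin n)) (z : Ext n) :
    ‖coneKernel x z‖ ≤ (Metric.ball z.fst z.snd).indicator
      (fun _ => 2 * ((ballVolume n)⁻¹ * (z.snd ^ n)⁻¹)) x := by
  unfold coneKernel
  split_ifs with h
  · have hx : x ∈ Metric.ball z.fst z.snd := by
      rw [Metric.mem_ball, dist_comm, dist_eq_norm]; exact h.2
    rw [indicator_of_mem hx, norm_smul, Real.norm_eq_abs, abs_of_nonneg (by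
      have := ballVolume_pos (n := n); have := h.1; positivity), mul_comm]
    refine mul_le_mul_of_nonneg_right (norm_pt_one_le ?_) (by
      have := ballVolume_pos (n := n); have := h.1; positivity)
    rw [norm_smul, norm_inv, Real.norm_eq_abs, abs_of_pos h.1, inv_mul_le_iff₀ h.1, mul_one]
    exact h.2.le
  · rw [norm_zero]
    by_cases hx : x ∈ Metric.ball z.fst z.snd
    · have hz : 0 < z.snd := Metric.pos_of_mem_ball hx
      rw [indicator_of_mem hx]
      have := ballVolume_pos (n := n)
      positivity
    · rw [indicator_of_notMem hx]

/-- For fixed `z` at height `y`, the apex `x` ranges over a ball of radius `y`, of volume `yⁿ |B|`;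
this cancels the factor `1 / (|B| yⁿ)` of the kernel and leaves the bound `2` on `|(ξ, 1)|`. It
gives the `L¹` bound on traces. -/
lemma lintegral_coneKernel_le (z : Ext n) : ∫⁻ x, ‖coneKernel x z‖ₑ ≤ 2 := by
  have hv := ballVolume_pos (n := n)
  calc ∫⁻ x, ‖coneKernel x z‖ₑ ≤ ∫⁻ x, (Metric.ball z.fst z.snd).indicator
          (fun _ => ENNReal.ofReal (2 * ((ballVolume n)⁻¹ * (z.snd ^ n)⁻¹))) x := by
        refine lintegral_mono fun x => ?_
        rw [← ofReal_norm]
        refine (ENNReal.ofReal_le_ofReal (norm_coneKernel_le x z)).trans (le_of_eq ?_)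
        by_cases hx : x ∈ Metric.ball z.fst z.snd
        · rw [indicator_of_mem hx, indicator_of_mem hx]
        · rw [indicator_of_notMem hx, indicator_of_notMem hx, ENNReal.ofReal_zero]
    _ = ENNReal.ofReal (2 * ((ballVolume n)⁻¹ * (z.snd ^ n)⁻¹)) *
        volume (Metric.ball z.fst z.snd) := by
        rw [lintegral_indicator_const measurableSet_ball]
    _ ≤ 2 := by
        rcases le_or_gt z.snd 0 with hz | hz
        · rw [Metric.ball_eq_empty.2 hz]; simp
        · rw [Measure.addHaar_ball_of_pos _ _ hz, finrank_euclideanSpace_fin,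
            ← ofReal_measureReal (measure_ball_lt_top.ne), ← ENNReal.ofReal_mul (by positivity),
            ← ENNReal.ofReal_mul (by positivity)]
          change ENNReal.ofReal (_ * (_ * ballVolume n)) ≤ 2
          rw [show 2 * ((ballVolume n)⁻¹ * (z.snd ^ n)⁻¹) * (z.snd ^ n * ballVolume n) = 2 by
            field_simp]
          simp

lemma aestronglyMeasurable_cone {G : Ext n → Ext n} (hG : AEStronglyMeasurable G)
    {ψ : EuclideanSpace ℝ (Fin n) → ℝ} (hψ : Measurable ψ) :
    AEStronglyMeasurable (fun p : EuclideanSpace ℝ (Fin n) × Ext n =>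
      ψ p.1 * inner ℝ (coneKernel p.1 p.2) (G p.2)) (volume.prod volume) :=
  (hψ.comp measurable_fst).aestronglyMeasurable.mul
    (measurable_coneKernel.aestronglyMeasurable.inner hG.comp_snd)

lemma lintegral_lintegral_cone_le {G : Ext n → Ext n} (hG : AEStronglyMeasurable G) :
    ∫⁻ x, ∫⁻ z, ‖inner ℝ (coneKernel x z) (G z)‖ₑ ≤ 2 * ∫⁻ z, ‖G z‖ₑ := by
  have hm := (aestronglyMeasurable_cone hG (ψ := fun _ => 1) measurable_const).enorm
  simp only [one_mul] at hm
  rw [lintegral_lintegral_swap hm, ← lintegral_const_mul'' _ hG.enorm]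
  refine lintegral_mono fun z => ?_
  calc ∫⁻ x, ‖inner ℝ (coneKernel x z) (G z)‖ₑ ≤ ∫⁻ x, ‖coneKernel x z‖ₑ * ‖G z‖ₑ := by
        refine lintegral_mono fun x => ?_
        rw [← ofReal_norm, ← ofReal_norm, ← ofReal_norm, ← ENNReal.ofReal_mul (norm_nonneg _)]
        exact ENNReal.ofReal_le_ofReal (norm_inner_le_norm _ _)
    _ = (∫⁻ x, ‖coneKernel x z‖ₑ) * ‖G z‖ₑ := by
        refine lintegral_mul_const _ ?_
        exact (measurable_coneKernel.comp (measurable_id.prodMk measurable_const)).enorm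
    _ ≤ 2 * ‖G z‖ₑ := by gcongr; exact lintegral_coneKernel_le z

lemma integrable_cone {G : Ext n → Ext n} (hG : Integrable G)
    {ψ : EuclideanSpace ℝ (Fin n) → ℝ} (hψ : Measurable ψ) {C : ℝ} (hC : ∀ x, |ψ x| ≤ C) :
    Integrable (fun p : EuclideanSpace ℝ (Fin n) × Ext n =>
      ψ p.1 * inner ℝ (coneKernel p.1 p.2) (G p.2)) (volume.prod volume) := by
  have h1 : Integrable (fun p : EuclideanSpace ℝ (Fin n) × Ext n =>
      inner ℝ (coneKernel p.1 p.2) (G p.2)) (volume.prod volume) := by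
    have hm := aestronglyMeasurable_cone hG.1 (ψ := fun _ => 1) measurable_const
    simp only [one_mul] at hm
    refine ⟨hm, ?_⟩
    rw [HasFiniteIntegral, lintegral_prod _ hm.enorm]
    exact (lintegral_lintegral_cone_le hG.1).trans_lt
      (ENNReal.mul_lt_top (by simp) hG.2)
  exact h1.bdd_mul (hψ.comp measurable_fst).aestronglyMeasurable
    (Eventually.of_forall fun p => hC p.1)

lemma ae_integrable_cone {G : Ext n → Ext n} (hG : Integrable G) :
    ∀ᵐ x : EuclideanSpace ℝ (Fin n), Integrable fun z => inner ℝ (coneKernel x z) (G z) := by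
  have := (integrable_cone hG (ψ := fun _ => 1) measurable_const (C := 1) (by simp)).prod_right_ae
  simpa using this

lemma integrable_coneTrace {G : Ext n → Ext n} (hG : Integrable G) : Integrable (coneTrace G) := by
  have := (integrable_cone hG (ψ := fun _ => 1) measurable_const (C := 1)
    (by simp)).integral_prod_left
  simp only [one_mul] at this
  exact this.neg

lemma lintegral_coneTrace_le {G : Ext n → Ext n} (hG : AEStronglyMeasurable G) :
    ∫⁻ x, ‖coneTrace G x‖ₑ ≤ 2 * ∫⁻ z, ‖G z‖ₑ := by
  refine (lintegral_mono fun x => ?_).trans (lintegral_lintegral_cone_le hG)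
  rw [coneTrace, enorm_neg]
  exact enorm_integral_le_lintegral_enorm _

lemma coneTrace_add_ae {G H : Ext n → Ext n} (hG : Integrable G) (hH : Integrable H) :
    coneTrace (fun z => G z + H z) =ᵐ[volume] fun x => coneTrace G x + coneTrace H x := by
  filter_upwards [ae_integrable_cone hG, ae_integrable_cone hH] with x h1 h2
  simp only [coneTrace, inner_add_right]
  rw [integral_add h1 h2]; ring

lemma coneTrace_sub_ae {G H : Ext n → Ext n} (hG : Integrable G) (hH : Integrable H) :
    coneTrace (fun z => G z - H z) =ᵐ[volume] fun x => coneTrace G x - coneTrace H x := by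
  filter_upwards [ae_integrable_cone hG, ae_integrable_cone hH] with x h1 h2
  simp only [coneTrace, inner_sub_right]
  rw [integral_sub h1 h2]; ring

/-- The substitution `x = x' - y ξ` at a point `z = (x', y)`, with Jacobian `yⁿ`. It identifies the
average over directions `ξ` with the kernel. -/
lemma integral_mul_coneKernel (ψ : EuclideanSpace ℝ (Fin n) → ℝ) {z : Ext n} (hz : 0 < z.snd)
    (g : Ext n) : ∫ x, ψ x * inner ℝ (coneKernel x z) g =
      (ballVolume n)⁻¹ * ∫ ξ in Metric.ball 0 1, inner ℝ g (pt ξ 1) * ψ (z.fst - z.snd • ξ) := by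
  rw [← integral_sub_left_eq_self (fun x => ψ x * inner ℝ (coneKernel x z) g) volume z.fst]
  have h := Measure.integral_comp_smul (volume : Measure (EuclideanSpace ℝ (Fin n)))
    (fun x => ψ (z.fst - x) * inner ℝ (coneKernel (z.fst - x) z) g) z.snd
  rw [finrank_euclideanSpace_fin, abs_of_pos (by positivity), smul_eq_mul,
    eq_inv_mul_iff_mul_eq₀ (by positivity)] at h
  rw [← h, ← integral_indicator measurableSet_ball, ← integral_const_mul, ← integral_const_mul]
  congr 1; ext ξ
  have e1 : z.fst - (z.fst - z.snd • ξ) = z.snd • ξ := by abel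
  have e2 : ‖z.snd • ξ‖ < z.snd ↔ ξ ∈ Metric.ball (0 : EuclideanSpace ℝ (Fin n)) 1 := by
    rw [norm_smul, Real.norm_eq_abs, abs_of_pos hz, Metric.mem_ball, dist_zero_right]
    exact mul_lt_iff_lt_one_right hz
  by_cases hξ : ξ ∈ Metric.ball (0 : EuclideanSpace ℝ (Fin n)) 1
  · rw [indicator_of_mem hξ, coneKernel, e1, if_pos ⟨hz, e2.2 hξ⟩, smul_smul,
      inv_mul_cancel₀ hz.ne', one_smul, inner_smul_left, real_inner_comm]
    have : z.snd ^ n ≠ 0 := by positivity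
    simp only [conj_trivial]
    field_simp
  · rw [indicator_of_notMem hξ, coneKernel, e1, if_neg fun h => hξ (e2.1 h.2)]
    simp

/-- Green's formula in the upper half-space, with the trace given by the gradient. -/
lemma IsWeakGradOn.integral_upperHalf_eq_coneTrace {w : Ext n → ℝ} {G : Ext n → Ext n}
    (h : IsWeakGradOn univ w G) (hw : Integrable w) (hG : Integrable G) {R : ℝ}
    (hwR : ∀ z, R < ‖z‖ → w z = 0) (hGR : ∀ z, R < ‖z‖ → G z = 0)
    {ψ : Ext n → ℝ} (hψ : IsTestOn univ ψ) :
    ∫ z in upperHalf n, (w z * fderiv ℝ ψ z (pt 0 1) + inner ℝ (G z) (pt 0 1) * ψ z) =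
      -∫ x, coneTrace G x * ψ (pt x 0) := by
  set LHS := ∫ z in upperHalf n,
    (w z * fderiv ℝ ψ z (pt 0 1) + inner ℝ (G z) (pt 0 1) * ψ z) with hL
  obtain ⟨C, hC⟩ := hψ.exists_bound
  have hψm : Measurable fun x : EuclideanSpace ℝ (Fin n) => ψ (pt x 0) :=
    hψ.smooth.continuous.measurable.comp
      (measurable_pt.comp (f := fun x : EuclideanSpace ℝ (Fin n) => (x, (0 : ℝ))) (by fun_prop))
  have hv := ballVolume_pos (n := n)
  have hcone := integrable_cone hG hψm (fun x => hC (pt x 0))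
  -- The left side does not depend on `ξ`, so it equals its average over the unit ball of
  -- directions.
  have e1 : LHS = (ballVolume n)⁻¹ * ∫ ξ in Metric.ball (0 : EuclideanSpace ℝ (Fin n)) 1,
      ∫ z in upperHalf n, inner ℝ (G z) (pt ξ 1) * ψ (obliqueProj ξ z) := by
    simp_rw [← h.integral_upperHalf_eq_oblique hw hwR hGR hψ, ← hL]
    rw [setIntegral_const, smul_eq_mul]
    change LHS = (ballVolume n)⁻¹ * (ballVolume n * LHS)
    field_simp
  have hfin : IsFiniteMeasure (volume.restrict (Metric.ball (0 : EuclideanSpace ℝ (Fin n)) 1)) :=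
    ⟨by rw [Measure.restrict_apply_univ]; exact measure_ball_lt_top⟩
  have hint : Integrable (Function.uncurry fun (ξ : EuclideanSpace ℝ (Fin n)) (z : Ext n) =>
      inner ℝ (G z) (pt ξ 1) * ψ (obliqueProj ξ z))
      ((volume.restrict (Metric.ball 0 1)).prod (volume.restrict (upperHalf n))) := by
    have hb : Integrable (fun p : EuclideanSpace ℝ (Fin n) × Ext n => (2 * C) * ‖G p.2‖)
        ((volume.restrict (Metric.ball 0 1)).prod (volume.restrict (upperHalf n))) :=
      (integrable_const (2 * C)).mul_prod hG.norm.integrableOn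
    refine hb.mono' ?_ ?_
    · refine AEStronglyMeasurable.mul ?_ (Continuous.aestronglyMeasurable ?_)
      · refine (hG.1.restrict.comp_snd).inner (Continuous.aestronglyMeasurable ?_)
        exact continuous_pt.comp (f := fun p : EuclideanSpace ℝ (Fin n) × Ext n => (p.1, (1 : ℝ)))
          (by fun_prop)
      · refine hψ.smooth.continuous.comp (continuous_pt.comp
          (f := fun p : EuclideanSpace ℝ (Fin n) × Ext n => (p.2.fst - p.2.snd • p.1, (0 : ℝ))) ?_)
        fun_prop
    · have : ∀ᵐ p : EuclideanSpace ℝ (Fin n) × Ext n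
          ∂((volume.restrict (Metric.ball 0 1)).prod (volume.restrict (upperHalf n))),
          p.1 ∈ Metric.ball (0 : EuclideanSpace ℝ (Fin n)) 1 :=
        Measure.quasiMeasurePreserving_fst.ae (ae_restrict_mem measurableSet_ball)
      filter_upwards [this] with p hp
      rw [Metric.mem_ball, dist_zero_right] at hp
      simp only [Function.uncurry]
      rw [norm_mul, Real.norm_eq_abs (ψ _)]
      calc _ ≤ (‖G p.2‖ * ‖(pt p.1 1 : Ext n)‖) * |ψ (obliqueProj p.1 p.2)| := by
            gcongr; exact norm_inner_le_norm _ _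
        _ ≤ (‖G p.2‖ * 2) * C := by
            gcongr
            · exact norm_pt_one_le hp.le
            · exact hC _
        _ = 2 * C * ‖G p.2‖ := by ring
  rw [e1, integral_integral_swap hint, ← integral_const_mul]
  have e2 : ∫ z in upperHalf n, (ballVolume n)⁻¹ * ∫ ξ in Metric.ball 0 1,
      inner ℝ (G z) (pt ξ 1) * ψ (obliqueProj ξ z) =
      ∫ z in upperHalf n, ∫ x, ψ (pt x 0) * inner ℝ (coneKernel x z) (G z) :=
    setIntegral_congr_fun measurableSet_upperHalf fun z hz =>
      (integral_mul_coneKernel (fun x => ψ (pt x 0)) hz (G z)).symm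
  rw [e2, setIntegral_eq_integral_of_forall_compl_eq_zero fun z hz => ?_,
    ← integral_integral_swap hcone, ← integral_neg]
  · congr 1; ext x
    rw [integral_const_mul, coneTrace]; ring
  · have : ∀ x : EuclideanSpace ℝ (Fin n), coneKernel x z = 0 := fun x => if_neg fun h => hz h.1
    simp [this]

end ConeTrace

/-! ### Traces on the hyperplane -/

section FlatTrace
variable {n : ℕ}

/-- Every test function on the disc is the restriction of one on the ball, namely its product with a
bump in `y`; the fundamental lemma of the calculus of variations then applies. -/
lemma IsFlatTrace.ae_eq {v : Ext n → ℝ} {g g' : EuclideanSpace ℝ (Fin n) → ℝ}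
    (h : IsFlatTrace (unitBall n) v g) (h' : IsFlatTrace (unitBall n) v g') :
    ∀ᵐ x : EuclideanSpace ℝ (Fin n), x ∈ slice (unitBall n) → g x = g' x := by
  have key : ∀ᵐ x : EuclideanSpace ℝ (Fin n), x ∈ slice (unitBall n) → g x - g' x = 0 := by
    have hopen : IsOpen (slice (unitBall n)) := by rw [slice_unitBall]; exact Metric.isOpen_ball
    refine hopen.ae_eq_zero_of_integral_contDiff_smul_eq_zero (h.locInt.sub h'.locInt)
      fun ψ hψ hψc hψs => ?_
    obtain ⟨r, ⟨hr0, hr1⟩, hr⟩ := exists_pos_lt_subset_ball one_pos (isClosed_tsupport ψ)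
      (by rwa [slice_unitBall] at hψs)
    have hψ0 : ∀ x, r < ‖x‖ → ψ x = 0 := fun x hx =>
      image_eq_zero_of_notMem_tsupport fun h' => by
        have := hr h'
        rw [Metric.mem_ball, dist_zero_right] at this
        linarith
    -- With `ψ` supported in radius `r`, a bump vanishing for `|y| ≥ (1 - r) / 2` keeps the product
    -- inside radius `r + (1 - r) / 2 = (1 + r) / 2 < 1`.
    let χ : ContDiffBump (0 : ℝ) := ⟨(1 - r) / 4, (1 - r) / 2, by linarith, by linarith⟩
    have hχ1 : χ 0 = 1 := χ.one_of_mem_closedBall (Metric.mem_closedBall_self χ.rIn_pos.le)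
    have hχ0 : ∀ t : ℝ, (1 - r) / 2 ≤ |t| → χ t = 0 := fun t ht =>
      χ.zero_of_le_dist (by simpa [χ] using ht)
    set Ψ : Ext n → ℝ := fun z => ψ z.fst * χ z.snd with hΨd
    have hΨ : IsTestOn (unitBall n) Ψ := by
      refine isTestOn_of_norm (r := (1 + r) / 2) ((hψ.comp contDiff_fst').mul
        (χ.contDiff.comp contDiff_snd')) (fun z hz => ?_) fun z hz => ?_
      · have h1 : ‖z‖ ≤ ‖z.fst‖ + |z.snd| := by
          refine le_of_sq_le_sq ?_ (by positivity)
          rw [norm_sq_eq, add_sq, sq_abs]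
          have : 0 ≤ 2 * ‖z.fst‖ * |z.snd| := by positivity
          linarith
        by_cases h2 : r < ‖z.fst‖
        · simp [hΨd, hψ0 _ h2]
        · simp [hΨd, hχ0 z.snd (by linarith)]
      · rw [Metric.mem_closedBall, dist_zero_right] at hz
        rw [mem_unitBall]; linarith
    have e1 := h.green Ψ hΨ
    rw [h'.green Ψ hΨ, neg_inj] at e1
    have hΨ0 : ∀ x, Ψ (pt x 0) = ψ x := fun x => by simp [hΨd, hχ1]
    simp only [hΨ0] at e1
    have hi : ∀ {f : EuclideanSpace ℝ (Fin n) → ℝ}, LocallyIntegrableOn f (slice (unitBall n)) →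
        Integrable fun x => f x * ψ x := by
      intro f hf
      have h1 : IntegrableOn f (tsupport ψ) := hf.integrableOn_compact_subset hψs hψc
      have h2 := h1.mul_continuousOn hψ.continuous.continuousOn hψc
      refine (integrableOn_iff_integrable_of_support_subset ?_).1 h2
      exact (Function.support_mul_subset_right _ _).trans (subset_tsupport ψ)
    have hz : ∀ f : EuclideanSpace ℝ (Fin n) → ℝ, ∫ x in slice (unitBall n), f x * ψ x =
        ∫ x, f x * ψ x := fun f =>
      setIntegral_eq_integral_of_forall_compl_eq_zero fun x hx => by
        rw [image_eq_zero_of_notMem_tsupport fun h' => hx (hψs h'), mul_zero]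
    rw [hz, hz] at e1
    have e2 : ∀ x, ψ x • (g x - g' x) = g x * ψ x - g' x * ψ x := fun x => by
      rw [smul_eq_mul]; ring
    simp_rw [e2]
    rw [integral_sub (hi h.locInt) (hi h'.locInt), e1, sub_self]
  filter_upwards [key] with x hx hxs
  linarith [hx hxs]

lemma IsFlatTrace.flatTrace_ae_eq {v : Ext n → ℝ} {g : EuclideanSpace ℝ (Fin n) → ℝ}
    (h : IsFlatTrace (unitBall n) v g) :
    ∀ᵐ x : EuclideanSpace ℝ (Fin n), x ∈ slice (unitBall n) →
      flatTrace (unitBall n) v x = g x := by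
  have hex : ∃ g, IsFlatTrace (unitBall n) v g := ⟨g, h⟩
  have : IsFlatTrace (unitBall n) v (flatTrace (unitBall n) v) := by
    rw [flatTrace, dif_pos hex]; exact hex.choose_spec
  exact this.ae_eq h

lemma setIntegral_green_congr {v : Ext n → ℝ} {G : Ext n → Ext n}
    (hG : weakGrad (unitBall n) v =ᵐ[volume.restrict (unitBall n)] G)
    {s : Set (Ext n)} (hs : s ⊆ unitBall n) (ψ : Ext n → ℝ) (e : Ext n) :
    ∫ z in s, (v z * fderiv ℝ ψ z e + inner ℝ (weakGrad (unitBall n) v z) e * ψ z) =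
      ∫ z in s, (v z * fderiv ℝ ψ z e + inner ℝ (G z) e * ψ z) := by
  refine integral_congr_ae ?_
  filter_upwards [ae_mono (Measure.restrict_mono_set volume hs) hG] with z hz
  rw [hz]

/-- A test function of the ball kills everything outside it, so the half-space formula for the
extension `w` is the half-ball formula for `v`. -/
lemma isFlatTrace_coneTrace {v w : Ext n → ℝ} {G : Ext n → Ext n}
    (h : IsWeakGradOn univ w G) (hw : Integrable w) (hG : Integrable G) {R : ℝ}
    (hwR : ∀ z, R < ‖z‖ → w z = 0) (hGR : ∀ z, R < ‖z‖ → G z = 0)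
    (hvw : ∀ z ∈ unitBall n, v z = w z) : IsFlatTrace (unitBall n) v (coneTrace G) where
  locInt := (integrable_coneTrace hG).integrableOn.locallyIntegrableOn
  green ψ hψ := by
    have hv : IsWeakGradOn (unitBall n) v G :=
      (h.mono (subset_univ _)).congr measurableSet_unitBall (fun z hz => (hvw z hz).symm)
        fun _ _ => rfl
    rw [setIntegral_green_congr (hv.weakGrad_ae_eq isOpen_unitBall) inter_subset_left]
    have e1 := h.integral_upperHalf_eq_coneTrace hw hG hwR hGR (hψ.mono (subset_univ _))
    have e2 : ∫ z in unitBall n ∩ upperHalf n,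
        (v z * fderiv ℝ ψ z (pt 0 1) + inner ℝ (G z) (pt 0 1) * ψ z) =
        ∫ z in unitBall n ∩ upperHalf n,
        (w z * fderiv ℝ ψ z (pt 0 1) + inner ℝ (G z) (pt 0 1) * ψ z) :=
      setIntegral_congr_fun (measurableSet_unitBall.inter measurableSet_upperHalf)
        fun z hz => by simp only [hvw z hz.1]
    rw [e2, ← setIntegral_eq_of_subset_of_forall_sdiff_eq_zero measurableSet_upperHalf
      inter_subset_right fun z hz => ?_, e1,
      ← setIntegral_eq_integral_of_forall_compl_eq_zero fun x hx => ?_]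
    · rw [hψ.eq_zero hx, mul_zero]
    · have : z ∉ unitBall n := fun h => hz.2 ⟨h, hz.1⟩
      simp [hψ.eq_zero this, hψ.fderiv_eq_zero this]

end FlatTrace

/-! ### Radial cutoffs and spherical shells -/

section SphereGreen
variable {n : ℕ}

/-- The radial cutoff which is `1` for `‖z‖ ≤ 1 - h` and `0` for `‖z‖ ≥ 1`. -/
noncomputable def radialCutoff (h : ℝ) (z : Ext n) : ℝ := min 1 (max 0 (h⁻¹ * (1 - ‖z‖)))

lemma radialCutoff_nonneg (h : ℝ) (z : Ext n) : 0 ≤ radialCutoff h z :=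
  le_min zero_le_one (le_max_left _ _)

lemma radialCutoff_le_one (h : ℝ) (z : Ext n) : radialCutoff h z ≤ 1 := min_le_left _ _

lemma radialCutoff_of_one_le {h : ℝ} (hh : 0 < h) {z : Ext n} (hz : 1 ≤ ‖z‖) :
    radialCutoff h z = 0 := by
  have : h⁻¹ * (1 - ‖z‖) ≤ 0 :=
    mul_nonpos_of_nonneg_of_nonpos (inv_pos.2 hh).le (by linarith)
  rw [radialCutoff, max_eq_left this, min_eq_right zero_le_one]

lemma radialCutoff_of_le {h : ℝ} (hh : 0 < h) {z : Ext n} (hz : ‖z‖ ≤ 1 - h) :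
    radialCutoff h z = 1 := by
  have : 1 ≤ h⁻¹ * (1 - ‖z‖) := by
    rw [inv_mul_eq_div, le_div_iff₀ hh]; linarith
  rw [radialCutoff, max_eq_right (by linarith), min_eq_left this]

lemma radialCutoff_of_mem {h : ℝ} (hh : 0 < h) {z : Ext n} (hz : 1 - h ≤ ‖z‖) (hz1 : ‖z‖ ≤ 1) :
    radialCutoff h z = h⁻¹ * (1 - ‖z‖) := by
  have h1 : h⁻¹ * (1 - ‖z‖) ≤ 1 := by
    rw [inv_mul_eq_div, div_le_iff₀ hh]; linarith
  have h0 : 0 ≤ h⁻¹ * (1 - ‖z‖) := mul_nonneg (inv_pos.2 hh).le (by linarith)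
  rw [radialCutoff, max_eq_right h0, min_eq_right h1]

lemma lipschitzWith_radialCutoff {h : ℝ} (hh : 0 < h) :
    ∃ C, LipschitzWith C (radialCutoff h : Ext n → ℝ) := by
  have h1 : LipschitzWith (Real.toNNReal h⁻¹) fun z : Ext n => h⁻¹ * (1 - ‖z‖) := by
    refine LipschitzWith.of_dist_le' fun a b => ?_
    rw [Real.dist_eq, dist_eq_norm, ← mul_sub, abs_mul, abs_of_pos (inv_pos.2 hh)]
    refine mul_le_mul_of_nonneg_left ?_ (inv_pos.2 hh).le
    rw [show 1 - ‖a‖ - (1 - ‖b‖) = ‖b‖ - ‖a‖ by ring, norm_sub_rev]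
    exact abs_norm_sub_norm_le b a
  exact ⟨_, (h1.const_max 0).const_min 1⟩

lemma hasCompactSupport_radialCutoff {h : ℝ} (hh : 0 < h) :
    HasCompactSupport (radialCutoff h : Ext n → ℝ) :=
  HasCompactSupport.intro (isCompact_closedBall (0 : Ext n) 1) fun z hz =>
    radialCutoff_of_one_le hh (by
      rw [Metric.mem_closedBall, dist_zero_right, not_le] at hz; exact hz.le)

lemma hasDerivAt_norm_add_smul {F : Type*} [NormedAddCommGroup F] [InnerProductSpace ℝ F] {z : F}
    (hz : z ≠ 0) (v : F) :
    HasDerivAt (fun t : ℝ => ‖z + t • v‖) (inner ℝ z v / ‖z‖) 0 := by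
  have h1 : HasDerivAt (fun t : ℝ => z + t • v) v 0 := by
    simpa using ((hasDerivAt_id (0 : ℝ)).smul_const v).const_add z
  have h2 := h1.norm_sq.sqrt (by simpa using hz)
  simp only [zero_smul, add_zero, norm_nonneg, Real.sqrt_sq] at h2
  convert! h2 using 1
  field_simp

/-- The closed-open spherical shell. -/
def shell (n : ℕ) (h : ℝ) : Set (Ext n) := {z | 1 - h ≤ ‖z‖ ∧ ‖z‖ < 1}

lemma measurableSet_shell (h : ℝ) : MeasurableSet (shell n h) :=
  (measurableSet_le measurable_const measurable_norm).inter
    (measurableSet_lt measurable_norm measurable_const)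

/-- The cutoff fails to be differentiable only on the two bounding spheres, which are null. The
condition `h < 1` keeps the origin, where the norm is singular, out of the shell. -/
lemma lineDeriv_radialCutoff_ae {h : ℝ} (hh : 0 < h) (hh1 : h < 1) (e : Ext n) :
    ∀ᵐ z : Ext n, lineDeriv ℝ (radialCutoff h) z (-e) =
      (shell n h).indicator (fun z => h⁻¹ * (inner ℝ z e / ‖z‖)) z := by
  have hs : ∀ r : ℝ, r ≠ 0 → ∀ᵐ z : Ext n, ‖z‖ ≠ r := fun r hr => by
    have := Measure.addHaar_sphere_of_ne_zero (volume : Measure (Ext n)) 0 hr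
    rw [measure_eq_zero_iff_ae_notMem] at this
    filter_upwards [this] with z hz h'
    exact hz (by simpa using h')
  filter_upwards [hs 1 one_ne_zero, hs (1 - h) (by linarith)] with z h1 h2
  have hline : Tendsto (fun t : ℝ => ‖z + t • (-e)‖) (𝓝 0) (𝓝 ‖z‖) := by
    have : Continuous fun t : ℝ => ‖z + t • (-e)‖ := by fun_prop
    simpa using this.tendsto 0
  refine HasLineDerivAt.lineDeriv ?_
  rcases lt_or_gt_of_ne h1 with h3 | h3
  · rcases lt_or_gt_of_ne h2 with h4 | h4
    · rw [indicator_of_notMem (fun h' => absurd h'.1 (not_le.2 h4))]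
      refine (hasDerivAt_const (0 : ℝ) (1 : ℝ)).congr_of_eventuallyEq ?_
      filter_upwards [hline.eventually (gt_mem_nhds h4)] with t ht
      exact radialCutoff_of_le hh ht.le
    · rw [indicator_of_mem (show z ∈ shell n h from ⟨h4.le, h3⟩)]
      have hz0 : z ≠ 0 := fun h0 => by rw [h0, norm_zero] at h4; linarith
      have hd := ((hasDerivAt_norm_add_smul hz0 (-e)).const_sub 1).const_mul h⁻¹
      rw [inner_neg_right, neg_div, neg_neg] at hd
      refine hd.congr_of_eventuallyEq ?_
      filter_upwards [hline.eventually (gt_mem_nhds h3), hline.eventually (lt_mem_nhds h4)]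
        with t ht ht'
      exact radialCutoff_of_mem hh ht'.le ht.le
  · rw [indicator_of_notMem (fun h' => absurd h'.2 (not_lt.2 h3.le))]
    refine (hasDerivAt_const (0 : ℝ) (0 : ℝ)).congr_of_eventuallyEq ?_
    filter_upwards [hline.eventually (lt_mem_nhds h3)] with t ht
    exact radialCutoff_of_one_le hh ht.le

/-- Integration over a shell in polar coordinates, for functions homogeneous of degree zero. -/
lemma setIntegral_shell {h : ℝ} (hh : 0 < h) (hh1 : h < 1) (H : Ext n → ℝ) :
    ∫ z in shell n h, H (‖z‖⁻¹ • z) =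
      (∫ ζ : Metric.sphere (0 : Ext n) 1, H ζ ∂(volume : Measure (Ext n)).toSphere) *
      ((1 - (1 - h) ^ (Module.finrank ℝ (Ext n) - 1 + 1)) /
        ((Module.finrank ℝ (Ext n) - 1 : ℕ) + 1)) := by
  set m := Module.finrank ℝ (Ext n) - 1 with hm
  let a : Ioi (0 : ℝ) := ⟨1 - h, by simpa using hh1⟩
  let b : Ioi (0 : ℝ) := ⟨1, by simp⟩
  have hab : a ≤ b := by change 1 - h ≤ 1; linarith
  have h1 := (Measure.measurePreserving_homeomorphUnitSphereProd
    (volume : Measure (Ext n))).integral_comp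
    (homeomorphUnitSphereProd (Ext n)).measurableEmbedding
    (fun p => H (p.1 : Ext n) * (Ico a b).indicator (fun _ => (1 : ℝ)) p.2)
  rw [integral_prod_mul (fun ζ : Metric.sphere (0 : Ext n) 1 => H ζ), ← hm] at h1
  have h2 : ∫ r, (Ico a b).indicator (fun _ => (1 : ℝ)) r ∂(Measure.volumeIoiPow m) =
      (1 - (1 - h) ^ (m + 1)) / ((m : ℝ) + 1) := by
    rw [integral_indicator measurableSet_Ico, setIntegral_const, smul_eq_mul, mul_one,
      ← Iio_sdiff_Iio, measureReal_sdiff (Iio_subset_Iio hab) measurableSet_Iio (by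
        rw [Measure.volumeIoiPow_apply_Iio]; exact ENNReal.ofReal_ne_top)]
    simp only [measureReal_def, Measure.volumeIoiPow_apply_Iio]
    rw [ENNReal.toReal_ofReal (by simp only [b]; positivity), ENNReal.toReal_ofReal (by
      have : (0 : ℝ) < a := a.2
      positivity)]
    simp only [a, b, one_pow]
    ring
  rw [h2] at h1
  rw [← h1, ← integral_indicator (measurableSet_shell h)]
  -- Polar coordinates live on the complement of the origin, and the shell does not contain the
  -- origin.
  have h3 : ∀ z : Ext n, (shell n h).indicator (fun z => H (‖z‖⁻¹ • z)) z =
      ({0}ᶜ : Set (Ext n)).indicator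
        ((shell n h).indicator (fun z => H (‖z‖⁻¹ • z))) z := by
    intro z
    by_cases hz : z = 0
    · subst hz
      rw [indicator_of_notMem (fun h' => ?_), indicator_of_notMem (by simp)]
      have := h'.1
      rw [norm_zero] at this
      linarith
    · rw [indicator_of_mem (s := ({0}ᶜ : Set (Ext n))) (by simpa using hz)]
  simp_rw [h3]
  rw [integral_indicator (measurableSet_singleton _).compl,
    ← integral_subtype_comap (measurableSet_singleton _).compl]
  congr 1; ext z
  have hz : z.1 ≠ 0 := z.2
  by_cases hs : z.1 ∈ shell n h
  · rw [indicator_of_mem hs, indicator_of_mem (show ((homeomorphUnitSphereProd (Ext n)) z).2 ∈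
      Ico a b from ⟨Subtype.coe_le_coe.1 (by simpa [a] using hs.1),
        Subtype.coe_lt_coe.1 (by simpa [b] using hs.2)⟩), mul_one]
    simp
  · rw [indicator_of_notMem hs, indicator_of_notMem, mul_zero]
    rintro ⟨h4, h5⟩
    refine hs ⟨?_, ?_⟩
    · simpa [a] using Subtype.coe_le_coe.2 h4
    · simpa [b] using Subtype.coe_lt_coe.2 h5

end SphereGreen

/-! ### The divergence theorem in the unit ball -/

section SphereGreen
variable {n : ℕ}

/-- With `h = 1 / (k + 2)`, this says that the radial integral over a shell, divided by its
thickness, tends to `1`. It is a difference quotient at `1` of `t^(m+1) / (m+1)`, whose derivative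
there is `1`. -/
lemma tendsto_shell_ratio (m : ℕ) : Tendsto (fun k : ℕ => ((k : ℝ) + 2) *
    ((1 - (1 - ((k : ℝ) + 2)⁻¹) ^ (m + 1)) / ((m : ℝ) + 1))) atTop (𝓝 1) := by
  have hd : HasDerivAt (fun t : ℝ => t ^ (m + 1) / ((m : ℝ) + 1)) 1 1 := by
    have := (hasDerivAt_pow (m + 1) (1 : ℝ)).div_const ((m : ℝ) + 1)
    convert! this using 1
    have : (m : ℝ) + 1 ≠ 0 := by positivity
    push_cast
    simp [this]
  have ht : Tendsto (fun k : ℕ => ((k : ℝ) + 2)⁻¹) atTop (𝓝 0) :=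
    (tendsto_natCast_atTop_atTop.atTop_add tendsto_const_nhds).inv_tendsto_atTop
  have ht1 : Tendsto (fun k : ℕ => 1 - ((k : ℝ) + 2)⁻¹) atTop (𝓝[≠] 1) := by
    refine tendsto_nhdsWithin_iff.2 ⟨by simpa using ht.const_sub 1, Eventually.of_forall fun k => ?_⟩
    have : (0 : ℝ) < ((k : ℝ) + 2)⁻¹ := by positivity
    simp only [mem_compl_iff, mem_singleton_iff]
    intro h; linarith
  refine ((hasDerivAt_iff_tendsto_slope.1 hd).comp ht1).congr fun k => ?_
  have h2 : (k : ℝ) + 2 ≠ 0 := by positivity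
  have h3 : (m : ℝ) + 1 ≠ 0 := by positivity
  simp only [Function.comp_apply, slope_def_field, one_pow]
  rw [show 1 - ((k : ℝ) + 2)⁻¹ - 1 = -((k : ℝ) + 2)⁻¹ by ring, div_neg, div_inv_eq_mul]
  field_simp
  ring

lemma norm_sub_normalize {z : Ext n} (hz : z ≠ 0) : ‖z - ‖z‖⁻¹ • z‖ = |1 - ‖z‖| := by
  have h0 : ‖z‖ ≠ 0 := norm_ne_zero_iff.2 hz
  have : z - ‖z‖⁻¹ • z = (1 - ‖z‖⁻¹) • z := by rw [sub_smul, one_smul]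
  rw [this, norm_smul, Real.norm_eq_abs, ← abs_of_nonneg (norm_nonneg z), ← abs_mul, abs_norm,
    abs_sub_comm]
  congr 1
  field_simp

/-- The divergence theorem in the unit ball for Lipschitz functions. -/
lemma integral_unitBall_lineDeriv {F : Ext n → ℝ} {C : ℝ≥0} (hF : LipschitzWith C F)
    (e : Ext n) : ∫ z in unitBall n, lineDeriv ℝ F z e =
      ∫ ζ : Metric.sphere (0 : Ext n) 1, F ζ * inner ℝ (ζ : Ext n) e
        ∂(volume : Measure (Ext n)).toSphere := by
  set m := Module.finrank ℝ (Ext n) - 1 with hm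
  set H : Ext n → ℝ := fun z => F z * inner ℝ z e with hH
  set S := ∫ ζ : Metric.sphere (0 : Ext n) 1, H ζ ∂(volume : Measure (Ext n)).toSphere with hS
  -- The offset `2` makes the thickness less than `1` from `k = 0` on.
  set h : ℕ → ℝ := fun k => ((k : ℝ) + 2)⁻¹ with hh
  have hpos : ∀ k, 0 < h k := fun k => by simp only [hh]; positivity
  have hlt : ∀ k, h k < 1 := fun k => inv_lt_one_of_one_lt₀ (by
    have : (0 : ℝ) ≤ k := Nat.cast_nonneg k
    linarith)
  have ht : Tendsto h atTop (𝓝 0) :=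
    (tendsto_natCast_atTop_atTop.atTop_add tendsto_const_nhds).inv_tendsto_atTop
  set c : ℕ → ℝ := fun k => (1 - (1 - h k) ^ (m + 1)) / ((m : ℝ) + 1) with hc
  have hhc : Tendsto (fun k => (h k)⁻¹ * c k) atTop (𝓝 1) := by
    simpa [hh, hc] using tendsto_shell_ratio m
  have hc0 : Tendsto c atTop (𝓝 0) := by
    have := ht.mul hhc
    rw [zero_mul] at this
    refine this.congr fun k => ?_
    rw [← mul_assoc, mul_inv_cancel₀ (hpos k).ne', one_mul]
  have hvol : ∀ k, volume.real (shell n (h k)) =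
      (volume : Measure (Ext n)).toSphere.real univ * c k := by
    intro k
    have := setIntegral_shell (hpos k) (hlt k) (fun _ : Ext n => (1 : ℝ))
    simpa [← hm] using this
  have hfinshell : ∀ k, volume (shell n (h k)) ≠ ⊤ := fun k =>
    ((measure_mono (fun z hz => mem_unitBall.2 hz.2)).trans_lt
      (show volume (unitBall n) < ⊤ from Metric.isBounded_ball.measure_lt_top)).ne
  have hnz : ∀ k, ∀ z ∈ shell n (h k), z ≠ 0 := fun k z hz h0 => by
    have := hz.1
    rw [h0, norm_zero] at this
    linarith [hlt k]
  obtain ⟨M, hM⟩ := (isCompact_closedBall (0 : Ext n) 1).exists_bound_of_continuousOn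
    hF.continuous.continuousOn
  have hMz : ∀ z : Ext n, ‖z‖ ≤ 1 → |F z| ≤ M := fun z hz => hM z (by simpa using hz)
  have hinner : ∀ z : Ext n, z ≠ 0 → |inner ℝ z e / ‖z‖| ≤ ‖e‖ := fun z hz => by
    rw [abs_div, abs_norm, div_le_iff₀ (norm_pos_iff.2 hz), mul_comm]
    exact abs_real_inner_le_norm z e
  have hnorm1 : ∀ z : Ext n, z ≠ 0 → ‖‖z‖⁻¹ • z‖ = 1 := fun z hz => by
    rw [norm_smul, norm_inv, norm_norm, inv_mul_cancel₀ (norm_ne_zero_iff.2 hz)]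
  have hFn : Measurable fun z : Ext n => F (‖z‖⁻¹ • z) :=
    hF.continuous.measurable.comp (measurable_norm.inv.smul measurable_id)
  have hI : Measurable fun z : Ext n => inner ℝ z e / ‖z‖ :=
    (measurable_id.inner_const).div measurable_norm
  -- Integration by parts against the radial cutoff produces an average over the shell. Replacing
  -- `F(z)` by `F(z / ‖z‖)` makes it exactly a multiple of the surface integral; the remainder is
  -- the second term.
  have hlayer : ∀ k, ∫ z, lineDeriv ℝ F z e * radialCutoff (h k) z =
      ((h k)⁻¹ * c k) * S + ∫ z in shell n (h k),
        (h k)⁻¹ * (inner ℝ z e / ‖z‖) * (F z - F (‖z‖⁻¹ • z)) := by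
    intro k
    obtain ⟨D, hD⟩ := lipschitzWith_radialCutoff (n := n) (hpos k)
    rw [hF.integral_lineDeriv_mul_eq hD (hasCompactSupport_radialCutoff (hpos k)) e]
    have e1 : ∫ z, lineDeriv ℝ (radialCutoff (h k)) z (-e) * F z =
        ∫ z in shell n (h k), (h k)⁻¹ * (inner ℝ z e / ‖z‖) * F z := by
      rw [← integral_indicator (measurableSet_shell _)]
      refine integral_congr_ae ?_
      filter_upwards [lineDeriv_radialCutoff_ae (hpos k) (hlt k) e] with z hz
      rw [hz]
      by_cases hs : z ∈ shell n (h k) <;> simp [hs]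
    have e2 : ((h k)⁻¹ * c k) * S = ∫ z in shell n (h k),
        (h k)⁻¹ * (inner ℝ z e / ‖z‖) * F (‖z‖⁻¹ • z) := by
      have := setIntegral_shell (hpos k) (hlt k) H
      rw [← hS, ← hm] at this
      rw [mul_assoc, mul_comm (c k), ← this, ← integral_const_mul]
      congr 1; ext z
      simp only [hH, inner_smul_left, conj_trivial]
      ring
    have hm1 : Measurable fun z : Ext n => (h k)⁻¹ * (inner ℝ z e / ‖z‖) := hI.const_mul _
    have i1 : IntegrableOn (fun z : Ext n => (h k)⁻¹ * (inner ℝ z e / ‖z‖) * F (‖z‖⁻¹ • z))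
        (shell n (h k)) := by
      refine Measure.integrableOn_of_bounded (M := (h k)⁻¹ * ‖e‖ * M) (hfinshell k)
        (hm1.mul hFn).aestronglyMeasurable ?_
      filter_upwards [ae_restrict_mem (measurableSet_shell _)] with z hz
      have hz0 := hnz k z hz
      rw [norm_mul, norm_mul, Real.norm_eq_abs, Real.norm_eq_abs, Real.norm_eq_abs,
        abs_of_pos (inv_pos.2 (hpos k))]
      have := inv_pos.2 (hpos k)
      gcongr
      · exact hinner z hz0
      · exact hMz _ (hnorm1 z hz0).le
    have i2 : IntegrableOn (fun z : Ext n => (h k)⁻¹ * (inner ℝ z e / ‖z‖) *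
        (F z - F (‖z‖⁻¹ • z))) (shell n (h k)) := by
      refine Measure.integrableOn_of_bounded (M := (h k)⁻¹ * ‖e‖ * (M + M)) (hfinshell k)
        (hm1.mul (hF.continuous.measurable.sub hFn)).aestronglyMeasurable ?_
      filter_upwards [ae_restrict_mem (measurableSet_shell _)] with z hz
      have hz0 := hnz k z hz
      rw [norm_mul, norm_mul, Real.norm_eq_abs, Real.norm_eq_abs,
        abs_of_pos (inv_pos.2 (hpos k))]
      have := inv_pos.2 (hpos k)
      gcongr
      · exact hinner z hz0
      · exact (norm_sub_le _ _).trans (add_le_add (hMz _ hz.2.le) (hMz _ (hnorm1 z hz0).le))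
    rw [e1, e2, ← integral_add i1 i2]
    congr 1; ext z; ring
  -- On the shell `z` lies within `h` of `z / ‖z‖`, so the Lipschitz bound `C h` cancels the factor
  -- `1 / h`, and the volume of the shell tends to zero.
  have herr : Tendsto (fun k => ∫ z in shell n (h k),
      (h k)⁻¹ * (inner ℝ z e / ‖z‖) * (F z - F (‖z‖⁻¹ • z))) atTop (𝓝 0) := by
    have hb : Tendsto (fun k => (‖e‖ * C) * volume.real (shell n (h k))) atTop (𝓝 0) := by
      simp only [hvol]
      simpa using (hc0.const_mul ((volume : Measure (Ext n)).toSphere.real univ)).const_mul (‖e‖ * C)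
    refine squeeze_zero_norm (fun k => ?_) hb
    refine norm_setIntegral_le_of_norm_le_const (hfinshell k).lt_top fun z hz => ?_
    have hz0 := hnz k z hz
    have h1 : |F z - F (‖z‖⁻¹ • z)| ≤ C * h k := by
      have := hF.dist_le_mul z (‖z‖⁻¹ • z)
      rw [dist_eq_norm, dist_eq_norm, norm_sub_normalize hz0] at this
      refine this.trans (mul_le_mul_of_nonneg_left ?_ C.2)
      rw [abs_of_nonneg (by linarith [hz.2])]
      linarith [hz.1]
    rw [norm_mul, norm_mul, Real.norm_eq_abs, Real.norm_eq_abs, Real.norm_eq_abs,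
      abs_of_pos (inv_pos.2 (hpos k))]
    have hp := hpos k
    calc (h k)⁻¹ * |inner ℝ z e / ‖z‖| * |F z - F (‖z‖⁻¹ • z)|
        ≤ (h k)⁻¹ * ‖e‖ * (C * h k) := by gcongr; exact hinner z hz0
      _ = ‖e‖ * C := by field_simp
  have hR : Tendsto (fun k => ∫ z, lineDeriv ℝ F z e * radialCutoff (h k) z) atTop (𝓝 S) := by
    simp only [hlayer]
    simpa using (hhc.mul_const S).add herr
  have hLim : Tendsto (fun k => ∫ z, lineDeriv ℝ F z e * radialCutoff (h k) z) atTop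
      (𝓝 (∫ z in unitBall n, lineDeriv ℝ F z e)) := by
    rw [← integral_indicator measurableSet_unitBall]
    refine tendsto_integral_of_dominated_convergence
      ((unitBall n).indicator fun _ => C * ‖e‖) (fun k => ?_) ?_ (fun k => ?_) ?_
    · obtain ⟨D, hD⟩ := lipschitzWith_radialCutoff (n := n) (hpos k)
      exact ((measurable_lineDeriv hF.continuous).mul
        hD.continuous.measurable).aestronglyMeasurable
    · rw [integrable_indicator_iff measurableSet_unitBall]
      exact integrableOn_const Metric.isBounded_ball.measure_lt_top.ne
    · refine Eventually.of_forall fun z => ?_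
      by_cases hz : z ∈ unitBall n
      · rw [indicator_of_mem hz, norm_mul, Real.norm_eq_abs (radialCutoff _ _),
          abs_of_nonneg (radialCutoff_nonneg _ _)]
        exact (mul_le_of_le_one_right (norm_nonneg _) (radialCutoff_le_one _ _)).trans
          (norm_lineDeriv_le_of_lipschitz ℝ hF)
      · rw [indicator_of_notMem hz, radialCutoff_of_one_le (hpos k)
          (not_lt.1 fun h' => hz (mem_unitBall.2 h')), mul_zero, norm_zero]
    · refine Eventually.of_forall fun z => ?_
      refine tendsto_const_nhds.congr' ?_
      by_cases hz : z ∈ unitBall n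
      · have hz1 := mem_unitBall.1 hz
        filter_upwards [ht.eventually (gt_mem_nhds (sub_pos.2 hz1))] with k hk
        rw [indicator_of_mem hz, radialCutoff_of_le (hpos k) (by linarith), mul_one]
      · refine Eventually.of_forall fun k => ?_
        simp only [indicator_of_notMem hz, radialCutoff_of_one_le (hpos k)
          (not_lt.1 fun h' => hz (mem_unitBall.2 h')), mul_zero]
  exact tendsto_nhds_unique hLim hR

end SphereGreen

/-! ### Lipschitz functions: weak gradients and traces on the sphere -/

section Lipschitz
variable {n : ℕ}

lemma inner_gradient (f : Ext n → ℝ) (z e : Ext n) :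
    inner ℝ (gradient f z) e = fderiv ℝ f z e := by
  rw [gradient, InnerProductSpace.toDual_symm_apply]

lemma norm_gradient_le {f : Ext n → ℝ} {C : ℝ≥0} (hf : LipschitzWith C f) (z : Ext n) :
    ‖gradient f z‖ ≤ C := by
  rw [gradient, LinearIsometryEquiv.norm_map]
  exact norm_fderiv_le_of_lipschitz ℝ hf

lemma measurable_gradient (f : Ext n → ℝ) : Measurable (gradient f) :=
  (InnerProductSpace.toDual ℝ (Ext n)).symm.continuous.measurable.comp (measurable_fderiv ℝ f)

lemma lineDeriv_ae_eq_inner_gradient {f : Ext n → ℝ} {C : ℝ≥0} (hf : LipschitzWith C f)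
    (e : Ext n) : ∀ᵐ z, lineDeriv ℝ f z e = inner ℝ (gradient f z) e := by
  filter_upwards [hf.ae_differentiableAt] with z hz
  rw [inner_gradient, hz.lineDeriv_eq_fderiv]

lemma IsTestOn.exists_lipschitzWith {Ω : Set (Ext n)} {ψ : Ext n → ℝ} (hψ : IsTestOn Ω ψ) :
    ∃ C, LipschitzWith C ψ :=
  (hψ.smooth.of_le (by simp : (1 : WithTop ℕ∞) ≤ ∞)).lipschitzWith_of_hasCompactSupport
    hψ.compact one_ne_zero

/-- Lipschitz functions can be integrated by parts against test functions, and Rademacher's theorem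
identifies the line derivatives with the components of the gradient. -/
lemma isWeakGradOn_gradient {f : Ext n → ℝ} {C : ℝ≥0} (hf : LipschitzWith C f) :
    IsWeakGradOn univ f (gradient f) where
  locInt := hf.continuous.locallyIntegrable.locallyIntegrableOn _
  grad_locInt := by
    refine LocallyIntegrable.locallyIntegrableOn ?_ _
    refine (locallyIntegrable_const (C : ℝ)).mono (measurable_gradient f).aestronglyMeasurable
      (Eventually.of_forall fun z => ?_)
    simpa using norm_gradient_le hf z
  by_parts ψ hψ e := by
    obtain ⟨D, hD⟩ := hψ.exists_lipschitzWith
    have h1 := hf.integral_lineDeriv_mul_eq (μ := volume) hD hψ.compact e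
    rw [setIntegral_univ, setIntegral_univ]
    have h2 : ∫ z, lineDeriv ℝ f z e * ψ z = ∫ z, inner ℝ (gradient f z) e * ψ z := by
      refine integral_congr_ae ?_
      filter_upwards [lineDeriv_ae_eq_inner_gradient hf e] with z hz
      rw [hz]
    have h3 : ∫ z, lineDeriv ℝ ψ z (-e) * f z = -∫ z, f z * fderiv ℝ ψ z e := by
      rw [← integral_neg]
      congr 1; ext z
      rw [(hψ.smooth.differentiable (by simp) z).lineDeriv_eq_fderiv, map_neg]; ring
    rw [← h2, h1, h3, neg_neg]

lemma gradient_eq_zero_of_norm {f : Ext n → ℝ} {R : ℝ} (hf : ∀ z, R < ‖z‖ → f z = 0) (z : Ext n)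
    (hz : R < ‖z‖) : gradient f z = 0 := by
  have : f =ᶠ[𝓝 z] fun _ => 0 := by
    filter_upwards [(isOpen_lt continuous_const continuous_norm).mem_nhds hz] with y hy
    exact hf y hy
  rw [gradient, this.fderiv_eq]
  simp

lemma exists_lipschitzWith_mul {f g : Ext n → ℝ} {C D : ℝ≥0} {A B : ℝ} (hf : LipschitzWith C f)
    (hg : LipschitzWith D g) (hA : ∀ z, |f z| ≤ A) (hB : ∀ z, |g z| ≤ B) :
    ∃ K, LipschitzWith K fun z => f z * g z := by
  refine ⟨_, LipschitzWith.of_dist_le' (K := A * D + B * C) fun a b => ?_⟩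
  have h1 := hf.dist_le_mul a b
  have h2 := hg.dist_le_mul a b
  rw [Real.dist_eq] at h1 h2 ⊢
  have hA0 : 0 ≤ A := (abs_nonneg _).trans (hA a)
  calc |f a * g a - f b * g b| = |f a * (g a - g b) + g b * (f a - f b)| := by ring_nf
    _ ≤ |f a| * |g a - g b| + |g b| * |f a - f b| := by
      rw [← abs_mul, ← abs_mul]; exact abs_add_le _ _
    _ ≤ A * (D * dist a b) + B * (C * dist a b) := by
      have hB0 : 0 ≤ B := (abs_nonneg _).trans (hB a)
      gcongr
      · exact hA a
      · exact hB b
    _ = (A * D + B * C) * dist a b := by ring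

/-- The divergence theorem applied to the product `f ψ`, which is Lipschitz because both factors are
bounded and Lipschitz. -/
lemma hasSphereTrace_of_lipschitz {v φ f : Ext n → ℝ} {C : ℝ≥0} {A : ℝ} (hf : LipschitzWith C f)
    (hA : ∀ z, |f z| ≤ A) (hv : ∀ z ∈ unitBall n, v z = f z)
    (hφ : ∀ z, ‖z‖ = 1 → φ z = f z) : HasSphereTrace v φ := by
  intro ψ hψ e
  obtain ⟨D, hD⟩ := hψ.exists_lipschitzWith
  obtain ⟨B, hB⟩ := hψ.exists_bound
  obtain ⟨K, hK⟩ := exists_lipschitzWith_mul hf hD hA hB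
  have hw : IsWeakGradOn (unitBall n) v (gradient f) :=
    ((isWeakGradOn_gradient hf).mono (subset_univ _)).congr measurableSet_unitBall
      (fun z hz => (hv z hz).symm) fun _ _ => rfl
  rw [setIntegral_green_congr (hw.weakGrad_ae_eq isOpen_unitBall) le_rfl]
  have h1 := integral_unitBall_lineDeriv hK e
  have h2 : ∫ z in unitBall n, lineDeriv ℝ (fun z => f z * ψ z) z e =
      ∫ z in unitBall n, (v z * fderiv ℝ ψ z e + inner ℝ (gradient f z) e * ψ z) := by
    refine integral_congr_ae ?_
    filter_upwards [ae_restrict_of_ae hf.ae_differentiableAt,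
      ae_restrict_mem measurableSet_unitBall] with z hz hzB
    have hψd := hψ.smooth.differentiable (by simp) z
    rw [(hz.fun_mul hψd).lineDeriv_eq_fderiv, fderiv_fun_mul hz hψd, inner_gradient, hv z hzB]
    simp only [add_apply, smul_apply, smul_eq_mul]
    ring
  rw [← h2, h1]
  congr 1; ext ζ
  rw [hφ ζ (by simp)]

end Lipschitz

/-! ### A Lipschitz extension of the boundary datum -/

section Datum
variable {n : ℕ}

lemma norm_pt_abs (z : Ext n) : ‖(pt z.fst |z.snd| : Ext n)‖ = ‖z‖ := by
  have := norm_pt_sq z.fst |z.snd|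
  rw [sq_abs, ← norm_sq_eq] at this
  exact (sq_eq_sq₀ (norm_nonneg _) (norm_nonneg _)).1 this

lemma lipschitzWith_evenExt {g : Ext n → ℝ} {C : ℝ≥0} (hg : LipschitzWith C g) :
    LipschitzWith C (evenExt g) := by
  refine LipschitzWith.of_dist_le_mul fun a b => ?_
  refine (hg.dist_le_mul _ _).trans (mul_le_mul_of_nonneg_left ?_ C.2)
  rw [dist_eq_norm, dist_eq_norm]
  refine le_of_sq_le_sq ?_ (norm_nonneg _)
  rw [norm_sq_eq, norm_sq_eq]
  change ‖a.fst - b.fst‖ ^ 2 + (|a.snd| - |b.snd|) ^ 2 ≤ ‖a.fst - b.fst‖ ^ 2 + (a.snd - b.snd) ^ 2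
  have := sq_le_sq.2 (abs_abs_sub_abs_le_abs_sub a.snd b.snd)
  linarith

/-- A Lipschitz extension with compact support of an even datum on the unit sphere. -/
structure IsDatum (φ f : Ext n → ℝ) : Prop where
  lipschitz : ∃ C, LipschitzWith C f
  bounded : ∃ A, ∀ z, |f z| ≤ A
  eq_zero : ∀ z, 2 < ‖z‖ → f z = 0
  eq_evenExt : ∀ z, ‖z‖ ≤ 1 → evenExt φ z = f z
  even : ∀ z, f (reflect n z) = f z

/-- Multiply `φ` by a bump equal to `1` on the unit ball, then reflect evenly. The reflection may
create a kink on `{y = 0}`, so only Lipschitz regularity survives. -/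
lemma exists_isDatum {φ : Ext n → ℝ} (hφ : ContDiff ℝ ∞ φ) : ∃ f, IsDatum φ f := by
  let χ : ContDiffBump (0 : Ext n) := ⟨1, 2, one_pos, one_lt_two⟩
  have hχ1 : ∀ z : Ext n, ‖z‖ ≤ 1 → χ z = 1 := fun z hz =>
    χ.one_of_mem_closedBall (by simpa [χ] using hz)
  have hχ0 : ∀ z : Ext n, 2 ≤ ‖z‖ → χ z = 0 := fun z hz =>
    χ.zero_of_le_dist (by simpa [χ] using hz)
  have ht : IsTestOn univ fun z => χ z * φ z :=
    ⟨χ.contDiff.mul hφ, χ.hasCompactSupport.mul_right, subset_univ _⟩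
  obtain ⟨C, hC⟩ := ht.exists_lipschitzWith
  obtain ⟨A, hA⟩ := ht.exists_bound
  refine ⟨evenExt fun z => χ z * φ z, ⟨C, lipschitzWith_evenExt hC⟩, ⟨A, fun z => hA _⟩,
    fun z hz => ?_, fun z hz => ?_, fun z => ?_⟩
  · simp only [evenExt]
    rw [hχ0 _ (by rw [norm_pt_abs]; exact hz.le), zero_mul]
  · simp only [evenExt]
    rw [hχ1 _ (by rwa [norm_pt_abs]), one_mul]
  · simp [evenExt]

end Datum

/-! ### Competitors as perturbations vanishing outside the ball -/

section Admissible
variable {n : ℕ}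

lemma MemH1.of_isWeakGradOn {b : ℝ} {u : Ext n → ℝ} {G : Ext n → Ext n}
    (h : IsWeakGradOn (unitBall n) u G)
    (hu : MemLp u 2 (volume.restrict (unitBall n)))
    (hG : MemLp (fun z => (|z.snd| ^ (b / 2)) • G z) 2 (volume.restrict (unitBall n))) :
    MemH1 b (unitBall n) u where
  memLp := hu.mono_measure (Measure.restrict_mono_set _ inter_subset_left)
  exists_grad := ⟨G, h⟩
  grad_memLp := by
    refine hG.ae_eq ?_
    filter_upwards [h.weakGrad_ae_eq isOpen_unitBall] with z hz
    rw [hz]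

lemma isFiniteMeasure_restrict_unitBall : IsFiniteMeasure (volume.restrict (unitBall n)) :=
  ⟨by rw [Measure.restrict_apply_univ]; exact Metric.isBounded_ball.measure_lt_top⟩

lemma IsDatum.continuous {φ f : Ext n → ℝ} (hf : IsDatum φ f) : Continuous f := by
  obtain ⟨C, hC⟩ := hf.lipschitz; exact hC.continuous

lemma IsDatum.integrable {φ f : Ext n → ℝ} (hf : IsDatum φ f) : Integrable f :=
  hf.continuous.integrable_of_hasCompactSupport
    (HasCompactSupport.intro (isCompact_closedBall (0 : Ext n) 2) fun z hz => hf.eq_zero z (by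
      rwa [Metric.mem_closedBall, dist_zero_right, not_le] at hz))

lemma IsDatum.isWeakGradOn {φ f : Ext n → ℝ} (hf : IsDatum φ f) :
    IsWeakGradOn univ f (gradient f) := by
  obtain ⟨C, hC⟩ := hf.lipschitz; exact isWeakGradOn_gradient hC

lemma IsDatum.gradient_eq_zero {φ f : Ext n → ℝ} (hf : IsDatum φ f) (z : Ext n) (hz : 2 < ‖z‖) :
    gradient f z = 0 := gradient_eq_zero_of_norm hf.eq_zero z hz

lemma IsDatum.integrable_gradient {φ f : Ext n → ℝ} (hf : IsDatum φ f) :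
    Integrable (gradient f) := by
  obtain ⟨C, hC⟩ := hf.lipschitz
  have h1 : IntegrableOn (gradient f) (Metric.closedBall 0 2) :=
    Measure.integrableOn_of_bounded (M := C) measure_closedBall_lt_top.ne
      (measurable_gradient f).aestronglyMeasurable
      (Eventually.of_forall fun z => norm_gradient_le hC z)
  refine (integrableOn_iff_integrable_of_support_subset fun z hz => ?_).1 h1
  by_contra h'
  exact hz (hf.gradient_eq_zero z (by rwa [Metric.mem_closedBall, dist_zero_right, not_le] at h'))

lemma IsDatum.memLp {φ f : Ext n → ℝ} (hf : IsDatum φ f) :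
    MemLp f 2 (volume.restrict (unitBall n)) := by
  obtain ⟨A, hA⟩ := hf.bounded
  have := isFiniteMeasure_restrict_unitBall (n := n)
  exact MemLp.of_bound hf.continuous.aestronglyMeasurable A (Eventually.of_forall hA)

lemma IsDatum.memLp_gradient {φ f : Ext n → ℝ} (hf : IsDatum φ f) {b : ℝ} (hb : -1 < b) :
    MemLp (fun z => (|z.snd| ^ (b / 2)) • gradient f z) 2 (volume.restrict (unitBall n)) := by
  obtain ⟨C, hC⟩ := hf.lipschitz
  refine (memLp_weight hb).of_le_mul (c := C)
    ((measurable_abs_snd_rpow _).smul (measurable_gradient f)).aestronglyMeasurable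
    (Eventually.of_forall fun z => ?_)
  rw [norm_smul, mul_comm]
  exact mul_le_mul_of_nonneg_right (norm_gradient_le hC z) (norm_nonneg _)

lemma IsDatum.hasSphereTrace {φ f : Ext n → ℝ} (hf : IsDatum φ f) :
    HasSphereTrace f (evenExt φ) := by
  obtain ⟨C, hC⟩ := hf.lipschitz
  obtain ⟨A, hA⟩ := hf.bounded
  exact hasSphereTrace_of_lipschitz hC hA (fun _ _ => rfl) fun z hz => hf.eq_evenExt z hz.le

lemma integrableOn_mul_test {u : Ext n → ℝ} {s : Set (Ext n)} (hu : IntegrableOn u s)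
    {ψ : Ext n → ℝ} (hc : Continuous ψ) (hs : HasCompactSupport ψ) :
    IntegrableOn (fun z => u z * ψ z) s := by
  obtain ⟨C, hC⟩ := hc.bounded_above_of_compact_support hs
  exact Integrable.mul_bdd hu hc.aestronglyMeasurable (Eventually.of_forall hC)

lemma IsTestOn.integrableOn_green {u : Ext n → ℝ} {G : Ext n → Ext n} {s : Set (Ext n)}
    {ψ : Ext n → ℝ} (hψ : IsTestOn univ ψ) (hu : IntegrableOn u s) (hG : IntegrableOn G s)
    (e : Ext n) :
    IntegrableOn (fun z => u z * fderiv ℝ ψ z e + inner ℝ (G z) e * ψ z) s :=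
  (integrableOn_mul_test hu (hψ.continuous_fderiv e) (hψ.hasCompactSupport_fderiv e)).add
    (integrableOn_mul_test (hG.inner_const e) hψ.smooth.continuous hψ.compact)

/-- Admissible functions differ from the datum by functions with a weak gradient on the whole
space that vanish outside the ball. -/
lemma IsDatum.admissible {φ f v w : Ext n → ℝ} {G : Ext n → Ext n} (hf : IsDatum φ f) {b : ℝ}
    (hb : -1 < b) (hw : IsWeakGradOn univ w G) (hwi : Integrable w) (hGi : Integrable G)
    (hw0 : ∀ z, z ∉ unitBall n → w z = 0) (hG0 : ∀ z, z ∉ unitBall n → G z = 0)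
    (hw2 : MemLp w 2 (volume.restrict (unitBall n)))
    (hG2 : MemLp (fun z => (|z.snd| ^ (b / 2)) • G z) 2 (volume.restrict (unitBall n)))
    (hv : ∀ z, v z = f z + w z) : Admissible b φ v := by
  obtain rfl : v = fun z => f z + w z := funext hv
  have hgrad := (hf.isWeakGradOn.add hw).mono (subset_univ (unitBall n))
  refine ⟨MemH1.of_isWeakGradOn hgrad (hf.memLp.add hw2) ?_, fun ψ hψ e => ?_⟩
  · simp only [smul_add]
    exact (hf.memLp_gradient hb).add hG2
  · rw [← hf.hasSphereTrace ψ hψ e, setIntegral_green_congr (hgrad.weakGrad_ae_eq isOpen_unitBall)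
      le_rfl, setIntegral_green_congr ((hf.isWeakGradOn.mono
        (subset_univ (unitBall n))).weakGrad_ae_eq isOpen_unitBall) le_rfl]
    have i1 := hψ.integrableOn_green hf.integrable.integrableOn
      hf.integrable_gradient.integrableOn e (s := unitBall n)
    have i2 := hψ.integrableOn_green hwi.integrableOn hGi.integrableOn e (s := unitBall n)
    -- Since `w` and `G` vanish outside the ball, integration by parts on the whole space shows that
    -- `w` adds no boundary term.
    have h0 : ∫ z in unitBall n, (w z * fderiv ℝ ψ z e + inner ℝ (G z) e * ψ z) = 0 := by
      rw [setIntegral_eq_integral_of_forall_compl_eq_zero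
        fun z hz => by simp [hw0 z hz, hG0 z hz],
        integral_add (hw.integrable_left hψ e) (hw.integrable_right hψ e)]
      have := hw.by_parts ψ hψ e
      rw [setIntegral_univ, setIntegral_univ] at this
      rw [this]; ring
    rw [← add_zero (∫ z in unitBall n, (f z * fderiv ℝ ψ z e + inner ℝ (gradient f z) e * ψ z)),
      ← h0, ← integral_add i1 i2]
    congr 1; ext z
    simp only [inner_add_left]
    ring

lemma Admissible.integrableOn {φ v : Ext n → ℝ} {b : ℝ} (hb : b < 1) (h : Admissible b φ v) :
    IntegrableOn v (unitBall n) := h.1.integrableOn hb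

/-- The gradient of an admissible function minus that of the datum, extended by zero. -/
noncomputable def gradDiff (f v : Ext n → ℝ) : Ext n → Ext n :=
  (unitBall n).indicator fun z => weakGrad (unitBall n) v z - gradient f z

lemma IsDatum.integrable_gradDiff {φ f v : Ext n → ℝ} (hf : IsDatum φ f) {b : ℝ} (hb : b < 1)
    (h : Admissible b φ v) : Integrable (gradDiff f v) := by
  rw [gradDiff, integrable_indicator_iff measurableSet_unitBall]
  exact (h.1.integrableOn_grad hb).sub hf.integrable_gradient.integrableOn

lemma IsDatum.integrable_diff {φ f v : Ext n → ℝ} (hf : IsDatum φ f) {b : ℝ} (hb : b < 1)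
    (h : Admissible b φ v) : Integrable ((unitBall n).indicator fun z => v z - f z) := by
  rw [integrable_indicator_iff measurableSet_unitBall]
  exact (h.integrableOn hb).sub hf.integrable.integrableOn

/-- `v` and `f` have the same right-hand side in Green's formula on the sphere. Subtraction leaves
an integration by parts without boundary term for test functions that need not vanish on the sphere.
-/
lemma IsDatum.isWeakGradOn_gradDiff {φ f v : Ext n → ℝ} (hf : IsDatum φ f) {b : ℝ} (hb : b < 1)
    (h : Admissible b φ v) :
    IsWeakGradOn univ ((unitBall n).indicator fun z => v z - f z) (gradDiff f v) where
  locInt := (hf.integrable_diff hb h).locallyIntegrable.locallyIntegrableOn _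
  grad_locInt := (hf.integrable_gradDiff hb h).locallyIntegrable.locallyIntegrableOn _
  by_parts ψ hψ e := by
    have e1 := h.2 ψ hψ e
    rw [← hf.hasSphereTrace ψ hψ e, setIntegral_green_congr ((hf.isWeakGradOn.mono
        (subset_univ (unitBall n))).weakGrad_ae_eq isOpen_unitBall) le_rfl] at e1
    have i1 := hψ.integrableOn_green hf.integrable.integrableOn
      hf.integrable_gradient.integrableOn e (s := unitBall n)
    have i2 := hψ.integrableOn_green (h.integrableOn hb) (h.1.integrableOn_grad hb) e
    have j1 := integrableOn_mul_test (s := univ) (hf.integrable_diff hb h).integrableOn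
      (hψ.continuous_fderiv e) (hψ.hasCompactSupport_fderiv e)
    have j2 := integrableOn_mul_test (s := univ)
      ((hf.integrable_gradDiff hb h).inner_const e).integrableOn hψ.smooth.continuous hψ.compact
    rw [← sub_eq_zero, ← integral_sub i2 i1] at e1
    rw [← sub_eq_zero, sub_neg_eq_add, ← integral_add j1 j2, setIntegral_univ, ← e1,
      ← integral_indicator measurableSet_unitBall]
    congr 1; ext z
    by_cases hz : z ∈ unitBall n
    · simp only [gradDiff, indicator_of_mem hz, inner_sub_left]; ring
    · simp [gradDiff, indicator_of_notMem hz]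

lemma IsDatum.isFlatTrace {φ f v w : Ext n → ℝ} {G : Ext n → Ext n} (hf : IsDatum φ f)
    (hw : IsWeakGradOn univ w G) (hwi : Integrable w) (hGi : Integrable G)
    (hw0 : ∀ z, z ∉ unitBall n → w z = 0) (hG0 : ∀ z, z ∉ unitBall n → G z = 0)
    (hv : ∀ z ∈ unitBall n, v z = f z + w z) :
    IsFlatTrace (unitBall n) v (coneTrace fun z => gradient f z + G z) := by
  have hout : ∀ z : Ext n, 2 < ‖z‖ → z ∉ unitBall n := fun z hz h' => by
    have := mem_unitBall.1 h'; linarith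
  exact isFlatTrace_coneTrace (hf.isWeakGradOn.add hw) (hf.integrable.add hwi)
    (hf.integrable_gradient.add hGi) (R := 2)
    (fun z hz => by rw [hf.eq_zero z hz, hw0 z (hout z hz), add_zero])
    (fun z hz => by rw [hf.gradient_eq_zero z hz, hG0 z (hout z hz), add_zero]) hv

lemma IsDatum.flatTrace_ae_eq {φ f v w : Ext n → ℝ} {G : Ext n → Ext n} (hf : IsDatum φ f)
    (hw : IsWeakGradOn univ w G) (hwi : Integrable w) (hGi : Integrable G)
    (hw0 : ∀ z, z ∉ unitBall n → w z = 0) (hG0 : ∀ z, z ∉ unitBall n → G z = 0)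
    (hv : ∀ z ∈ unitBall n, v z = f z + w z) :
    ∀ᵐ x : EuclideanSpace ℝ (Fin n), x ∈ slice (unitBall n) →
      flatTrace (unitBall n) v x = coneTrace (gradient f) x + coneTrace G x := by
  filter_upwards [(hf.isFlatTrace hw hwi hGi hw0 hG0 hv).flatTrace_ae_eq,
    coneTrace_add_ae hf.integrable_gradient hGi] with x h1 h2 hx
  rw [h1 hx, h2]

end Admissible

/-! ### Evenness: reflection, trace and energy -/

section Symmetrization
variable {n : ℕ}

lemma fderiv_comp_reflect_vertical (ψ : Ext n → ℝ) (z : Ext n) :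
    fderiv ℝ (ψ ∘ reflect n) z (pt 0 1) = -fderiv ℝ ψ (reflect n z) (pt 0 1) := by
  rw [fderiv_comp_reflect, reflect_pt, ← map_neg]
  congr 1
  change _ = pt (-0) (-1)
  rw [neg_zero]

/-- The even part of a function has the same trace on the hyperplane. -/
lemma IsFlatTrace.even_part {v : Ext n → ℝ} {g : EuclideanSpace ℝ (Fin n) → ℝ}
    {G : Ext n → Ext n} (hG : IsWeakGradOn (unitBall n) v G)
    (h : IsFlatTrace (unitBall n) v g) :
    IsFlatTrace (unitBall n) (fun z => 1 / 2 * (v z + v (reflect n z))) g where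
  locInt := h.locInt
  green ψ hψ := by
    have hR := hG.comp_reflect preimage_reflect_unitBall
    have havg := (hG.add hR).const_smul (1 / 2)
    have hψR := hψ.comp_reflect preimage_reflect_unitBall
    rw [setIntegral_green_congr (havg.weakGrad_ae_eq isOpen_unitBall) inter_subset_left]
    have e1 := h.green ψ hψ
    have e2 := h.green _ hψR
    rw [setIntegral_green_congr (hG.weakGrad_ae_eq isOpen_unitBall) inter_subset_left] at e1 e2
    set q : Ext n → ℝ := fun z => v z * fderiv ℝ (ψ ∘ reflect n) z (pt 0 1) +
      inner ℝ (G z) (pt 0 1) * (ψ ∘ reflect n) z with hq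
    have hqi : Integrable q := (hG.integrable_left hψR _).add (hG.integrable_right hψR _)
    have i1 : Integrable fun z => v z * fderiv ℝ ψ z (pt 0 1) + inner ℝ (G z) (pt 0 1) * ψ z :=
      (hG.integrable_left hψ _).add (hG.integrable_right hψ _)
    have i2 : Integrable fun z => -q (reflect n z) :=
      ((measurePreserving_reflect.integrable_comp_emb measurableEmbedding_reflect).2 hqi).neg
    have hpt : ∀ z, 1 / 2 * (v z + v (reflect n z)) * fderiv ℝ ψ z (pt 0 1) +
        inner ℝ ((1 / 2 : ℝ) • (G z + reflect n (G (reflect n z)))) (pt 0 1) * ψ z =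
        1 / 2 * ((v z * fderiv ℝ ψ z (pt 0 1) + inner ℝ (G z) (pt 0 1) * ψ z) +
          -q (reflect n z)) := by
      intro z
      have hin : inner ℝ (reflect n (G (reflect n z))) (pt 0 1) =
          -inner ℝ (G (reflect n z)) (pt 0 1) := by
        rw [inner_vertical, inner_vertical, reflect_snd]
      simp only [hq, fderiv_comp_reflect_vertical, reflect_reflect, Function.comp_apply,
        real_inner_smul_left, inner_add_left, hin]
      ring
    simp_rw [hpt]
    rw [integral_const_mul, integral_add i1.integrableOn i2.integrableOn, e1]
    -- Over the whole ball the Green integrand of the reflected test function integrates to zero, so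
    -- its lower half contributes minus its upper half; reflecting reverses the sign of the vertical
    -- direction once more.
    have hsum : ∫ z in unitBall n, q z = 0 := by
      have := hG.by_parts _ hψR (pt 0 1)
      rw [hq, integral_add (hG.integrable_left hψR _).integrableOn
        (hG.integrable_right hψR _).integrableOn, this]
      ring
    have hlow : ∫ z in unitBall n ∩ upperHalf n, -q (reflect n z) =
        ∫ z in unitBall n ∩ upperHalf n, q z := by
      have hm := measurableSet_unitBall.inter (measurableSet_upperHalf (n := n))
      have hset : unitBall n ∩ upperHalf n =
          reflect n ⁻¹' (reflect n ⁻¹' (unitBall n ∩ upperHalf n)) := by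
        ext z; simp
      have hdisj : Disjoint (unitBall n ∩ upperHalf n)
          (reflect n ⁻¹' (unitBall n ∩ upperHalf n)) := by
        rw [Set.disjoint_left]
        rintro z ⟨-, h1⟩ ⟨-, h2⟩
        simp only [upperHalf, mem_ofPred_eq, reflect_snd] at h1 h2
        linarith
      have hae : ((unitBall n ∩ upperHalf n) ∪ (reflect n ⁻¹' (unitBall n ∩ upperHalf n)) :
          Set (Ext n)) =ᵐ[volume] unitBall n := by
        rw [eventuallyEq_set]
        filter_upwards [ae_snd_ne_zero] with z hz
        simp only [mem_union, mem_inter_iff, mem_preimage, reflect_mem_unitBall, upperHalf,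
          mem_ofPred_eq, reflect_snd]
        constructor
        · rintro (h | h) <;> exact h.1
        · intro h
          rcases lt_or_gt_of_ne hz with h1 | h1
          · exact Or.inr ⟨h, by linarith⟩
          · exact Or.inl ⟨h, h1⟩
      have hu := setIntegral_union hdisj ((reflect n).continuous.measurable hm)
        hqi.integrableOn hqi.integrableOn
      rw [setIntegral_congr_set hae, hsum] at hu
      rw [integral_neg]
      have h3 : ∫ z in unitBall n ∩ upperHalf n, q (reflect n z) =
          ∫ z in reflect n ⁻¹' (unitBall n ∩ upperHalf n), q z := by
        conv_lhs => rw [hset]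
        exact setIntegral_comp_reflect _ _
      rw [h3]; linarith
    rw [hlow, e2]
    simp only [Function.comp_apply, reflect_pt, neg_zero]
    ring

lemma posVolume_congr {u v : Ext n → ℝ} (h : ∀ᵐ x : EuclideanSpace ℝ (Fin n),
    x ∈ slice (unitBall n) → flatTrace (unitBall n) u x = flatTrace (unitBall n) v x) :
    posVolume (unitBall n) u = posVolume (unitBall n) v := by
  unfold posVolume
  congr 1
  refine measure_congr ?_
  rw [eventuallyEq_set]
  filter_upwards [h] with x hx
  simp only [mem_inter_iff, mem_ofPred_eq]
  constructor
  · rintro ⟨h1, h2⟩; exact ⟨h1, by rwa [← hx h1]⟩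
  · rintro ⟨h1, h2⟩; exact ⟨h1, by rwa [hx h1]⟩

lemma energy_integrand_eq (b : ℝ) (G : Ext n → Ext n) (z : Ext n) :
    |z.snd| ^ b * ‖G z‖ ^ 2 = ‖(|z.snd| ^ (b / 2)) • G z‖ ^ 2 := by
  rw [norm_smul, mul_pow, Real.norm_eq_abs, abs_of_nonneg (Real.rpow_nonneg (abs_nonneg _) _),
    abs_rpow_half_sq]

lemma energy_eq {b : ℝ} {v : Ext n → ℝ} {G : Ext n → Ext n} (h : IsWeakGradOn (unitBall n) v G) :
    energy b (unitBall n) v = ∫ z in unitBall n, ‖(|z.snd| ^ (b / 2)) • G z‖ ^ 2 := by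
  unfold energy
  refine integral_congr_ae ?_
  filter_upwards [h.weakGrad_ae_eq isOpen_unitBall] with z hz
  rw [hz, energy_integrand_eq]

/-- Convexity of the square of the norm; the weight is even in `y` and the reflection is an
isometry, so the reflected function has the same energy. -/
lemma energy_even_part_le {b : ℝ} {v : Ext n → ℝ} {G : Ext n → Ext n}
    (h : IsWeakGradOn (unitBall n) v G)
    (hG2 : MemLp (fun z => (|z.snd| ^ (b / 2)) • G z) 2 (volume.restrict (unitBall n))) :
    energy b (unitBall n) (fun z => 1 / 2 * (v z + v (reflect n z))) ≤ energy b (unitBall n) v := by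
  have hR := h.comp_reflect preimage_reflect_unitBall
  have havg := (h.add hR).const_smul (1 / 2)
  set P : Ext n → ℝ := fun z => ‖(|z.snd| ^ (b / 2)) • G z‖ ^ 2 with hP
  have hPi : IntegrableOn P (unitBall n) := (memLp_two_iff_integrable_sq_norm hG2.1).1 hG2
  have hPR : IntegrableOn (fun z => P (reflect n z)) (unitBall n) := by
    have := (measurePreserving_reflect.integrableOn_comp_preimage
      measurableEmbedding_reflect).2 hPi
    rwa [preimage_reflect_unitBall] at this
  have hPRint : ∫ z in unitBall n, P (reflect n z) = ∫ z in unitBall n, P z := by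
    conv_lhs => rw [← preimage_reflect_unitBall]
    exact setIntegral_comp_reflect _ _
  rw [energy_eq havg, energy_eq h]
  calc ∫ z in unitBall n, ‖(|z.snd| ^ (b / 2)) •
        ((1 / 2 : ℝ) • (G z + reflect n (G (reflect n z))))‖ ^ 2
      ≤ ∫ z in unitBall n, (1 / 2 * P z + 1 / 2 * P (reflect n z)) := by
        refine integral_mono_of_nonneg (Eventually.of_forall fun z => by positivity)
          ((hPi.const_mul _).add (hPR.const_mul _)) (Eventually.of_forall fun z => ?_)
        have hPz : P (reflect n z) = ‖(|z.snd| ^ (b / 2)) • reflect n (G (reflect n z))‖ ^ 2 := by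
          simp only [hP, norm_smul, reflect_snd, abs_neg, LinearIsometryEquiv.norm_map]
        simp only [hPz]
        simp only [hP]
        rw [smul_comm, norm_smul, smul_add]
        set A := (|z.snd| ^ (b / 2)) • G z
        set D := (|z.snd| ^ (b / 2)) • reflect n (G (reflect n z))
        have h1 := norm_add_le A D
        have h2 : ‖A + D‖ ^ 2 ≤ (‖A‖ + ‖D‖) ^ 2 := pow_le_pow_left₀ (norm_nonneg _) h1 2
        have h3 : ‖(1 / 2 : ℝ)‖ = 1 / 2 := by norm_num
        rw [h3]
        nlinarith [sq_nonneg (‖A‖ - ‖D‖)]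
    _ = ∫ z in unitBall n, P z := by
        rw [integral_add (hPi.const_mul _) (hPR.const_mul _), integral_const_mul,
          integral_const_mul, hPRint]
        ring

end Symmetrization

/-! ### Weak compactness and lower semicontinuity -/

section WeakCompactness

/-- Bounded sequences in a separable Hilbert space have weakly convergent subsequences. -/
lemma exists_subseq_tendsto_inner {H : Type*} [NormedAddCommGroup H] [InnerProductSpace ℝ H]
    [CompleteSpace H] [TopologicalSpace.SeparableSpace H] {x : ℕ → H} {M : ℝ}
    (hx : ∀ k, ‖x k‖ ≤ M) :
    ∃ (x₀ : H) (σ : ℕ → ℕ), StrictMono σ ∧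
      ∀ h : H, Tendsto (fun k => inner ℝ (x (σ k)) h) atTop (𝓝 (inner ℝ x₀ h)) := by
  have hc := WeakDual.isSeqCompact_closedBall ℝ H 0 M
  have hmem : ∀ k, StrongDual.toWeakDual (InnerProductSpace.toDual ℝ H (x k)) ∈
      WeakDual.toStrongDual ⁻¹' Metric.closedBall (0 : StrongDual ℝ H) M := fun k => by
    rw [mem_preimage, Metric.mem_closedBall, dist_zero_right]
    change ‖InnerProductSpace.toDual ℝ H (x k)‖ ≤ M
    rw [LinearIsometryEquiv.norm_map]
    exact hx k
  obtain ⟨a, -, σ, hσ, hlim⟩ := hc hmem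
  refine ⟨(InnerProductSpace.toDual ℝ H).symm (WeakDual.toStrongDual a), σ, hσ, fun h => ?_⟩
  rw [InnerProductSpace.toDual_symm_apply]
  have := ((WeakDual.eval_continuous h).tendsto a).comp hlim
  refine this.congr fun k => ?_
  change InnerProductSpace.toDual ℝ H (x (σ k)) h = _
  rw [InnerProductSpace.toDual_apply_apply]

/-- Pass to the limit in `2⟨x_k, x₀⟩ - ‖x₀‖² ≤ ‖x_k‖²`. -/
lemma norm_sq_le_of_tendsto_inner {H : Type*} [NormedAddCommGroup H] [InnerProductSpace ℝ H]
    {x : ℕ → H} {x₀ : H} {c : ℝ}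
    (hw : Tendsto (fun k => inner ℝ (x k) x₀) atTop (𝓝 (inner ℝ x₀ x₀)))
    (hc : Tendsto (fun k => ‖x k‖ ^ 2) atTop (𝓝 c)) : ‖x₀‖ ^ 2 ≤ c := by
  have h1 : Tendsto (fun k => 2 * inner ℝ (x k) x₀ - ‖x₀‖ ^ 2) atTop
      (𝓝 (2 * inner ℝ x₀ x₀ - ‖x₀‖ ^ 2)) := (hw.const_mul 2).sub_const _
  have h2 := le_of_tendsto_of_tendsto' h1 hc fun k => by
    have := real_inner_le_norm (x k) x₀
    nlinarith [sq_nonneg (‖x k‖ - ‖x₀‖)]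
  rw [real_inner_self_eq_norm_sq] at h2
  linarith

/-- Positivity is an open condition: where `0 < g₀ x`, the indicators of `{0 < g k}` are eventually
`1`. Fatou's lemma for these indicators gives the inequality. -/
lemma measure_pos_le_of_tendsto_ae {α : Type*} [MeasurableSpace α] {μ : Measure α}
    [IsFiniteMeasure μ] {g : ℕ → α → ℝ} {g₀ : α → ℝ} {p : ℝ}
    (hg : ∀ k, AEStronglyMeasurable (g k) μ) (hg₀ : AEStronglyMeasurable g₀ μ)
    (hlim : ∀ᵐ x ∂μ, Tendsto (fun k => g k x) atTop (𝓝 (g₀ x)))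
    (hp : Tendsto (fun k => μ.real {x | 0 < g k x}) atTop (𝓝 p)) :
    μ.real {x | 0 < g₀ x} ≤ p := by
  have hms : ∀ {f : α → ℝ}, AEStronglyMeasurable f μ → NullMeasurableSet {x | 0 < f x} μ :=
    fun hf => nullMeasurableSet_lt aemeasurable_const hf.aemeasurable
  set I : ℕ → α → ENNReal := fun k => {x | 0 < g k x}.indicator 1 with hI
  have h1 := lintegral_liminf_le' (μ := μ) (f := I) (u := atTop)
    (fun k => (aemeasurable_const (b := (1 : ENNReal))).indicator₀ (hms (hg k)))
  have h2 : μ {x | 0 < g₀ x} ≤ ∫⁻ x, liminf (fun k => I k x) atTop ∂μ := by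
    rw [← lintegral_indicator_one₀ (hms hg₀)]
    refine lintegral_mono_ae ?_
    filter_upwards [hlim] with x hx
    by_cases h0 : 0 < g₀ x
    · rw [indicator_of_mem (show x ∈ {x | 0 < g₀ x} from h0)]
      refine le_liminf_of_le (by isBoundedDefault) ?_
      filter_upwards [hx.eventually (lt_mem_nhds h0)] with k hk
      rw [hI]; simp only
      rw [indicator_of_mem (show x ∈ {x | 0 < g k x} from hk)]
    · rw [indicator_of_notMem (show x ∉ {x | 0 < g₀ x} from h0)]
      exact zero_le
  have h3 : ∀ k, ∫⁻ x, I k x ∂μ = ENNReal.ofReal (μ.real {x | 0 < g k x}) := fun k => by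
    rw [ofReal_measureReal, hI]
    exact lintegral_indicator_one₀ (hms (hg k))
  simp only [h3] at h1
  have h4 : Tendsto (fun k => ENNReal.ofReal (μ.real {x | 0 < g k x})) atTop
      (𝓝 (ENNReal.ofReal p)) := (ENNReal.continuous_ofReal.tendsto p).comp hp
  rw [h4.liminf_eq] at h1
  have hp0 : 0 ≤ p := ge_of_tendsto' hp fun k => measureReal_nonneg
  exact ENNReal.toReal_le_of_le_ofReal hp0 (h2.trans h1)

end WeakCompactness

/-! ### Strong convergence of traces -/

section ConeTraceCompactness
variable {n : ℕ}

/-- The traces of a sequence of gradients converge strongly if the gradients converge weakly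
and do not concentrate on the hyperplane. -/
lemma tendsto_lintegral_coneTrace {D : ℕ → Ext n → Ext n} (hD : ∀ k, Integrable (D k))
    (hweak : ∀ (h : Ext n → Ext n) (C : ℝ), Measurable h → (∀ z, ‖h z‖ ≤ C) →
      Tendsto (fun k => ∫ z, inner ℝ (h z) (D k z)) atTop (𝓝 0))
    {K : ℝ} (hK : ∀ k, ∫ z, ‖D k z‖ ≤ K)
    (hunif : ∀ ε : ENNReal, 0 < ε → ∃ δ : ℝ, 0 < δ ∧ ∀ k,
      ∫⁻ z in {z | 0 < z.snd ∧ z.snd ≤ δ}, ‖D k z‖ₑ ≤ ε) :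
    Tendsto (fun k => ∫⁻ x in slice (unitBall n), ‖coneTrace (D k) x‖ₑ) atTop (𝓝 0) := by
  rw [ENNReal.tendsto_nhds_zero]
  intro ε hε
  -- A quarter of `ε`, because the `L¹` bound for the trace operator has constant `2` and the strip
  -- may use up half of `ε`.
  obtain ⟨δ, hδ, hδk⟩ := hunif (ε / 2 / 2) (ENNReal.half_pos (ENNReal.half_pos hε.ne').ne')
  set s : Set (Ext n) := {z | δ < z.snd} with hs
  set t : Set (Ext n) := {z | 0 < z.snd ∧ z.snd ≤ δ} with ht
  have hsm : MeasurableSet s := measurableSet_lt measurable_const measurable_snd'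
  have htm : MeasurableSet t := (measurableSet_lt measurable_const measurable_snd').inter
    (measurableSet_le measurable_snd' measurable_const)
  have hv := ballVolume_pos (n := n)
  -- The bound on the cone kernel at height `δ`, which dominates it at all greater heights.
  set C : ℝ := 2 * ((ballVolume n)⁻¹ * (δ ^ n)⁻¹) with hC
  have hC0 : 0 ≤ C := by positivity
  have hker : ∀ x z, ‖s.indicator (coneKernel x) z‖ ≤ C := by
    intro x z
    by_cases hz : z ∈ s
    · rw [indicator_of_mem hz]
      have hz' : δ < z.snd := hz
      refine (norm_coneKernel_le x z).trans ?_
      by_cases hx : x ∈ Metric.ball z.fst z.snd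
      · rw [indicator_of_mem hx]
        exact mul_le_mul_of_nonneg_left (mul_le_mul_of_nonneg_left
          (inv_anti₀ (pow_pos hδ n) (pow_le_pow_left₀ hδ.le hz'.le n)) (inv_nonneg.2 hv.le))
          zero_le_two
      · rw [indicator_of_notMem hx]; exact hC0
    · rw [indicator_of_notMem hz, norm_zero]; exact hC0
  have hkerm : ∀ x, Measurable (s.indicator (coneKernel x)) := fun x =>
    (measurable_coneKernel.comp (measurable_const.prodMk measurable_id)).indicator hsm
  set T : ℕ → EuclideanSpace ℝ (Fin n) → ℝ := fun k x =>
    ∫ z, inner ℝ (s.indicator (coneKernel x) z) (D k z) with hT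
  have hTs : ∀ k x, T k x = -coneTrace (s.indicator (D k)) x := by
    intro k x
    rw [coneTrace, neg_neg]
    simp only [hT]
    congr 1; ext z
    by_cases hz : z ∈ s
    · rw [indicator_of_mem hz, indicator_of_mem hz]
    · rw [indicator_of_notMem hz, indicator_of_notMem hz, inner_zero_left, inner_zero_right]
  have hsplit : ∀ k, ∫⁻ x in slice (unitBall n), ‖coneTrace (D k) x‖ₑ ≤
      (∫⁻ x in slice (unitBall n), ‖T k x‖ₑ) + ε / 2 := by
    intro k
    have i1 := (hD k).indicator hsm
    have i2 := (hD k).indicator htm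
    have e1 : ∀ x, coneTrace (D k) x =
        coneTrace (fun z => s.indicator (D k) z + t.indicator (D k) z) x := by
      intro x
      unfold coneTrace
      congr 2; ext z
      beta_reduce
      rcases le_or_gt z.snd 0 with hz | hz
      · have : coneKernel x z = 0 := if_neg fun h => absurd h.1 (not_lt.2 hz)
        rw [this, inner_zero_left, inner_zero_left]
      · rcases le_or_gt z.snd δ with h1 | h1
        · rw [indicator_of_notMem (show z ∉ s from not_lt.2 h1),
            indicator_of_mem (show z ∈ t from ⟨hz, h1⟩), zero_add]
        · rw [indicator_of_mem (show z ∈ s from h1),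
            indicator_of_notMem (show z ∉ t from fun h => absurd h.2 (not_le.2 h1)), add_zero]
    calc ∫⁻ x in slice (unitBall n), ‖coneTrace (D k) x‖ₑ
        ≤ ∫⁻ x in slice (unitBall n), (‖T k x‖ₑ + ‖coneTrace (t.indicator (D k)) x‖ₑ) := by
          refine lintegral_mono_ae (ae_restrict_of_ae ?_)
          filter_upwards [coneTrace_add_ae i1 i2] with x hx
          rw [e1, hx, hTs, enorm_neg]
          exact enorm_add_le _ _
      _ = (∫⁻ x in slice (unitBall n), ‖T k x‖ₑ) +
          ∫⁻ x in slice (unitBall n), ‖coneTrace (t.indicator (D k)) x‖ₑ :=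
          lintegral_add_right' _ (integrable_coneTrace i2).1.restrict.enorm
      _ ≤ (∫⁻ x in slice (unitBall n), ‖T k x‖ₑ) + ε / 2 := by
          gcongr
          refine (lintegral_mono' Measure.restrict_le_self le_rfl).trans
            ((lintegral_coneTrace_le i2.1).trans ?_)
          have e2 : ∫⁻ z, ‖t.indicator (D k) z‖ₑ = ∫⁻ z in t, ‖D k z‖ₑ := by
            rw [← lintegral_indicator htm]
            congr 1; ext z
            by_cases hz : z ∈ t <;> simp [hz]
          rw [e2]
          calc 2 * ∫⁻ z in t, ‖D k z‖ₑ ≤ 2 * (ε / 2 / 2) := by gcongr; exact hδk k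
            _ = ε / 2 := ENNReal.mul_div_cancel (by simp) (by simp)
  -- For each `x` the truncated kernel is a bounded measurable field, so the weak hypothesis gives
  -- `T k x → 0`. The constant `C * K` dominates on the disc, which has finite measure.
  have hTlim : Tendsto (fun k => ∫⁻ x in slice (unitBall n), ‖T k x‖ₑ) atTop (𝓝 0) := by
    have : (0 : ENNReal) = ∫⁻ x in slice (unitBall n), 0 := by simp
    rw [this]
    refine tendsto_lintegral_of_dominated_convergence' (fun _ => ENNReal.ofReal (C * K))
      (fun k => ?_) (fun k => Eventually.of_forall fun x => ?_) ?_ (Eventually.of_forall fun x => ?_)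
    · have e : T k = fun x => -coneTrace (s.indicator (D k)) x := funext (hTs k)
      rw [e]
      exact (integrable_coneTrace ((hD k).indicator hsm)).neg.1.restrict.enorm
    · simp only
      rw [← ofReal_norm]
      refine ENNReal.ofReal_le_ofReal ?_
      calc ‖T k x‖ ≤ ∫ z, C * ‖D k z‖ := by
            refine norm_integral_le_of_norm_le ((hD k).norm.const_mul C)
              (Eventually.of_forall fun z => ?_)
            exact (norm_inner_le_norm _ _).trans
              (mul_le_mul_of_nonneg_right (hker x z) (norm_nonneg _))
        _ ≤ C * K := by
            rw [integral_const_mul]; exact mul_le_mul_of_nonneg_left (hK k) hC0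
    · rw [setLIntegral_const, slice_unitBall]
      exact ENNReal.mul_ne_top ENNReal.ofReal_ne_top measure_ball_lt_top.ne
    · have := (hweak _ C (hkerm x) (hker x)).enorm
      rw [enorm_zero] at this
      exact this
  filter_upwards [(ENNReal.tendsto_nhds_zero.1 hTlim) (ε / 2) (ENNReal.half_pos hε.ne')] with k hk
  exact (hsplit k).trans ((add_le_add_left hk _).trans (ENNReal.add_halves ε).le)

end ConeTraceCompactness

/-! ### The Hilbert space of weighted gradients -/

section Weak
variable {n : ℕ}

/-- The Hilbert space of weighted gradients. -/
noncomputable abbrev GradSpace (n : ℕ) : Type :=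
  Lp (Ext n) 2 (volume.restrict (unitBall n))

lemma memLp_weight_smul {b : ℝ} (hb : b < 1) {h : Ext n → Ext n} {C : ℝ} (hm : Measurable h)
    (hC : ∀ z, ‖h z‖ ≤ C) :
    MemLp (fun z => (|z.snd| ^ (-b / 2)) • h z) 2 (volume.restrict (unitBall n)) := by
  refine (memLp_weight (c := -b) (by linarith)).of_le_mul (c := C)
    ((measurable_abs_snd_rpow _).smul hm).aestronglyMeasurable
    (Eventually.of_forall fun z => ?_)
  rw [norm_smul, mul_comm]
  exact mul_le_mul_of_nonneg_right (hC z) (norm_nonneg _)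

lemma norm_sq_gradSpace (F : GradSpace n) : ‖F‖ ^ 2 = ∫ z in unitBall n, ‖F z‖ ^ 2 := by
  rw [← real_inner_self_eq_norm_sq, L2.inner_def]
  simp only [real_inner_self_eq_norm_sq]

/-- Separability is what makes the weak compactness sequential. -/
instance separableSpace_gradSpace : TopologicalSpace.SeparableSpace (GradSpace n) := by
  have : Fact ((2 : ENNReal) ≠ ⊤) := ⟨ENNReal.ofNat_ne_top⟩
  have : TopologicalSpace.SeparableSpace (Ext n) := inferInstance
  have : IsSeparable (volume.restrict (unitBall n)) := inferInstance
  have : SecondCountableTopology (GradSpace n) := Lp.SecondCountableTopology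
  infer_instance

/-- Weak convergence of the weighted gradients implies convergence of the gradients against
bounded functions. -/
lemma tendsto_integral_inner_of_weak {b : ℝ} (hb : b < 1) {F : ℕ → GradSpace n} {F₀ : GradSpace n}
    (hF : ∀ h, Tendsto (fun k => inner ℝ (F k) h) atTop (𝓝 (inner ℝ F₀ h)))
    {h : Ext n → Ext n} {C : ℝ} (hm : Measurable h) (hC : ∀ z, ‖h z‖ ≤ C) :
    Tendsto (fun k => ∫ z in unitBall n, inner ℝ (h z) ((|z.snd| ^ (-b / 2)) • F k z)) atTop
      (𝓝 (∫ z in unitBall n, inner ℝ (h z) ((|z.snd| ^ (-b / 2)) • F₀ z))) := by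
  -- Moving `|y|^{-b/2}` onto the bounded field `h` gives an element of `L²`, so each integral is an
  -- inner product with a fixed vector.
  have hmem := memLp_weight_smul hb hm hC
  have key : ∀ F : GradSpace n, ∫ z in unitBall n, inner ℝ (h z) ((|z.snd| ^ (-b / 2)) • F z) =
      inner ℝ F (hmem.toLp _) := by
    intro F
    rw [L2.inner_def]
    refine integral_congr_ae ?_
    filter_upwards [hmem.coeFn_toLp] with z hz
    rw [hz, inner_smul_right, inner_smul_right, real_inner_comm]
  simp only [key]
  exact hF _

end Weak

/-! ### Weak limits of gradients are gradients -/

section Closedness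
variable {n : ℕ}

lemma measurable_vertInt {k : ℝ → ℝ → ℝ} (hk : Measurable (Function.uncurry k)) {ψ : Ext n → ℝ}
    (hψ : Measurable ψ) : Measurable (vertInt k ψ) := by
  have h1 : Measurable fun p : Ext n × ℝ => k p.2 p.1.snd * ψ (pt p.1.fst p.2) :=
    (hk.comp (measurable_snd.prodMk (measurable_snd'.comp measurable_fst))).mul
      (hψ.comp (measurable_pt.comp ((measurable_fst'.comp measurable_fst).prodMk measurable_snd)))
  exact (h1.stronglyMeasurable.integral_prod_right').measurable

lemma abs_vertInt_le {k : ℝ → ℝ → ℝ} (hk1 : ∀ s t, |k s t| ≤ 1) {ψ : Ext n → ℝ} {C : ℝ}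
    (hC : ∀ z, |ψ z| ≤ C) (h0 : ∀ z, z ∉ unitBall n → ψ z = 0) (z : Ext n) :
    |vertInt k ψ z| ≤ C * 2 := by
  have hC0 : 0 ≤ C := (abs_nonneg _).trans (hC 0)
  have hz : ∀ s, s ∉ Icc (-1 : ℝ) 1 → k s z.snd * ψ (pt z.fst s) = 0 := by
    intro s hs
    rw [h0, mul_zero]
    intro hmem
    have h1 := (abs_snd_le_norm (pt z.fst s)).trans (mem_unitBall.1 hmem).le
    rw [pt_snd] at h1
    exact hs (abs_le.1 h1)
  unfold vertInt
  rw [← setIntegral_eq_integral_of_forall_compl_eq_zero (s := Icc (-1 : ℝ) 1) hz]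
  have := norm_setIntegral_le_of_norm_le_const (C := C) (μ := volume) (s := Icc (-1 : ℝ) 1)
    (f := fun s => k s z.snd * ψ (pt z.fst s)) (by simp) fun s _ => by
      rw [norm_mul]
      calc ‖k s z.snd‖ * ‖ψ (pt z.fst s)‖ ≤ 1 * C :=
            mul_le_mul (hk1 _ _) (hC _) (norm_nonneg _) zero_le_one
        _ = C := one_mul C
  rw [Real.norm_eq_abs] at this
  refine this.trans (le_of_eq ?_)
  rw [measureReal_def, Real.volume_Icc]
  norm_num

/-- It writes the pairing of `ψ` with a function recovered from `G` as the pairing of `G` with a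
vertical field; this is the form in which weak convergence can be used. -/
lemma integral_mul_vertInt_of_bounded {G : Ext n → Ext n} (hG : Integrable G) {ψ : Ext n → ℝ}
    (hψ : Measurable ψ) {C : ℝ} (hC : ∀ z, |ψ z| ≤ C) (h0 : ∀ z, z ∉ unitBall n → ψ z = 0) :
    ∫ z, inner ℝ (pt 0 (vertInt (fun t y => shiftKernel y t) ψ z)) (G z) =
      ∫ z, ψ z * vertInt shiftKernel (fun z => (G z).snd) z := by
  have hGs : Integrable fun z => (G z).snd := by
    have := hG.inner_const (𝕜 := ℝ) (pt 0 1)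
    simpa only [inner_vertical] using this
  rw [← integral_mul_vertInt measurable_shiftKernel abs_shiftKernel_le hGs hψ hC (r := 1)]
  · congr 1; ext z
    rw [inner_pt, pt_fst, pt_snd, inner_zero_left, zero_add, mul_comm]
  · intro z hz
    refine h0 z fun hmem => ?_
    have := (abs_snd_le_norm z).trans_lt (mem_unitBall.1 hmem)
    linarith

/-- Weak limits of gradients of functions vanishing outside the ball are gradients of such
functions. -/
lemma isWeakGradOn_of_tendsto {w : ℕ → Ext n → ℝ} {G : ℕ → Ext n → Ext n} {G₀ : Ext n → Ext n}
    (hw : ∀ k, IsWeakGradOn univ (w k) (G k)) (hG : ∀ k, Integrable (G k)) (hG₀ : Integrable G₀)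
    (hw0 : ∀ k z, z ∉ unitBall n → w k z = 0)
    (hlim : ∀ (h : Ext n → Ext n) (C : ℝ), Measurable h → (∀ z, ‖h z‖ ≤ C) →
      Tendsto (fun k => ∫ z, inner ℝ (h z) (G k z)) atTop (𝓝 (∫ z, inner ℝ (h z) (G₀ z)))) :
    IsWeakGradOn univ
      ((unitBall n).indicator fun z => -vertInt shiftKernel (fun z => (G₀ z).snd) z) G₀ := by
  have hGs : Integrable fun z => (G₀ z).snd := by
    have := hG₀.inner_const (𝕜 := ℝ) (pt 0 1)
    simpa only [inner_vertical] using this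
  have hwi : Integrable
      ((unitBall n).indicator fun z => -vertInt shiftKernel (fun z => (G₀ z).snd) z) := by
    rw [integrable_indicator_iff measurableSet_unitBall]
    exact (integrableOn_unitBall_vertInt measurable_shiftKernel abs_shiftKernel_le hGs).neg
  refine ⟨hwi.locallyIntegrable.locallyIntegrableOn _,
    hG₀.locallyIntegrable.locallyIntegrableOn _, fun ψ hψ e => ?_⟩
  -- The derivative of `ψ` matters only on the ball. Cut off there it is no longer continuous, but
  -- boundedness and measurability suffice below.
  set θ : Ext n → ℝ := (unitBall n).indicator fun z => fderiv ℝ ψ z e with hθ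
  have hθm : Measurable θ := (hψ.continuous_fderiv e).measurable.indicator measurableSet_unitBall
  obtain ⟨C, hC⟩ := (hψ.continuous_fderiv e).bounded_above_of_compact_support
    (hψ.hasCompactSupport_fderiv e)
  have hθC : ∀ z, |θ z| ≤ C := fun z => by
    rw [← Real.norm_eq_abs]
    exact (norm_indicator_le_norm_self (fun z => fderiv ℝ ψ z e) z).trans (hC z)
  have hθ0 : ∀ z, z ∉ unitBall n → θ z = 0 := fun z hz => indicator_of_notMem hz _
  have key : ∀ {W : Ext n → ℝ} {H : Ext n → Ext n}, Integrable H →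
      (∀ z, z ∉ unitBall n → W z = 0) →
      (∀ᵐ z : Ext n, z ∈ unitBall n → W z = -vertInt shiftKernel (fun z => (H z).snd) z) →
      ∫ z, W z * fderiv ℝ ψ z e =
        -∫ z, inner ℝ (pt 0 (vertInt (fun t y => shiftKernel y t) θ z)) (H z) := by
    intro W H hH hW0 hW
    rw [integral_mul_vertInt_of_bounded hH hθm hθC hθ0, ← integral_neg]
    refine integral_congr_ae ?_
    filter_upwards [hW] with z hz
    by_cases hzB : z ∈ unitBall n
    · rw [hz hzB, hθ, indicator_of_mem hzB]; ring
    · rw [hW0 z hzB, hθ0 z hzB]; ring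
  have hks : Measurable (Function.uncurry fun t y => shiftKernel y t) :=
    measurable_shiftKernel.comp measurable_swap
  have hqm : Measurable fun z : Ext n =>
      pt (0 : EuclideanSpace ℝ (Fin n)) (vertInt (fun t y => shiftKernel y t) θ z) :=
    measurable_pt.comp (measurable_const.prodMk
      (measurable_vertInt hks hθm))
  have hqC : ∀ z : Ext n,
      ‖pt (0 : EuclideanSpace ℝ (Fin n)) (vertInt (fun t y => shiftKernel y t) θ z)‖ ≤ C * 2 := by
    intro z
    have h1 := abs_vertInt_le (fun s t => abs_shiftKernel_le t s) hθC hθ0 z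
    have h2 := norm_pt_sq (0 : EuclideanSpace ℝ (Fin n))
      (vertInt (fun t y => shiftKernel y t) θ z)
    rw [norm_zero, zero_pow two_ne_zero, zero_add,
      ← sq_abs (vertInt (fun t y => shiftKernel y t) θ z)] at h2
    exact ((sq_eq_sq₀ (norm_nonneg _) (abs_nonneg _)).1 h2).le.trans h1
  obtain ⟨A, hA⟩ := hψ.exists_bound
  have hl1 := (hlim _ _ hqm hqC).neg
  have hl2 := (hlim (fun z => ψ z • e) (A * ‖e‖) (hψ.smooth.continuous.measurable.smul_const e)
    fun z => by
      rw [norm_smul]; exact mul_le_mul_of_nonneg_right (hA z) (norm_nonneg _)).neg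
  rw [setIntegral_univ, setIntegral_univ, key hG₀ (fun z hz => indicator_of_notMem hz _)
    (Eventually.of_forall fun z hz => indicator_of_mem hz _)]
  have hrw : ∀ H : Ext n → Ext n, ∫ z, inner ℝ (ψ z • e) (H z) = ∫ z, inner ℝ (H z) e * ψ z :=
    fun H => by
      congr 1; ext z
      rw [real_inner_smul_left, real_inner_comm, mul_comm]
  rw [← hrw]
  -- The two sides of the integration by parts are now limits of pairings of `G k` with fixed
  -- bounded fields, and for every `k` these pairings agree by the weak gradient relation of `w k`.
  refine tendsto_nhds_unique hl1 (hl2.congr fun k => ?_)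
  have := (hw k).by_parts ψ hψ e
  rw [setIntegral_univ, setIntegral_univ] at this
  rw [hrw, ← this, key (hG k) (hw0 k) ((hw k).ae_eq_vertInt (hG k) (hw0 k))]

end Closedness

/-! ### Passing between gradients and weighted gradients -/

section Limit
variable {n : ℕ}

/-- The gradient field, relative to that of `f`, encoded by a weighted gradient. -/
noncomputable def relGrad (b : ℝ) (f : Ext n → ℝ) (F : GradSpace n) : Ext n → Ext n :=
  (unitBall n).indicator fun z => (|z.snd| ^ (-b / 2)) • F z - gradient f z

lemma weight_smul_ae (b : ℝ) (F : Ext n → Ext n) :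
    (fun z => (|z.snd| ^ (b / 2)) • (|z.snd| ^ (-b / 2)) • F z)
      =ᵐ[volume.restrict (unitBall n)] F := by
  filter_upwards [ae_restrict_of_ae ae_snd_ne_zero] with z hz
  rw [smul_smul, mul_comm, weight_cancel hz, one_smul]

lemma memLp_weight_smul_gradSpace (b : ℝ) (F : GradSpace n) :
    MemLp (fun z => (|z.snd| ^ (b / 2)) • (|z.snd| ^ (-b / 2)) • F z) 2
      (volume.restrict (unitBall n)) :=
  (Lp.memLp F).ae_eq (weight_smul_ae b F).symm

lemma integrableOn_gradSpace {b : ℝ} (hb : b < 1) (F : GradSpace n) :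
    IntegrableOn (fun z => (|z.snd| ^ (-b / 2)) • F z) (unitBall n) :=
  integrableOn_of_weighted hb (memLp_weight_smul_gradSpace b F)

lemma IsDatum.integrable_relGrad {φ f : Ext n → ℝ} (hf : IsDatum φ f) {b : ℝ} (hb : b < 1)
    (F : GradSpace n) : Integrable (relGrad b f F) := by
  rw [relGrad, integrable_indicator_iff measurableSet_unitBall]
  exact (integrableOn_gradSpace hb F).sub hf.integrable_gradient.integrableOn

lemma IsDatum.memLp_relGrad {φ f : Ext n → ℝ} (hf : IsDatum φ f) {b : ℝ} (hb : -1 < b)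
    (F : GradSpace n) : MemLp (fun z => (|z.snd| ^ (b / 2)) • relGrad b f F z) 2
      (volume.restrict (unitBall n)) := by
  refine ((memLp_weight_smul_gradSpace b F).sub (hf.memLp_gradient hb)).ae_eq ?_
  filter_upwards [ae_restrict_mem measurableSet_unitBall] with z hz
  rw [relGrad, indicator_of_mem hz, smul_sub]
  rfl

/-- Admissible functions are encoded by elements of the Hilbert space of weighted gradients. -/
lemma IsDatum.exists_gradSpace {φ f v : Ext n → ℝ} {b : ℝ} (h : Admissible b φ v) :
    ∃ F : GradSpace n, ‖F‖ ^ 2 = energy b (unitBall n) v ∧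
      gradDiff f v =ᵐ[volume] relGrad b f F := by
  have hae := h.1.grad_memLp.coeFn_toLp
  refine ⟨h.1.grad_memLp.toLp _, ?_, ?_⟩
  · rw [norm_sq_gradSpace, energy_eq h.1.isWeakGradOn]
    refine integral_congr_ae ?_
    filter_upwards [hae] with z hz
    rw [hz]
  · rw [EventuallyEq, ae_restrict_iff' measurableSet_unitBall] at hae
    filter_upwards [hae, ae_snd_ne_zero] with z hz hz0
    by_cases hzB : z ∈ unitBall n
    · rw [gradDiff, relGrad, indicator_of_mem hzB, indicator_of_mem hzB, hz hzB, smul_smul,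
        weight_cancel hz0, one_smul]
    · rw [gradDiff, relGrad, indicator_of_notMem hzB, indicator_of_notMem hzB]

lemma IsDatum.tendsto_integral_relGrad {φ f : Ext n → ℝ} (hf : IsDatum φ f) {b : ℝ} (hb : b < 1)
    {F : ℕ → GradSpace n} {F₀ : GradSpace n}
    (hF : ∀ h, Tendsto (fun k => inner ℝ (F k) h) atTop (𝓝 (inner ℝ F₀ h)))
    {h : Ext n → Ext n} {C : ℝ} (hm : Measurable h) (hC : ∀ z, ‖h z‖ ≤ C) :
    Tendsto (fun k => ∫ z, inner ℝ (h z) (relGrad b f (F k) z)) atTop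
      (𝓝 (∫ z, inner ℝ (h z) (relGrad b f F₀ z))) := by
  have bdd : ∀ {H : Ext n → Ext n}, IntegrableOn H (unitBall n) →
      IntegrableOn (fun z => inner ℝ (h z) (H z)) (unitBall n) := fun hH =>
    (hH.norm.const_mul C).mono' (hm.aestronglyMeasurable.inner hH.1)
      (Eventually.of_forall fun z => (norm_inner_le_norm _ _).trans
        (mul_le_mul_of_nonneg_right (hC z) (norm_nonneg _)))
  have key : ∀ F : GradSpace n, ∫ z, inner ℝ (h z) (relGrad b f F z) =
      (∫ z in unitBall n, inner ℝ (h z) ((|z.snd| ^ (-b / 2)) • F z)) -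
        ∫ z in unitBall n, inner ℝ (h z) (gradient f z) := by
    intro F
    rw [← integral_sub (bdd (integrableOn_gradSpace hb F))
      (bdd hf.integrable_gradient.integrableOn), ← integral_indicator measurableSet_unitBall]
    congr 1; ext z
    by_cases hz : z ∈ unitBall n
    · rw [relGrad, indicator_of_mem hz, indicator_of_mem hz, inner_sub_right]
    · rw [relGrad, indicator_of_notMem hz, indicator_of_notMem hz, inner_zero_right]
  simp only [key]
  exact (tendsto_integral_inner_of_weak hb hF hm hC).sub_const _

/-- The strips decrease and, because `y = 0` is excluded, have empty intersection; the ball has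
finite measure. -/
lemma tendsto_volume_strip : Tendsto (fun k : ℕ => volume.restrict (unitBall n)
    {z : Ext n | 0 < z.snd ∧ z.snd ≤ ((k : ℝ) + 1)⁻¹}) atTop (𝓝 0) := by
  have := isFiniteMeasure_restrict_unitBall (n := n)
  have hm : ∀ k : ℕ, MeasurableSet {z : Ext n | 0 < z.snd ∧ z.snd ≤ ((k : ℝ) + 1)⁻¹} := fun k =>
    (measurableSet_lt measurable_const measurable_snd').inter
      (measurableSet_le measurable_snd' measurable_const)
  have h := tendsto_measure_iInter_atTop (μ := volume.restrict (unitBall n))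
    (s := fun k : ℕ => {z : Ext n | 0 < z.snd ∧ z.snd ≤ ((k : ℝ) + 1)⁻¹})
    (fun k => (hm k).nullMeasurableSet) (fun k l hkl z hz => ⟨hz.1, hz.2.trans (by gcongr)⟩)
    ⟨0, measure_ne_top _ _⟩
  have he : (⋂ k : ℕ, {z : Ext n | 0 < z.snd ∧ z.snd ≤ ((k : ℝ) + 1)⁻¹}) = ∅ := by
    rw [eq_empty_iff_forall_notMem]
    intro z hz
    rw [mem_iInter] at hz
    have hz0 := (hz 0).1
    obtain ⟨k, hk⟩ := exists_nat_one_div_lt hz0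
    have := (hz k).2
    rw [one_div] at hk
    linarith
  rwa [he, measure_empty] at h

/-- The gradient of `f` cancels in the difference, and Cauchy-Schwarz on `s` splits off the weight.
The first factor depends on `s` alone, so smallness is uniform over bounded sets of gradients. -/
lemma lintegral_relGrad_sub_le {b : ℝ} (f : Ext n → ℝ) (F F' : GradSpace n) {s : Set (Ext n)}
    (hs : MeasurableSet s) :
    ∫⁻ z in s, ‖relGrad b f F z - relGrad b f F' z‖ₑ ≤
      eLpNorm (s.indicator fun z : Ext n => |z.snd| ^ (-b / 2)) 2 (volume.restrict (unitBall n)) *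
        ENNReal.ofReal ‖F - F'‖ := by
  have hsB := hs.inter (measurableSet_unitBall (n := n))
  have e1 : ∫⁻ z in s, ‖relGrad b f F z - relGrad b f F' z‖ₑ =
      eLpNorm (fun z : Ext n => (|z.snd| ^ (-b / 2)) • (F - F' : GradSpace n) z) 1
        (volume.restrict (s ∩ unitBall n)) := by
    rw [eLpNorm_one_eq_lintegral_enorm, ← lintegral_indicator hs, ← lintegral_indicator hsB]
    have hae := Lp.coeFn_sub F F'
    rw [EventuallyEq, ae_restrict_iff' measurableSet_unitBall] at hae
    refine lintegral_congr_ae ?_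
    filter_upwards [hae] with z hz
    by_cases h1 : z ∈ s <;> by_cases h2 : z ∈ unitBall n
    · rw [indicator_of_mem h1, indicator_of_mem (show z ∈ s ∩ unitBall n from ⟨h1, h2⟩), hz h2,
        relGrad, relGrad, indicator_of_mem h2, indicator_of_mem h2, Pi.sub_apply, smul_sub,
        sub_sub_sub_cancel_right]
    · rw [indicator_of_mem h1, indicator_of_notMem (show z ∉ s ∩ unitBall n from fun h => h2 h.2),
        relGrad, relGrad, indicator_of_notMem h2, indicator_of_notMem h2, sub_zero, enorm_zero]
    · rw [indicator_of_notMem h1, indicator_of_notMem (show z ∉ s ∩ unitBall n from fun h => h1 h.1)]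
    · rw [indicator_of_notMem h1, indicator_of_notMem (show z ∉ s ∩ unitBall n from fun h => h1 h.1)]
  have hmem := memLp_weight_smul_gradSpace b (F - F')
  rw [e1]
  refine (eLpNorm_one_le_of_weighted (b := b) (hmem.1.mono_measure
    (Measure.restrict_mono_set _ inter_subset_right))).trans ?_
  refine mul_le_mul' (le_of_eq ?_) ?_
  · rw [eLpNorm_indicator_eq_eLpNorm_restrict hs, Measure.restrict_restrict hs]
  · refine (eLpNorm_mono_measure _ (Measure.restrict_mono_set _ inter_subset_right)).trans ?_
    rw [eLpNorm_congr_ae (weight_smul_ae b _), ofReal_norm, Lp.enorm_def]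

/-- Bounded sets of weighted gradients do not concentrate on the hyperplane. -/
lemma exists_lintegral_strip_le {b : ℝ} (hb : b < 1) (f : Ext n → ℝ) {M : ℝ} (hM : 0 < M)
    {ε : ENNReal} (hε : 0 < ε) : ∃ δ : ℝ, 0 < δ ∧ ∀ F F' : GradSpace n, ‖F - F'‖ ≤ M →
      ∫⁻ z in {z | 0 < z.snd ∧ z.snd ≤ δ}, ‖relGrad b f F z - relGrad b f F' z‖ₑ ≤ ε := by
  obtain ⟨r, hr0, hrε⟩ := ENNReal.lt_iff_exists_nnreal_btwn.1 hε
  have hr0' : 0 < (r : ℝ) := by exact_mod_cast hr0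
  -- Absolute continuity of the `L²` norm of `|y|^{-b/2}`: it is at most `r / M` on sets of measure
  -- at most `η`, and thin strips are such sets.
  obtain ⟨η, hη, hηs⟩ := (memLp_weight (n := n) (c := -b) (by linarith)).eLpNorm_indicator_le
    one_le_two ENNReal.ofNat_ne_top (div_pos hr0' hM)
  obtain ⟨k, hk⟩ := ((ENNReal.tendsto_nhds_zero.1 (tendsto_volume_strip (n := n)))
    (ENNReal.ofReal η) (ENNReal.ofReal_pos.2 hη)).exists
  have hm : MeasurableSet {z : Ext n | 0 < z.snd ∧ z.snd ≤ ((k : ℝ) + 1)⁻¹} :=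
    (measurableSet_lt measurable_const measurable_snd').inter
      (measurableSet_le measurable_snd' measurable_const)
  refine ⟨((k : ℝ) + 1)⁻¹, by positivity, fun F F' hFF => ?_⟩
  calc _ ≤ _ := lintegral_relGrad_sub_le f F F' hm
    _ ≤ ENNReal.ofReal (r / M) * ENNReal.ofReal M :=
        mul_le_mul' (hηs _ hm hk) (ENNReal.ofReal_le_ofReal hFF)
    _ = r := by
        rw [← ENNReal.ofReal_mul (by positivity), div_mul_cancel₀ _ hM.ne',
          ENNReal.ofReal_coe_nnreal]
    _ ≤ ε := hrε.le

end Limit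

/-! ### The penalization -/

section Penal

lemma continuous_penal (ε w : ℝ) : Continuous (penal ε w) := by
  unfold penal
  refine Continuous.if_le (by fun_prop) (by fun_prop) continuous_const continuous_id ?_
  rintro s rfl
  simp

lemma monotone_penal {ε : ℝ} (hε : 0 < ε) (w : ℝ) : Monotone (penal ε w) := by
  intro s t hst
  have h1 : 0 < 1 / ε := by positivity
  unfold penal
  split_ifs with hs ht ht
  · exact mul_le_mul_of_nonneg_left (by linarith) h1.le
  · linarith
  · exact (mul_nonpos_of_nonneg_of_nonpos hε.le (by linarith)).trans
      (mul_nonneg h1.le (by linarith))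
  · exact mul_le_mul_of_nonneg_left (by linarith) hε.le

/-- By monotonicity the least value on volumes is taken at `0`; this lower bound yields the energy
bound along a minimizing sequence. -/
lemma le_penal {ε w s : ℝ} (hε : 0 < ε) (hw : 0 < w) (hs : 0 ≤ s) : -(ε * w) ≤ penal ε w s := by
  refine le_trans (le_of_eq ?_) (monotone_penal hε w hs)
  rw [penal, if_neg (not_le.2 hw)]
  ring

end Penal

/-! ### Existence of a minimizer -/

section Perturbation
variable {n : ℕ}

/-- Functions of finite weighted energy vanishing outside the ball, with their gradients. -/
structure IsPerturbation (b : ℝ) (w : Ext n → ℝ) (G : Ext n → Ext n) : Prop where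
  isWeakGradOn : IsWeakGradOn univ w G
  eq_zero : ∀ z, z ∉ unitBall n → w z = 0
  grad_eq_zero : ∀ z, z ∉ unitBall n → G z = 0
  memLp : MemLp w 2 (volume.restrict (unitBall n))
  memLp_grad : MemLp (fun z => (|z.snd| ^ (b / 2)) • G z) 2 (volume.restrict (unitBall n))

variable {b : ℝ} {w : Ext n → ℝ} {G : Ext n → Ext n}

lemma IsPerturbation.integrable (h : IsPerturbation b w G) : Integrable w := by
  have := isFiniteMeasure_restrict_unitBall (n := n)
  refine (integrableOn_iff_integrable_of_support_subset fun z hz => ?_).1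
    (h.memLp.integrable one_le_two)
  by_contra h'
  exact hz (h.eq_zero z h')

lemma IsPerturbation.integrable_grad (h : IsPerturbation b w G) (hb : b < 1) : Integrable G := by
  refine (integrableOn_iff_integrable_of_support_subset fun z hz => ?_).1
    (integrableOn_of_weighted hb h.memLp_grad)
  by_contra h'
  exact hz (h.grad_eq_zero z h')

lemma isPerturbation_zero (b : ℝ) : IsPerturbation b (0 : Ext n → ℝ) 0 where
  isWeakGradOn := ⟨(integrable_zero _ _ _).locallyIntegrable.locallyIntegrableOn _,
    (integrable_zero _ _ _).locallyIntegrable.locallyIntegrableOn _, fun ψ _ e => by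
      simp only [Pi.zero_apply, zero_mul, inner_zero_left, integral_zero, neg_zero]⟩
  eq_zero _ _ := rfl
  grad_eq_zero _ _ := rfl
  memLp := MemLp.zero
  memLp_grad := by
    simp only [Pi.zero_apply, smul_zero]
    exact MemLp.zero

lemma memLp_comp_reflect {F : Type*} [NormedAddCommGroup F] {g : Ext n → F}
    (hg : MemLp g 2 (volume.restrict (unitBall n))) :
    MemLp (fun z => g (reflect n z)) 2 (volume.restrict (unitBall n)) := by
  have h := (measurePreserving_reflect (n := n)).restrict_preimage measurableSet_unitBall
  rw [preimage_reflect_unitBall] at h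
  exact hg.comp_measurePreserving h

lemma IsPerturbation.even_part (h : IsPerturbation b w G) :
    IsPerturbation b (fun z => 1 / 2 * (w z + w (reflect n z)))
      (fun z => (1 / 2 : ℝ) • (G z + reflect n (G (reflect n z)))) where
  isWeakGradOn := (h.isWeakGradOn.add (h.isWeakGradOn.comp_reflect preimage_univ)).const_smul _
  eq_zero z hz := by
    rw [h.eq_zero z hz, h.eq_zero _ (mt reflect_mem_unitBall.1 hz)]; ring
  grad_eq_zero z hz := by
    rw [h.grad_eq_zero z hz, h.grad_eq_zero _ (mt reflect_mem_unitBall.1 hz), map_zero, add_zero,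
      smul_zero]
  memLp := (h.memLp.add (memLp_comp_reflect h.memLp)).const_mul _
  memLp_grad := by
    have h1 := (reflect n).toContinuousLinearEquiv.toContinuousLinearMap.comp_memLp'
      (memLp_comp_reflect h.memLp_grad)
    refine ((h.memLp_grad.add h1).const_smul (1 / 2 : ℝ)).ae_eq (Eventually.of_forall fun z => ?_)
    change (1 / 2 : ℝ) • ((|z.snd| ^ (b / 2)) • G z +
      reflect n ((|(reflect n z).snd| ^ (b / 2)) • G (reflect n z))) = _
    rw [reflect_snd, abs_neg, map_smul, ← smul_add, smul_comm]

variable {φ f : Ext n → ℝ}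

lemma IsDatum.admissible_add (hf : IsDatum φ f) (hb : -1 < b) (hb1 : b < 1)
    (h : IsPerturbation b w G) : Admissible b φ (fun z => f z + w z) :=
  hf.admissible hb h.isWeakGradOn h.integrable (h.integrable_grad hb1) h.eq_zero h.grad_eq_zero
    h.memLp h.memLp_grad fun _ => rfl

lemma posVolume_eq {v : Ext n → ℝ} {g : EuclideanSpace ℝ (Fin n) → ℝ}
    (h : ∀ᵐ x : EuclideanSpace ℝ (Fin n), x ∈ slice (unitBall n) →
      flatTrace (unitBall n) v x = g x) :
    posVolume (unitBall n) v = (volume.restrict (slice (unitBall n))).real {x | 0 < g x} := by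
  have hm : MeasurableSet (slice (unitBall n)) := by
    rw [slice_unitBall]; exact Metric.isOpen_ball.measurableSet
  rw [measureReal_def, Measure.restrict_apply' hm, posVolume, inter_comm]
  congr 1
  refine measure_congr ?_
  rw [eventuallyEq_set]
  filter_upwards [h] with x hx
  simp only [mem_inter_iff, mem_ofPred_eq]
  constructor
  · rintro ⟨h1, h2⟩; exact ⟨by rwa [← hx h2], h2⟩
  · rintro ⟨h1, h2⟩; exact ⟨by rwa [hx h2], h2⟩

lemma posVolume_le (v : Ext n → ℝ) :
    posVolume (unitBall n) v ≤ (volume (slice (unitBall n))).toReal := by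
  refine ENNReal.toReal_mono ?_ (measure_mono inter_subset_left)
  rw [slice_unitBall]
  exact measure_ball_lt_top.ne

lemma energy_nonneg (b : ℝ) (Ω : Set (Ext n)) (v : Ext n → ℝ) : 0 ≤ energy b Ω v :=
  integral_nonneg fun _ => mul_nonneg (Real.rpow_nonneg (abs_nonneg _) _) (sq_nonneg _)

/-- Along a weakly convergent sequence of admissible functions, the limit is admissible, and its
energy and its positive volume are at most the limits of those of the sequence. -/
lemma IsDatum.exists_limit (hf : IsDatum φ f) (hb : -1 < b) (hb1 : b < 1) {v : ℕ → Ext n → ℝ}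
    (hv : ∀ k, Admissible b φ (v k)) {F : ℕ → GradSpace n} {F₀ : GradSpace n}
    (hFv : ∀ k, gradDiff f (v k) =ᵐ[volume] relGrad b f (F k)) {M : ℝ} (hM : ∀ k, ‖F k‖ ≤ M)
    (hF : ∀ h, Tendsto (fun k => inner ℝ (F k) h) atTop (𝓝 (inner ℝ F₀ h)))
    {E p : ℝ} (hE : Tendsto (fun k => ‖F k‖ ^ 2) atTop (𝓝 E))
    (hp : Tendsto (fun k => posVolume (unitBall n) (v k)) atTop (𝓝 p)) :
    ∃ w G, IsPerturbation b w G ∧ energy b (unitBall n) (fun z => f z + w z) ≤ E ∧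
      posVolume (unitBall n) (fun z => f z + w z) ≤ p := by
  set G₀ := relGrad b f F₀ with hG₀
  have hGi : ∀ k, Integrable (gradDiff f (v k)) := fun k => hf.integrable_gradDiff hb1 (hv k)
  have hG₀i : Integrable G₀ := hf.integrable_relGrad hb1 F₀
  have hG₀s : Integrable fun z => (G₀ z).snd := by
    have := hG₀i.inner_const (𝕜 := ℝ) (pt 0 1)
    simpa only [inner_vertical] using this
  have hG₀0 : ∀ z, z ∉ unitBall n → G₀ z = 0 := fun z hz => indicator_of_notMem hz _
  have hlim : ∀ (h : Ext n → Ext n) (C : ℝ), Measurable h → (∀ z, ‖h z‖ ≤ C) →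
      Tendsto (fun k => ∫ z, inner ℝ (h z) (gradDiff f (v k) z)) atTop
        (𝓝 (∫ z, inner ℝ (h z) (G₀ z))) := by
    intro h C hm hC
    refine (hf.tendsto_integral_relGrad hb1 hF hm hC).congr fun k => integral_congr_ae ?_
    filter_upwards [hFv k] with z hz
    rw [hz]
  set w : Ext n → ℝ :=
    (unitBall n).indicator fun z => -vertInt shiftKernel (fun z => (G₀ z).snd) z with hw
  have hG₀2 := hf.memLp_relGrad hb F₀
  have hpert : IsPerturbation b w G₀ := by
    refine ⟨isWeakGradOn_of_tendsto (fun k => hf.isWeakGradOn_gradDiff hb1 (hv k)) hGi hG₀i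
      (fun k z hz => indicator_of_notMem hz _) hlim, fun z hz => indicator_of_notMem hz _, hG₀0,
      ?_, hG₀2⟩
    -- The vertical component inherits the weighted `L²` bound. It is needed on the whole space,
    -- where the field is zero outside the ball.
    have hvert : MemLp (fun z => |z.snd| ^ (b / 2) * (G₀ z).snd) 2 := by
      have h1 : MemLp (fun z => |z.snd| ^ (b / 2) * (G₀ z).snd) 2
          (volume.restrict (unitBall n)) := by
        refine hG₀2.of_le ((measurable_abs_snd_rpow _).aestronglyMeasurable.mul
          hG₀s.1.restrict) (Eventually.of_forall fun z => ?_)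
        rw [norm_smul, norm_mul]
        exact mul_le_mul_of_nonneg_left (abs_snd_le_norm _) (norm_nonneg _)
      rw [← memLp_indicator_iff_restrict measurableSet_unitBall] at h1
      refine h1.ae_eq (Eventually.of_forall fun z => ?_)
      by_cases hz : z ∈ unitBall n
      · rw [indicator_of_mem hz]
      · rw [indicator_of_notMem hz]
        beta_reduce
        rw [hG₀0 z hz]
        exact (mul_zero _).symm
    refine (memLp_vertInt hb1 measurable_shiftKernel abs_shiftKernel_le hG₀s
      (fun z hz => by rw [hG₀0 z hz]; rfl) hvert).neg.ae_eq ?_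
    filter_upwards [ae_restrict_mem measurableSet_unitBall] with z hz
    rw [hw, indicator_of_mem hz]
    rfl
  refine ⟨w, G₀, hpert, ?_, ?_⟩
  · have hgrad := (hf.isWeakGradOn.add hpert.isWeakGradOn).mono (subset_univ (unitBall n))
    refine le_trans (le_of_eq ?_) (norm_sq_le_of_tendsto_inner (hF F₀) hE)
    rw [energy_eq hgrad, norm_sq_gradSpace]
    refine integral_congr_ae ?_
    filter_upwards [ae_restrict_mem measurableSet_unitBall, weight_smul_ae b F₀] with z hz h1
    rw [hG₀, relGrad, indicator_of_mem hz, add_sub_cancel, h1]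
  · have htr₀ := hf.flatTrace_ae_eq hpert.isWeakGradOn hpert.integrable hG₀i hpert.eq_zero hG₀0
      (v := fun z => f z + w z) fun _ _ => rfl
    have htr : ∀ k, ∀ᵐ x : EuclideanSpace ℝ (Fin n), x ∈ slice (unitBall n) →
        flatTrace (unitBall n) (v k) x =
          coneTrace (gradient f) x + coneTrace (gradDiff f (v k)) x := fun k =>
      hf.flatTrace_ae_eq (hf.isWeakGradOn_gradDiff hb1 (hv k)) (hf.integrable_diff hb1 (hv k))
        (hGi k) (fun z hz => indicator_of_notMem hz _) (fun z hz => indicator_of_notMem hz _)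
        fun z hz => by rw [indicator_of_mem hz]; ring
    simp only [posVolume_eq (htr _)] at hp
    rw [posVolume_eq htr₀]
    set μ := volume.restrict (slice (unitBall n)) with hμ
    have : IsFiniteMeasure μ := ⟨by
      rw [hμ, Measure.restrict_apply_univ, slice_unitBall]; exact measure_ball_lt_top⟩
    have hmt : ∀ {H : Ext n → Ext n}, Integrable H →
        AEStronglyMeasurable (fun x => coneTrace (gradient f) x + coneTrace H x) μ := fun hH =>
      ((integrable_coneTrace hf.integrable_gradient).1.add (integrable_coneTrace hH).1).restrict
    -- The summand `1` only makes the bound strictly positive.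
    have hM' : ∀ k, ‖F k - F₀‖ ≤ M + ‖F₀‖ + 1 := fun k =>
      (norm_sub_le _ _).trans (by linarith [hM k])
    have hM0 : 0 < M + ‖F₀‖ + 1 := by linarith [(norm_nonneg _).trans (hM 0), norm_nonneg F₀]
    have hDeq : ∀ k (s : Set (Ext n)), ∫⁻ z in s, ‖gradDiff f (v k) z - G₀ z‖ₑ =
        ∫⁻ z in s, ‖relGrad b f (F k) z - relGrad b f F₀ z‖ₑ := fun k s => by
      refine lintegral_congr_ae (ae_restrict_of_ae ?_)
      filter_upwards [hFv k] with z hz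
      rw [hz]
    have hconv : Tendsto (fun k => ∫⁻ x, ‖coneTrace (fun z => gradDiff f (v k) z - G₀ z) x‖ₑ ∂μ)
        atTop (𝓝 0) := by
      -- The three inputs are weak convergence of the gradient differences to zero, a uniform `L¹`
      -- bound from Cauchy-Schwarz with `s = univ`, and the absence of concentration on the strip.
      refine tendsto_lintegral_coneTrace (fun k => (hGi k).sub hG₀i) (fun h C hm hC => ?_)
        (K := (eLpNorm (univ.indicator fun z : Ext n => |z.snd| ^ (-b / 2)) 2
          (volume.restrict (unitBall n)) * ENNReal.ofReal (M + ‖F₀‖ + 1)).toReal) (fun k => ?_)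
        fun ε hε => ?_
      · have hbd : ∀ {H : Ext n → Ext n}, Integrable H →
            Integrable fun z => inner ℝ (h z) (H z) := fun hH =>
          (hH.norm.const_mul C).mono' (hm.aestronglyMeasurable.inner hH.1)
            (Eventually.of_forall fun z => (norm_inner_le_norm _ _).trans
              (mul_le_mul_of_nonneg_right (hC z) (norm_nonneg _)))
        have h1 := (hlim h C hm hC).sub_const (∫ z, inner ℝ (h z) (G₀ z))
        rw [sub_self] at h1
        refine h1.congr fun k => ?_
        rw [← integral_sub (hbd (hGi k)) (hbd hG₀i)]
        congr 1; ext z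
        rw [inner_sub_right]
      · rw [integral_norm_eq_lintegral_enorm (f := fun z => gradDiff f (v k) z - G₀ z)
          ((hGi k).sub hG₀i).1]
        refine ENNReal.toReal_mono (ENNReal.mul_ne_top ?_ ENNReal.ofReal_ne_top) ?_
        · rw [indicator_univ]
          exact (memLp_weight (by linarith)).2.ne
        · rw [← setLIntegral_univ, hDeq]
          exact (lintegral_relGrad_sub_le f _ _ MeasurableSet.univ).trans
            (mul_le_mul_right (ENNReal.ofReal_le_ofReal (hM' k)) _)
      · obtain ⟨δ, hδ, h⟩ := exists_lintegral_strip_le hb1 f hM0 hε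
        exact ⟨δ, hδ, fun k => by rw [hDeq]; exact h _ _ (hM' k)⟩
    have hmeas : TendstoInMeasure μ
        (fun k x => coneTrace (gradient f) x + coneTrace (gradDiff f (v k)) x) atTop
        (fun x => coneTrace (gradient f) x + coneTrace G₀ x) := by
      refine tendstoInMeasure_of_tendsto_eLpNorm one_ne_zero (fun k => hmt (hGi k)) (hmt hG₀i) ?_
      refine hconv.congr fun k => ?_
      rw [eLpNorm_one_eq_lintegral_enorm]
      refine lintegral_congr_ae (ae_restrict_of_ae ?_)
      filter_upwards [coneTrace_sub_ae (hGi k) hG₀i] with x hx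
      rw [hx, Pi.sub_apply, add_sub_add_left_eq_sub]
    -- Almost everywhere convergence holds only along a subsequence; that is enough, since the
    -- positive volumes still tend to `p` along it.
    obtain ⟨σ, hσ, hae⟩ := hmeas.exists_seq_tendsto_ae
    exact measure_pos_le_of_tendsto_ae (fun k => hmt (hGi (σ k))) (hmt hG₀i) hae
      (hp.comp hσ.tendsto_atTop)

/-- The even part of a competitor has at most the same energy and the same positive volume. -/
lemma IsDatum.functional_even_part_le (hf : IsDatum φ f) (hb : -1 < b) (hb1 : b < 1)
    (h : IsPerturbation b w G) (ε κ : ℝ) :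
    functional b ε κ (unitBall n) (fun z => f z + 1 / 2 * (w z + w (reflect n z))) ≤
      functional b ε κ (unitBall n) (fun z => f z + w z) := by
  set u : Ext n → ℝ := fun z => f z + w z with hu
  -- Because `f` is even, symmetrizing the perturbation is the same as symmetrizing the whole
  -- competitor.
  have he : (fun z => f z + 1 / 2 * (w z + w (reflect n z))) =
      fun z => 1 / 2 * (u z + u (reflect n z)) := by
    ext z
    simp only [hu, hf.even]; ring
  have hgrad := (hf.isWeakGradOn.add h.isWeakGradOn).mono (subset_univ (unitBall n))
  have h2 : MemLp (fun z => (|z.snd| ^ (b / 2)) • (gradient f z + G z)) 2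
      (volume.restrict (unitBall n)) := by
    simp only [smul_add]
    exact (hf.memLp_gradient hb).add h.memLp_grad
  have htr := hf.isFlatTrace h.isWeakGradOn h.integrable (h.integrable_grad hb1) h.eq_zero
    h.grad_eq_zero (v := u) fun _ _ => rfl
  rw [he, functional, functional]
  refine add_le_add (energy_even_part_le hgrad h2) (le_of_eq ?_)
  congr 1
  refine posVolume_congr ?_
  filter_upwards [(htr.even_part hgrad).flatTrace_ae_eq, htr.flatTrace_ae_eq] with x h1 h2 hx
  rw [h1 hx, h2 hx]

lemma IsDatum.exists_minimizer (hf : IsDatum φ f) (hb : -1 < b) (hb1 : b < 1) {ε κ : ℝ}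
    (hε : 0 < ε) (hκ : 0 < κ) : ∃ w G, IsPerturbation b w G ∧ ∀ v, Admissible b φ v →
      functional b ε κ (unitBall n) (fun z => f z + w z) ≤ functional b ε κ (unitBall n) v := by
  set S : Set ℝ := functional b ε κ (unitBall n) '' {v | Admissible b φ v} with hS
  have hlow : ∀ v : Ext n → ℝ, energy b (unitBall n) v - ε * κ ≤
      functional b ε κ (unitBall n) v := fun v => by
    have := le_penal hε hκ (s := posVolume (unitBall n) v) ENNReal.toReal_nonneg
    rw [functional]; linarith
  have hne : S.Nonempty := ⟨_, _, hf.admissible_add hb hb1 (isPerturbation_zero b), rfl⟩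
  have hbdd : BddBelow S := ⟨-(ε * κ), by
    rintro _ ⟨v, -, rfl⟩
    linarith [hlow v, energy_nonneg b (unitBall n) v]⟩
  obtain ⟨s, hsa, hs, hsS⟩ := exists_seq_tendsto_sInf hne hbdd
  choose v hv hvs using hsS
  choose F hFE hFv using fun k => IsDatum.exists_gradSpace (f := f) (hv k)
  -- The energy is at most the functional plus `ε * κ`, and the functional along the antitone
  -- minimizing sequence is at most its first value `s 0`.
  have hFM : ∀ k, ‖F k‖ ≤ Real.sqrt (s 0 + ε * κ) := fun k => by
    refine Real.le_sqrt_of_sq_le ?_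
    rw [hFE]
    linarith [hlow (v k), hvs k, hsa (Nat.zero_le k)]
  obtain ⟨F₀, σ, hσ, hF⟩ := exists_subseq_tendsto_inner hFM
  -- The positive volumes lie in a compact interval, so a further subsequence makes them converge.
  -- The energies then converge too, to the infimum minus the penalization of `p`, and the two
  -- limits can be treated separately.
  obtain ⟨p, -, τ, hτ, hp⟩ := (isCompact_Icc (a := (0 : ℝ))
    (b := (volume (slice (unitBall n))).toReal)).tendsto_subseq
    (x := fun k => posVolume (unitBall n) (v (σ k))) fun k =>
      ⟨ENNReal.toReal_nonneg, posVolume_le _⟩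
  have hE : Tendsto (fun k => ‖F (σ (τ k))‖ ^ 2) atTop (𝓝 (sInf S - penal ε κ p)) := by
    refine ((hs.comp (hσ.tendsto_atTop.comp hτ.tendsto_atTop)).sub
      (((continuous_penal ε κ).tendsto p).comp hp)).congr fun k => ?_
    simp only [Function.comp_apply]
    rw [hFE, ← hvs, functional, add_sub_cancel_right]
  obtain ⟨w, G, hwG, h1, h2⟩ := hf.exists_limit hb hb1 (fun k => hv (σ (τ k)))
    (fun k => hFv (σ (τ k))) (fun k => hFM (σ (τ k)))
    (fun h => (hF h).comp hτ.tendsto_atTop) hE hp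
  refine ⟨w, G, hwG, fun v' hv' => ?_⟩
  calc functional b ε κ (unitBall n) (fun z => f z + w z)
      ≤ (sInf S - penal ε κ p) + penal ε κ p := add_le_add h1 (monotone_penal hε κ h2)
    _ = sInf S := by ring
    _ ≤ functional b ε κ (unitBall n) v' := csInf_le hbdd ⟨v', hv', rfl⟩

end Perturbation

end FractionalDesign

open FractionalDesign in
theorem lemma2p1 (n : ℕ) (hn : 1 ≤ n) (α ε w : ℝ) (hα0 : 0 < α) (hα1 : α < 1)
    (hε : 0 < ε) (hw : 0 < w)
    (φ : WithLp 2 (EuclideanSpace ℝ (Fin n) × ℝ) → ℝ) (hφ : ContDiff ℝ ∞ φ) :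
    ∃ u : WithLp 2 (EuclideanSpace ℝ (Fin n) × ℝ) → ℝ,
      Admissible (1 - 2 * α) φ u ∧
      (∀ x y, u (pt x (-y)) = u (pt x y)) ∧
      ∀ v : WithLp 2 (EuclideanSpace ℝ (Fin n) × ℝ) → ℝ, Admissible (1 - 2 * α) φ v →
        functional (1 - 2 * α) ε w (unitBall n) u ≤
          functional (1 - 2 * α) ε w (unitBall n) v := by
  obtain ⟨f, hf⟩ := exists_isDatum hφ
  have hb : -1 < 1 - 2 * α := by linarith
  have hb1 : 1 - 2 * α < 1 := by linarith
  obtain ⟨q, G, hqG, hmin⟩ := hf.exists_minimizer hb hb1 hε hw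
  -- The even part of the minimizer: its functional is no larger, so it is again a minimizer.
  refine ⟨fun z => f z + 1 / 2 * (q z + q (reflect n z)),
    hf.admissible_add hb hb1 hqG.even_part, fun x y => ?_, fun v hv =>
      (hf.functional_even_part_le hb hb1 hqG ε w).trans (hmin v hv)⟩
  have h1 : f (pt x (-y)) = f (pt x y) := by rw [← reflect_pt, hf.even]
  beta_reduce
  rw [reflect_pt, reflect_pt, neg_neg, h1, add_comm (q (pt x (-y)))]
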